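/- **Setting.** Let $\mathcal Q$ be a finite bipartite quiver with vertex set $V_{\rm source}\sqcup V_{\rm target}$ and arrows $h_1,\dots,h_n$ (parallel arrows allowed), where $h_k$ goes from ${\rm s}(h_k)\in V_{\rm source}$ to ${\rm t}(h_k)\in V_{\rm target}$. Let $\mathbf m=(m_\gamma)$ and $\mathbf u=(u_\gamma)$ be tuples of nonnegative integers indexed by the vertices. Page $k$ is the set of positions of an $m_{{\rm t}(h_k)}\times m_{{\rm s}(h_k)}$ matrix, and $$L=\{(i,j,k)\in\mathbb Z^3: 1\le k\le n,\ 1\le i\le m_{{\rm t}(h_k)},\ 1\le j\le m_{{\rm s}(h_k)}\}.$$ For $\alpha\in V_{\rm target}$ let $A_\alpha$ be the block matrix obtained by placing the pages $k$ with ${\rm t}(h_k)=\alpha$ side by side from left to right in increasing order of $k$; for $\beta\in V_{\rm source}$ let $A_\beta$ be obtained by stacking the pages $k$ with ${\rm s}(h_k)=\beta$ from top to bottom in increasing order of $k$. Let $a_\gamma\times b_\gamma$ be the size of $A_\gamma$ and let $\phi_\gamma:[1,a_\gamma]_{\mathbb Z}\times[1,b_\gamma]_{\mathbb Z}\to L$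 send a position of $A_\gamma$ to the corresponding $(i,j,k)$. Put $v_\alpha=\sum_{{\rm t}(h_k)=\alpha}u_{{\rm s}(h_k)}$ and $v_\beta=\sum_{{\rm s}(h_k)=\beta}u_{{\rm t}(h_k)}$, and assume that $0<u_\gamma\le\min(a_\gamma,b_\gamma)$ and $u_\gamma\le v_\gamma$ for every vertex $\gamma$. Points of $\mathbb Z^2$ are written (row, column), as for matrix entries. A *path* is a lattice path whose steps, read from its SW to its NE endpoint, are $(0,1)$ or $(-1,0)$; a *corner* is a vertex of it adjacent to both a horizontal and a vertical edge. A *road map* (of rank $\mathbf u$) consists, for each $\alpha\in V_{\rm target}$, of paths $H^\alpha_p$ ($1\le p\le u_\alpha$) in $A_\alpha$ with endpoints $(a_\alpha-u_\alpha+p,1)$ and $(p,b_\alpha)$, pairwise without common vertex, and, for each $\beta\in V_{\rm source}$, of paths $V^\beta_q$ ($1\le q\le u_\beta$) in $A_\beta$ with endpoints $(1,b_\beta-u_\beta+q)$ and $(a_\beta,q)$, pairwise without common vertex. For a path $P$ of $A_\gamma$, write $P|_k$ for its restriction to page $k$ (positions being identified through $\phi_\gamma$). A road map is *straight* if each corner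 of a path $H^\alpha_p$ lies (as a point of $L$) on some $V^\beta_q$ and each corner of a path $V^\beta_q$ lies on some $H^\alpha_p$. A set $C\subseteq L$ is a *concurrent vertex map* if there is a straight road map such that $C$ is exactly the set of $(i,j,k)\in L$ lying on some $H^{{\rm t}(h_k)}_p|_k$ and on some $V^{{\rm s}(h_k)}_q|_k$; such a road map is said to correspond to $C$. A finite set of lattice points is a *diagonal chain* if it can be listed as $(i_1,j_1),\dots,(i_s,j_s)$ with $i_1<\dots<i_s$ and $j_1<\dots<j_s$; its size is $s$. For $C\subseteq L$ put $C^\gamma=\phi_\gamma^{-1}(C)$. $C$ is *$\mathbf u$-compatible* if for every vertex $\gamma$, $C^\gamma$ contains no diagonal chain of size $u_\gamma+1$, and *maximal $\mathbf u$-compatible* if moreover it is not properly contained in a $\mathbf u$-compatible subset of $L$. For $(i,j,k)\in L$ with $\alpha={\rm t}(h_k)$, $(i,j')=\phi_\alpha^{-1}(i,j,k)$, let $r_{ijk}$ (resp. $s_{ijk}$) be the maximal size of a diagonal chain in $C^\alpha$ all of whose points $(x,y)$ satisfy $x<i,\ y<j'$ (resp. $x>i,\ y>j'$), and let $$\bar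 r_{ijk}=\max\bigl(r_{ijk},\min(i-1,\,u_\alpha-1-\min(a_\alpha-i,b_\alpha-j'))\bigr),\qquad \bar s_{ijk}=\max\bigl(s_{ijk},\min(a_\alpha-i,\,u_\alpha-\min(i,j'))\bigr).$$ With $\beta={\rm s}(h_k)$, $(i',j)=\phi_\beta^{-1}(i,j,k)$, let $r'_{ijk}$ (resp. $s'_{ijk}$) be the maximal size of a diagonal chain in $C^\beta$ all of whose points $(x,y)$ satisfy $x<i',\ y<j$ (resp. $x>i',\ y>j$), and let $$\bar r'_{ijk}=\max\bigl(r'_{ijk},\min(j-1,\,u_\beta-1-\min(b_\beta-j,a_\beta-i'))\bigr),\qquad \bar s'_{ijk}=\max\bigl(s'_{ijk},\min(b_\beta-j,\,u_\beta-\min(i',j))\bigr).$$ **Proposition.** For $C\subseteq L$ the following are equivalent: (i) $C$ is a concurrent vertex map; (ii) $C$ is maximal $\mathbf u$-compatible; (iii) $C$ is $\mathbf u$-compatible and $$|C|=N_{\mathcal Q,\mathbf m,\mathbf u}:=\sum_{k}u_{{\rm s}(h_k)}u_{{\rm t}(h_k)}+\sum_{\alpha\in V_{\rm target}}u_\alpha(a_\alpha-u_\alpha)+\sum_{\beta\in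 V_{\rm source}}u_\beta(b_\beta-u_\beta);$$ (iv) for every $(i,j,k)\in L$: $(i,j,k)\in C$ if and only if $r_{ijk}+s_{ijk}<u_{{\rm t}(h_k)}$ and $r'_{ijk}+s'_{ijk}<u_{{\rm s}(h_k)}$; (v) for every $(i,j,k)\in L$: $\bar r_{ijk}+\bar s_{ijk}\in\{u_{{\rm t}(h_k)}-1,u_{{\rm t}(h_k)}\}$ and $\bar r'_{ijk}+\bar s'_{ijk}\in\{u_{{\rm s}(h_k)}-1,u_{{\rm s}(h_k)}\}$, and $(i,j,k)\in C$ if and only if $\bar r_{ijk}+\bar s_{ijk}=u_{{\rm t}(h_k)}-1$ and $\bar r'_{ijk}+\bar s'_{ijk}=u_{{\rm s}(h_k)}-1$. Moreover, if $C$ is a concurrent vertex map, then exactly one straight road map corresponds to $C$, and it is the only road map satisfying the following conditions for all $(i,j,k)\in L$, $1\le p\le u_{{\rm t}(h_k)}$, $1\le q\le u_{{\rm s}(h_k)}$: - $(i,j)\in H^{{\rm t}(h_k)}_p|_k$ if and only if $\bar r_{ijk}=p-1$ and $\bar s_{ijk}=u_{{\rm t}(h_k)}-p$; - $(i,j)\in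 V^{{\rm s}(h_k)}_q|_k$ if and only if $\bar r'_{ijk}=q-1$ and $\bar s'_{ijk}=u_{{\rm s}(h_k)}-q$. -/

import Mathlib

noncomputable section

/-- A bipartite quiver with source vertices `S`, target vertices `T`, and arrows indexed by `Fin n`
(arrow `k` goes from `src k` to `tgt k`; parallel arrows are allowed), together with the
nonnegative integers `m` and `u` attached to its vertices. -/
structure BipartiteDatum (S T : Type*) (n : ℕ) where
  src : Fin n → S
  tgt : Fin n → T
  mS : S → ℕ
  mT : T → ℕ
  uS : S → ℕ
  uT : T → ℕ

/-- A finite set of lattice points is a diagonal chain if any two distinct points of it are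
strictly comparable in both coordinates. Its size is its cardinality. -/
def IsDiagonalChain (X : Finset (ℤ × ℤ)) : Prop :=
  ∀ P ∈ X, ∀ Q ∈ X, P ≠ Q → (P.1 < Q.1 ∧ P.2 < Q.2) ∨ (Q.1 < P.1 ∧ Q.2 < P.2)

open scoped Classical in
/-- The maximal size of a diagonal chain contained in `X`. -/
def maxChainSize (X : Finset (ℤ × ℤ)) : ℕ :=
  (X.powerset.filter IsDiagonalChain).sup Finset.card

/-- The maximal size of a diagonal chain in the part of `X` strictly north-west of `P`
(first coordinates are row indices, increasing to the south). -/
def chainNW (X : Finset (ℤ × ℤ)) (P : ℤ × ℤ) : ℕ :=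
  maxChainSize (X.filter fun Q => Q.1 ≤ P.1 - 1 ∧ Q.2 ≤ P.2 - 1)

/-- The maximal size of a diagonal chain in the part of `X` strictly south-east of `P`. -/
def chainSE (X : Finset (ℤ × ℤ)) (P : ℤ × ℤ) : ℕ :=
  maxChainSize (X.filter fun Q => P.1 + 1 ≤ Q.1 ∧ P.2 + 1 ≤ Q.2)

/-- A unit step to the east or to the north. -/
def LatticeStep (P Q : ℤ × ℤ) : Prop :=
  Q = (P.1, P.2 + 1) ∨ Q = (P.1 - 1, P.2)

/-- `l` is the list of vertices, from south-west to north-east, of a lattice path with SW endpoint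
`P` and NE endpoint `Q`. -/
def IsLatticePath (P Q : ℤ × ℤ) (l : List (ℤ × ℤ)) : Prop :=
  l.IsChain LatticeStep ∧ l.head? = some P ∧ l.getLast? = some Q

/-- A corner of a path: a vertex that is an endpoint of a horizontal edge and of a vertical edge of
the path. -/
def IsPathCorner (l : List (ℤ × ℤ)) (R : ℤ × ℤ) : Prop :=
  (∃ P Q, [P, Q] <:+: l ∧ P.1 = Q.1 ∧ (R = P ∨ R = Q)) ∧
  (∃ P Q, [P, Q] <:+: l ∧ P.2 = Q.2 ∧ (R = P ∨ R = Q))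

namespace BipartiteDatum

variable {S T : Type*} {n : ℕ} (D : BipartiteDatum S T n)

/-- Number of rows of the block matrix at a target vertex. -/
def aT (α : T) : ℕ := D.mT α

open scoped Classical in
/-- Number of columns of the block matrix at a target vertex. -/
def bT (α : T) : ℕ := ∑ k ∈ Finset.univ.filter (fun k => D.tgt k = α), D.mS (D.src k)

open scoped Classical in
/-- Number of rows of the block matrix at a source vertex. -/
def aS (β : S) : ℕ := ∑ k ∈ Finset.univ.filter (fun k => D.src k = β), D.mT (D.tgt k)

/-- Number of columns of the block matrix at a source vertex. -/
def bS (β : S) : ℕ := D.mS β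

open scoped Classical in
/-- The number `v` at a target vertex. -/
def vT (α : T) : ℕ := ∑ k ∈ Finset.univ.filter (fun k => D.tgt k = α), D.uS (D.src k)

open scoped Classical in
/-- The number `v` at a source vertex. -/
def vS (β : S) : ℕ := ∑ k ∈ Finset.univ.filter (fun k => D.src k = β), D.uT (D.tgt k)

/-- The standing assumption on `u`. -/
def Admissible : Prop :=
  (∀ α, 0 < D.uT α ∧ D.uT α ≤ min (D.aT α) (D.bT α) ∧ D.uT α ≤ D.vT α) ∧
  (∀ β, 0 < D.uS β ∧ D.uS β ≤ min (D.aS β) (D.bS β) ∧ D.uS β ≤ D.vS β)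

/-- The set `L` of triples `(i, j, k)` where `(i, j)` is an entry (counted from 1) of the matrix
on page `k`, which has `mT (tgt k)` rows and `mS (src k)` columns. -/
def L : Set (ℤ × ℤ × Fin n) :=
  {x | 1 ≤ x.1 ∧ x.1 ≤ D.mT (D.tgt x.2.2) ∧ 1 ≤ x.2.1 ∧ x.2.1 ≤ D.mS (D.src x.2.2)}

open scoped Classical in
/-- The position of the entry `(i, j)` of page `k` in the block matrix at the target of arrow `k`;
in that matrix the pages are placed from left to right in the order of their indices. -/
def posT (x : ℤ × ℤ × Fin n) : ℤ × ℤ :=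
  (x.1, (∑ l ∈ Finset.univ.filter (fun l => l < x.2.2 ∧ D.tgt l = D.tgt x.2.2),
    (D.mS (D.src l) : ℤ)) + x.2.1)

open scoped Classical in
/-- The position of the entry `(i, j)` of page `k` in the block matrix at the source of arrow `k`;
in that matrix the pages are placed from top to bottom in the order of their indices. -/
def posS (x : ℤ × ℤ × Fin n) : ℤ × ℤ :=
  ((∑ l ∈ Finset.univ.filter (fun l => l < x.2.2 ∧ D.src l = D.src x.2.2),
    (D.mT (D.tgt l) : ℤ)) + x.1, x.2.1)

open scoped Classical in
/-- The part of `C` lying in the block matrix at the target vertex `α`. -/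
def partT (C : Finset (ℤ × ℤ × Fin n)) (α : T) : Finset (ℤ × ℤ) :=
  (C.filter fun x => D.tgt x.2.2 = α).image D.posT

open scoped Classical in
/-- The part of `C` lying in the block matrix at the source vertex `β`. -/
def partS (C : Finset (ℤ × ℤ × Fin n)) (β : S) : Finset (ℤ × ℤ) :=
  (C.filter fun x => D.src x.2.2 = β).image D.posS

/-- The number `r` at the point `x`, computed at the target of its arrow. -/
def rT (C : Finset (ℤ × ℤ × Fin n)) (x : ℤ × ℤ × Fin n) : ℕ :=
  chainNW (D.partT C (D.tgt x.2.2)) (D.posT x)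

/-- The number `s` at the point `x`, computed at the target of its arrow. -/
def sT (C : Finset (ℤ × ℤ × Fin n)) (x : ℤ × ℤ × Fin n) : ℕ :=
  chainSE (D.partT C (D.tgt x.2.2)) (D.posT x)

/-- The number `r'` at the point `x`, computed at the source of its arrow. -/
def rS (C : Finset (ℤ × ℤ × Fin n)) (x : ℤ × ℤ × Fin n) : ℕ :=
  chainNW (D.partS C (D.src x.2.2)) (D.posS x)

/-- The number `s'` at the point `x`, computed at the source of its arrow. -/
def sS (C : Finset (ℤ × ℤ × Fin n)) (x : ℤ × ℤ × Fin n) : ℕ :=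
  chainSE (D.partS C (D.src x.2.2)) (D.posS x)

/-- The number `r̄` at the point `x`. -/
def rbarT (C : Finset (ℤ × ℤ × Fin n)) (x : ℤ × ℤ × Fin n) : ℤ :=
  max (D.rT C x : ℤ) (min ((D.posT x).1 - 1)
    ((D.uT (D.tgt x.2.2) : ℤ) - 1 -
      min ((D.aT (D.tgt x.2.2) : ℤ) - (D.posT x).1) ((D.bT (D.tgt x.2.2) : ℤ) - (D.posT x).2)))

/-- The number `s̄` at the point `x`. -/
def sbarT (C : Finset (ℤ × ℤ × Fin n)) (x : ℤ × ℤ × Fin n) : ℤ :=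
  max (D.sT C x : ℤ) (min ((D.aT (D.tgt x.2.2) : ℤ) - (D.posT x).1)
    ((D.uT (D.tgt x.2.2) : ℤ) - min (D.posT x).1 (D.posT x).2))

/-- The number `r̄'` at the point `x`. -/
def rbarS (C : Finset (ℤ × ℤ × Fin n)) (x : ℤ × ℤ × Fin n) : ℤ :=
  max (D.rS C x : ℤ) (min ((D.posS x).2 - 1)
    ((D.uS (D.src x.2.2) : ℤ) - 1 -
      min ((D.bS (D.src x.2.2) : ℤ) - (D.posS x).2) ((D.aS (D.src x.2.2) : ℤ) - (D.posS x).1)))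

/-- The number `s̄'` at the point `x`. -/
def sbarS (C : Finset (ℤ × ℤ × Fin n)) (x : ℤ × ℤ × Fin n) : ℤ :=
  max (D.sS C x : ℤ) (min ((D.bS (D.src x.2.2) : ℤ) - (D.posS x).2)
    ((D.uS (D.src x.2.2) : ℤ) - min (D.posS x).1 (D.posS x).2))

/-- `C` is a `u`-compatible subset of `L`: no block matrix at a vertex `γ` contains a diagonal
chain of size `u_γ + 1` consisting of points of `C`. -/
def IsUCompatible (C : Finset (ℤ × ℤ × Fin n)) : Prop :=
  (C : Set (ℤ × ℤ × Fin n)) ⊆ D.L ∧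
  (∀ α, ¬ ∃ X ⊆ D.partT C α, IsDiagonalChain X ∧ X.card = D.uT α + 1) ∧
  (∀ β, ¬ ∃ X ⊆ D.partS C β, IsDiagonalChain X ∧ X.card = D.uS β + 1)

/-- `C` is a maximal `u`-compatible subset of `L`. -/
def IsMaximalUCompatible (C : Finset (ℤ × ℤ × Fin n)) : Prop :=
  D.IsUCompatible C ∧ ¬ ∃ C', D.IsUCompatible C' ∧ C ⊂ C'

/-- A road map of rank `u`. The index `p : Fin _` stands for `p.val + 1` in the usual numbering
from 1. Every path is recorded by its vertices from south-west to north-east. -/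
structure RoadMap where
  H : (α : T) → Fin (D.uT α) → List (ℤ × ℤ)
  V : (β : S) → Fin (D.uS β) → List (ℤ × ℤ)
  isPath_H : ∀ α p, IsLatticePath
    ((D.aT α : ℤ) - D.uT α + (p.val + 1 : ℤ), 1) ((p.val + 1 : ℤ), (D.bT α : ℤ)) (H α p)
  isPath_V : ∀ β q, IsLatticePath
    ((D.aS β : ℤ), (q.val + 1 : ℤ)) (1, (D.bS β : ℤ) - D.uS β + (q.val + 1 : ℤ)) (V β q)
  disjoint_H : ∀ α p p', p ≠ p' → (H α p).Disjoint (H α p')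
  disjoint_V : ∀ β q q', q ≠ q' → (V β q).Disjoint (V β q')

variable {D}

/-- The point `x` of `L` lies on some horizontal path. -/
def RoadMap.OnH (R : D.RoadMap) (x : ℤ × ℤ × Fin n) : Prop :=
  ∃ p, D.posT x ∈ R.H (D.tgt x.2.2) p

/-- The point `x` of `L` lies on some vertical path. -/
def RoadMap.OnV (R : D.RoadMap) (x : ℤ × ℤ × Fin n) : Prop :=
  ∃ q, D.posS x ∈ R.V (D.src x.2.2) q

/-- A road map is straight if each corner of a horizontal path lies in a vertical path and each
corner of a vertical path lies in a horizontal path. -/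
def RoadMap.IsStraight (R : D.RoadMap) : Prop :=
  (∀ α p P, IsPathCorner (R.H α p) P → ∃ x ∈ D.L, D.tgt x.2.2 = α ∧ D.posT x = P ∧ R.OnV x) ∧
  (∀ β q P, IsPathCorner (R.V β q) P → ∃ x ∈ D.L, D.src x.2.2 = β ∧ D.posS x = P ∧ R.OnH x)

/-- `C` consists of the points of `L` lying on a horizontal and on a vertical path of `R`. -/
def RoadMap.Induces (R : D.RoadMap) (C : Finset (ℤ × ℤ × Fin n)) : Prop :=
  ∀ x, x ∈ C ↔ x ∈ D.L ∧ R.OnH x ∧ R.OnV x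

variable (D)

/-- `C` is a concurrent vertex map. -/
def IsConcurrentVertexMap (C : Finset (ℤ × ℤ × Fin n)) : Prop :=
  ∃ R : D.RoadMap, R.IsStraight ∧ R.Induces C

/-- The number `N_{Q,m,u}`. -/
def N [Fintype S] [Fintype T] : ℤ :=
  (∑ k : Fin n, (D.uS (D.src k) : ℤ) * D.uT (D.tgt k)) +
  (∑ α : T, (D.uT α : ℤ) * ((D.aT α : ℤ) - D.uT α)) +
  (∑ β : S, (D.uS β : ℤ) * ((D.bS β : ℤ) - D.uS β))

end BipartiteDatum

end

/-! A path is encoded by the row `f t` of its point on each diagonal `j - i = t` and prolonged by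
horizontal rays at both ends; disjoint paths become strictly ordered functions. Statements at a
source are the transposed statements at a target of the reversed quiver `op`.

From road maps to numbers. Let `X` consist of points of the `u` paths in one matrix and contain
their corners. A chain meets each path at most once, so the chains north-west of `P` are no longer
than the number of paths passing north-west of `P`. Conversely, such a path has a north-west corner
strictly north-west of `P`, unless its starting row alone forces it to pass there; the preceding
path passes north-west of that corner, and so on, which builds a chain. The correction terms count
the paths forced by their endpoints, so r̄ and s̄ are the numbers of paths passing north-west and
south-east of `P` (`rho_eq`, `sigma_eq`). Hence r̄ + s̄ is `u - 1` on the paths and `u` off them,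
where even r + s ≥ `u`. This gives the two pointwise criteria and determines the road map.

From numbers to road maps. Either criterion makes `C` saturated (`IsSaturated`). The paths are then
the level lines of r̄, and `C` is the set of points common to both families
(`IsLevelMap.isInducedBy`). A north-west corner of a level line lies in `C`, because r̄ jumps there;
the only exception is a jump of the correction term, for which `u ≤ v` supplies a chain of `C` in
the first `u` rows (`IsLevelMap.exists_mem_row`). For south-east corners nothing new is needed: if
all north-west corners lie on transverse paths, then so does every vertical edge of a horizontal
path (`PageSystem.sign_mono`, `PageSystem.vertical`).

Cardinality. On a page, a horizontal and a vertical path share exactly one more vertex than edges.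
Each vertical edge of a horizontal path belongs to exactly one vertical path, and symmetrically, so
counting edges gives `N` (`card_eq_N`). A compatible set with `N` points therefore equals any
maximal compatible set containing it. -/

noncomputable section

open Finset

/-! ### Diagonal chains: maximal sizes, symmetries, concatenation. -/

theorem IsDiagonalChain.subset {X Y : Finset (ℤ × ℤ)} (hX : IsDiagonalChain X) (h : Y ⊆ X) :
    IsDiagonalChain Y := fun P hP Q hQ => hX P (h hP) Q (h hQ)

theorem card_le_maxChainSize {X Y : Finset (ℤ × ℤ)} (h : Y ⊆ X) (hY : IsDiagonalChain Y) :
    Y.card ≤ maxChainSize X := by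
  classical
  exact Finset.le_sup (f := Finset.card) (mem_filter.2 ⟨mem_powerset.2 h, hY⟩)

theorem exists_chain_card_eq (X : Finset (ℤ × ℤ)) :
    ∃ Y ⊆ X, IsDiagonalChain Y ∧ Y.card = maxChainSize X := by
  classical
  have hne : (X.powerset.filter IsDiagonalChain).Nonempty :=
    ⟨∅, mem_filter.2 ⟨mem_powerset.2 (empty_subset _), fun P hP => by simp at hP⟩⟩
  obtain ⟨Y, hY, h⟩ := Finset.exists_mem_eq_sup _ hne Finset.card
  rw [mem_filter, mem_powerset] at hY
  exact ⟨Y, hY.1, hY.2, h.symm⟩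

theorem maxChainSize_le_iff {X : Finset (ℤ × ℤ)} {u : ℕ} :
    maxChainSize X ≤ u ↔ ∀ Y ⊆ X, IsDiagonalChain Y → Y.card ≤ u := by
  refine ⟨fun h Y hY hc => (card_le_maxChainSize hY hc).trans h, fun h => ?_⟩
  obtain ⟨Y, hY, hc, h'⟩ := exists_chain_card_eq X
  exact h' ▸ h Y hY hc

theorem maxChainSize_le_iff_not_exists {X : Finset (ℤ × ℤ)} {u : ℕ} :
    maxChainSize X ≤ u ↔ ¬ ∃ Y ⊆ X, IsDiagonalChain Y ∧ Y.card = u + 1 := by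
  rw [maxChainSize_le_iff]
  constructor
  · rintro h ⟨Y, hY, hc, h'⟩
    have := h Y hY hc
    omega
  · intro h Y hY hc
    by_contra hlt
    obtain ⟨Z, hZ, hcard⟩ := exists_subset_card_eq (show u + 1 ≤ Y.card by omega)
    exact h ⟨Z, hZ.trans hY, hc.subset hZ, hcard⟩

theorem maxChainSize_mono {X Y : Finset (ℤ × ℤ)} (h : X ⊆ Y) :
    maxChainSize X ≤ maxChainSize Y :=
  maxChainSize_le_iff.2 fun _ hZ hc => card_le_maxChainSize (hZ.trans h) hc

/-- Applied to transposition, which reduces sources to targets, and to the point reflection, which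
reduces south-east chains to north-west ones. -/
theorem maxChainSize_image (X : Finset (ℤ × ℤ)) (e : ℤ × ℤ → ℤ × ℤ) (he : Function.Injective e)
    (hc : ∀ Y : Finset (ℤ × ℤ), IsDiagonalChain (Y.image e) ↔ IsDiagonalChain Y) :
    maxChainSize (X.image e) = maxChainSize X := by
  apply le_antisymm
  · rw [maxChainSize_le_iff]
    intro Y hY hYc
    obtain ⟨Z, hZ, rfl⟩ := subset_image_iff.1 hY
    rw [card_image_of_injective _ he]
    exact card_le_maxChainSize hZ ((hc Z).1 hYc)
  · rw [maxChainSize_le_iff]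
    intro Y hY hYc
    rw [← card_image_of_injective Y he]
    exact card_le_maxChainSize (image_subset_image hY) ((hc Y).2 hYc)

theorem isDiagonalChain_image_swap (Y : Finset (ℤ × ℤ)) :
    IsDiagonalChain (Y.image Prod.swap) ↔ IsDiagonalChain Y := by
  simp only [IsDiagonalChain, forall_mem_image, Prod.fst_swap, Prod.snd_swap, ne_eq,
    Prod.swap_inj]
  refine forall₄_congr fun P _ Q _ => ?_
  tauto

/-- The point reflection exchanging `(1, 1)` and `(a, b)`. -/
def pointReflection (a b : ℤ) (P : ℤ × ℤ) : ℤ × ℤ := (a + 1 - P.1, b + 1 - P.2)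

theorem pointReflection_injective (a b : ℤ) : Function.Injective (pointReflection a b) := by
  intro P Q h
  simp only [pointReflection, Prod.mk.injEq] at h
  ext <;> omega

theorem isDiagonalChain_image_pointReflection (a b : ℤ) (Y : Finset (ℤ × ℤ)) :
    IsDiagonalChain (Y.image (pointReflection a b)) ↔ IsDiagonalChain Y := by
  simp only [IsDiagonalChain, forall_mem_image, ne_eq, (pointReflection_injective a b).eq_iff]
  refine forall₄_congr fun P _ Q _ => ?_
  simp only [pointReflection]
  constructor <;> intro h hne <;> rcases h hne with h | h <;> omega

theorem chainNW_image_swap (X : Finset (ℤ × ℤ)) (P : ℤ × ℤ) :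
    chainNW (X.image Prod.swap) P.swap = chainNW X P := by
  unfold chainNW
  refine Eq.trans ?_ (maxChainSize_image _ _ Prod.swap_injective isDiagonalChain_image_swap)
  congr 1
  ext Q
  simp only [mem_filter, mem_image, Prod.exists, Prod.fst_swap, Prod.snd_swap]
  constructor
  · rintro ⟨⟨i, j, h, rfl⟩, h'⟩
    exact ⟨i, j, ⟨h, h'.2, h'.1⟩, rfl⟩
  · rintro ⟨i, j, ⟨h, h'⟩, rfl⟩
    exact ⟨⟨i, j, h, rfl⟩, h'.2, h'.1⟩

theorem chainSE_image_swap (X : Finset (ℤ × ℤ)) (P : ℤ × ℤ) :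
    chainSE (X.image Prod.swap) P.swap = chainSE X P := by
  unfold chainSE
  refine Eq.trans ?_ (maxChainSize_image _ _ Prod.swap_injective isDiagonalChain_image_swap)
  congr 1
  ext Q
  simp only [mem_filter, mem_image, Prod.exists, Prod.fst_swap, Prod.snd_swap]
  constructor
  · rintro ⟨⟨i, j, h, rfl⟩, h'⟩
    exact ⟨i, j, ⟨h, h'.2, h'.1⟩, rfl⟩
  · rintro ⟨i, j, ⟨h, h'⟩, rfl⟩
    exact ⟨⟨i, j, h, rfl⟩, h'.2, h'.1⟩

theorem chainNW_image_pointReflection (a b : ℤ) (X : Finset (ℤ × ℤ)) (P : ℤ × ℤ) :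
    chainNW (X.image (pointReflection a b)) (pointReflection a b P) = chainSE X P := by
  unfold chainNW chainSE
  refine Eq.trans ?_ (maxChainSize_image _ _ (pointReflection_injective a b)
    (isDiagonalChain_image_pointReflection a b))
  congr 1
  ext Q
  rw [mem_filter]
  simp only [mem_filter, mem_image, Prod.exists, pointReflection]
  constructor
  · rintro ⟨⟨i, j, h, rfl⟩, h'⟩
    exact ⟨i, j, ⟨h, by omega⟩, rfl⟩
  · rintro ⟨i, j, ⟨h, h'⟩, rfl⟩
    exact ⟨⟨i, j, h, rfl⟩, by omega⟩

theorem chainNW_le_chainNW (X : Finset (ℤ × ℤ)) {P Q : ℤ × ℤ} (h1 : P.1 ≤ Q.1) (h2 : P.2 ≤ Q.2) :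
    chainNW X P ≤ chainNW X Q :=
  maxChainSize_mono fun R hR => by
    simp only [mem_filter] at hR ⊢
    exact ⟨hR.1, by omega⟩

theorem chainNW_mono {X Y : Finset (ℤ × ℤ)} (h : X ⊆ Y) (P : ℤ × ℤ) :
    chainNW X P ≤ chainNW Y P := maxChainSize_mono (filter_subset_filter _ h)

theorem chainSE_mono {X Y : Finset (ℤ × ℤ)} (h : X ⊆ Y) (P : ℤ × ℤ) :
    chainSE X P ≤ chainSE Y P := maxChainSize_mono (filter_subset_filter _ h)

theorem IsDiagonalChain.card_fst {Y : Finset (ℤ × ℤ)} (hY : IsDiagonalChain Y) {lo hi : ℤ}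
    (h : ∀ P ∈ Y, lo ≤ P.1 ∧ P.1 < hi) : (Y.card : ℤ) ≤ max 0 (hi - lo) := by
  have := Finset.card_le_card_of_injOn (s := Y) (t := Finset.Ico lo hi) Prod.fst
    (fun P hP => by simpa using h P hP) (fun P hP Q hQ e => by
      by_contra hne
      have := hY P hP Q hQ hne
      omega)
  rw [Int.card_Ico] at this
  omega

theorem IsDiagonalChain.card_snd {Y : Finset (ℤ × ℤ)} (hY : IsDiagonalChain Y) {lo hi : ℤ}
    (h : ∀ P ∈ Y, lo ≤ P.2 ∧ P.2 < hi) : (Y.card : ℤ) ≤ max 0 (hi - lo) := by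
  have := Finset.card_le_card_of_injOn (s := Y) (t := Finset.Ico lo hi) Prod.snd
    (fun P hP => by simpa using h P hP) (fun P hP Q hQ e => by
      by_contra hne
      have := hY P hP Q hQ hne
      omega)
  rw [Int.card_Ico] at this
  omega

/-- A set of lattice points is contained in the matrix positions of an `a` by `b` matrix. -/
def InBox (a b : ℕ) (X : Finset (ℤ × ℤ)) : Prop :=
  ∀ P ∈ X, 1 ≤ P.1 ∧ P.1 ≤ a ∧ 1 ≤ P.2 ∧ P.2 ≤ b

theorem InBox.chainNW_le_fst {a b : ℕ} {X : Finset (ℤ × ℤ)} (hX : InBox a b X) (P : ℤ × ℤ) :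
    (chainNW X P : ℤ) ≤ max 0 (P.1 - 1) := by
  obtain ⟨Y, hY, hc, h⟩ := exists_chain_card_eq (X.filter fun Q => Q.1 ≤ P.1 - 1 ∧ Q.2 ≤ P.2 - 1)
  rw [chainNW, ← h]
  refine hc.card_fst fun Q hQ => ?_
  have := mem_filter.1 (hY hQ)
  have := hX Q this.1
  omega

theorem InBox.chainNW_le_snd {a b : ℕ} {X : Finset (ℤ × ℤ)} (hX : InBox a b X) (P : ℤ × ℤ) :
    (chainNW X P : ℤ) ≤ max 0 (P.2 - 1) := by
  obtain ⟨Y, hY, hc, h⟩ := exists_chain_card_eq (X.filter fun Q => Q.1 ≤ P.1 - 1 ∧ Q.2 ≤ P.2 - 1)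
  rw [chainNW, ← h]
  refine hc.card_snd fun Q hQ => ?_
  have := mem_filter.1 (hY hQ)
  have := hX Q this.1
  omega

theorem InBox.chainSE_le_fst {a b : ℕ} {X : Finset (ℤ × ℤ)} (hX : InBox a b X) (P : ℤ × ℤ) :
    (chainSE X P : ℤ) ≤ max 0 (a - P.1) := by
  obtain ⟨Y, hY, hc, h⟩ := exists_chain_card_eq (X.filter fun Q => P.1 + 1 ≤ Q.1 ∧ P.2 + 1 ≤ Q.2)
  rw [chainSE, ← h]
  have := hc.card_fst (lo := P.1 + 1) (hi := a + 1) fun Q hQ => by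
    have := mem_filter.1 (hY hQ)
    have := hX Q this.1
    omega
  omega

theorem InBox.chainSE_le_snd {a b : ℕ} {X : Finset (ℤ × ℤ)} (hX : InBox a b X) (P : ℤ × ℤ) :
    (chainSE X P : ℤ) ≤ max 0 (b - P.2) := by
  obtain ⟨Y, hY, hc, h⟩ := exists_chain_card_eq (X.filter fun Q => P.1 + 1 ≤ Q.1 ∧ P.2 + 1 ≤ Q.2)
  rw [chainSE, ← h]
  have := hc.card_snd (lo := P.2 + 1) (hi := b + 1) fun Q hQ => by
    have := mem_filter.1 (hY hQ)
    have := hX Q this.1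
    omega
  omega

theorem IsDiagonalChain.union {Y Z : Finset (ℤ × ℤ)} (hY : IsDiagonalChain Y)
    (hZ : IsDiagonalChain Z) (h : ∀ P ∈ Y, ∀ Q ∈ Z, P.1 < Q.1 ∧ P.2 < Q.2) :
    IsDiagonalChain (Y ∪ Z) ∧ (Y ∪ Z).card = Y.card + Z.card := by
  constructor
  · intro P hP Q hQ hne
    rcases mem_union.1 hP with hP | hP <;> rcases mem_union.1 hQ with hQ | hQ
    · exact hY P hP Q hQ hne
    · exact Or.inl (h P hP Q hQ)
    · exact Or.inr (h Q hQ P hP)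
    · exact hZ P hP Q hQ hne
  · refine card_union_of_disjoint (disjoint_left.2 fun P hP hP' => ?_)
    have := h P hP P hP'
    omega

theorem isDiagonalChain_singleton (P : ℤ × ℤ) : IsDiagonalChain {P} := by
  intro Q hQ R hR hne
  rw [mem_singleton] at hQ hR
  exact absurd (hQ.trans hR.symm) hne

/-- The two open quadrants stay separated as long as `P ≤ Q + (1, 1)`. The extreme case `P = Q + (1,
1)`, where the first quadrant contains `Q` itself, is the one used. -/
theorem chainNW_add_chainSE_le (X : Finset (ℤ × ℤ)) {P Q : ℤ × ℤ} (h1 : P.1 ≤ Q.1 + 1)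
    (h2 : P.2 ≤ Q.2 + 1) : chainNW X P + chainSE X Q ≤ maxChainSize X := by
  obtain ⟨Y, hY, hYc, hYe⟩ := exists_chain_card_eq
    (X.filter fun R => R.1 ≤ P.1 - 1 ∧ R.2 ≤ P.2 - 1)
  obtain ⟨Z, hZ, hZc, hZe⟩ := exists_chain_card_eq
    (X.filter fun R => Q.1 + 1 ≤ R.1 ∧ Q.2 + 1 ≤ R.2)
  rw [chainNW, chainSE, ← hYe, ← hZe]
  obtain ⟨hc, hcard⟩ := hYc.union hZc fun R hR R' hR' => by
    have := mem_filter.1 (hY hR)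
    have := mem_filter.1 (hZ hR')
    omega
  rw [← hcard]
  exact card_le_maxChainSize (union_subset (hY.trans (filter_subset _ _))
    (hZ.trans (filter_subset _ _))) hc

theorem chainNW_add_one_le {X : Finset (ℤ × ℤ)} {P Q : ℤ × ℤ} (hP : P ∈ X) (h1 : P.1 < Q.1)
    (h2 : P.2 < Q.2) : chainNW X P + 1 ≤ chainNW X Q := by
  obtain ⟨Y, hY, hYc, hYe⟩ := exists_chain_card_eq
    (X.filter fun R => R.1 ≤ P.1 - 1 ∧ R.2 ≤ P.2 - 1)
  rw [chainNW, ← hYe]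
  obtain ⟨hc, hcard⟩ := hYc.union (isDiagonalChain_singleton P) fun R hR R' hR' => by
    have := mem_filter.1 (hY hR)
    rw [mem_singleton.1 hR']
    omega
  rw [card_singleton] at hcard
  rw [← hcard]
  refine card_le_maxChainSize (fun R hR => ?_) hc
  rcases mem_union.1 hR with hR | hR
  · have := mem_filter.1 (hY hR)
    exact mem_filter.2 ⟨this.1, by omega⟩
  · rw [mem_singleton.1 hR]
    exact mem_filter.2 ⟨hP, by omega⟩

theorem chainNW_add_chainSE_add_one_le {X : Finset (ℤ × ℤ)} {P : ℤ × ℤ} (hP : P ∈ X) :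
    chainNW X P + chainSE X P + 1 ≤ maxChainSize X := by
  have h1 := chainNW_add_one_le (Q := (P.1 + 1, P.2 + 1)) hP (by simp) (by simp)
  have h2 := chainNW_add_chainSE_le X (P := (P.1 + 1, P.2 + 1)) (Q := P) le_rfl le_rfl
  omega

/-- A chain through `P` splits into its parts north-west and south-east of `P`. -/
theorem IsDiagonalChain.card_le {X Y : Finset (ℤ × ℤ)} (hY : IsDiagonalChain Y) {P : ℤ × ℤ}
    (hP : P ∈ Y) (h : ∀ Q ∈ Y, Q ≠ P → Q ∈ X) : Y.card ≤ chainNW X P + chainSE X P + 1 := by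
  have h1 : (Y.filter fun Q => Q.1 ≤ P.1 - 1 ∧ Q.2 ≤ P.2 - 1).card ≤ chainNW X P := by
    refine card_le_maxChainSize (fun Q hQ => ?_) (hY.subset (filter_subset _ _))
    have hQ := mem_filter.1 hQ
    exact mem_filter.2 ⟨h Q hQ.1 (by rintro rfl; omega), hQ.2⟩
  have h2 : (Y.filter fun Q => P.1 + 1 ≤ Q.1 ∧ P.2 + 1 ≤ Q.2).card ≤ chainSE X P := by
    refine card_le_maxChainSize (fun Q hQ => ?_) (hY.subset (filter_subset _ _))
    have hQ := mem_filter.1 hQ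
    exact mem_filter.2 ⟨h Q hQ.1 (by rintro rfl; omega), hQ.2⟩
  have h3 : Y ⊆ ((Y.filter fun Q => Q.1 ≤ P.1 - 1 ∧ Q.2 ≤ P.2 - 1) ∪
      (Y.filter fun Q => P.1 + 1 ≤ Q.1 ∧ P.2 + 1 ≤ Q.2)) ∪ {P} := by
    intro Q hQ
    by_cases e : Q = P
    · simp [e]
    · refine mem_union_left _ ?_
      rw [← filter_or]
      refine mem_filter.2 ⟨hQ, ?_⟩
      have := hY Q hQ P hP e
      omega
  have h4 := (card_le_card h3).trans (card_union_le _ _)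
  have h5 := card_union_le (Y.filter fun Q => Q.1 ≤ P.1 - 1 ∧ Q.2 ≤ P.2 - 1)
    (Y.filter fun Q => P.1 + 1 ≤ Q.1 ∧ P.2 + 1 ≤ Q.2)
  rw [card_singleton] at h4
  omega

theorem maxChainSize_insert_le (X : Finset (ℤ × ℤ)) (P : ℤ × ℤ) :
    maxChainSize (insert P X) ≤ max (maxChainSize X) (chainNW X P + chainSE X P + 1) := by
  rw [maxChainSize_le_iff]
  intro Y hY hc
  by_cases hP : P ∈ Y
  · exact (hc.card_le hP fun Q hQ hne => (mem_insert.1 (hY hQ)).resolve_left hne).trans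
      (le_max_right _ _)
  · refine (card_le_maxChainSize (fun Q hQ => ?_) hc).trans (le_max_left _ _)
    exact (mem_insert.1 (hY hQ)).resolve_left (by rintro rfl; exact hP hQ)

/-- A nonempty diagonal chain has a south-east most point. -/
theorem IsDiagonalChain.exists_last {Y : Finset (ℤ × ℤ)} (hY : IsDiagonalChain Y)
    (hne : Y.Nonempty) : ∃ P ∈ Y, ∀ Q ∈ Y, Q ≠ P → Q.1 < P.1 ∧ Q.2 < P.2 := by
  obtain ⟨P, hP, hmax⟩ := Y.exists_max_image Prod.fst hne
  refine ⟨P, hP, fun Q hQ hne => ?_⟩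
  have := hmax Q hQ
  have := hY Q hQ P hP hne
  omega

/-- If a chain north-west of `(i + 1, j + 1)` is longer than all chains north-west of `(i, j)`,
then its last point is near `(i, j)`. -/
theorem exists_mem_of_lt_chainNW {X : Finset (ℤ × ℤ)} {P : ℤ × ℤ} {m : ℕ}
    (h : m + 1 ≤ chainNW X P) :
    ∃ R ∈ X, R.1 < P.1 ∧ R.2 < P.2 ∧ m ≤ chainNW X R := by
  obtain ⟨Y, hY, hYc, hYe⟩ := exists_chain_card_eq
    (X.filter fun R => R.1 ≤ P.1 - 1 ∧ R.2 ≤ P.2 - 1)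
  rw [chainNW, ← hYe] at h
  obtain ⟨R, hR, hlast⟩ := hYc.exists_last (card_pos.1 (by omega))
  have hR' := mem_filter.1 (hY hR)
  refine ⟨R, hR'.1, by omega, by omega, ?_⟩
  have h1 : (Y.erase R).card ≤ chainNW X R := by
    refine card_le_maxChainSize (fun Q hQ => ?_) (hYc.subset (erase_subset _ _))
    have hQ := mem_erase.1 hQ
    have h2 := hlast Q hQ.2 hQ.1
    exact mem_filter.2 ⟨(mem_filter.1 (hY hQ.2)).1, by omega⟩
  rw [card_erase_of_mem hR] at h1
  omega

/-- The last point of a chain north-west of `P + (1, 1)` is weakly north-west of `P`, so the other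
points are strictly so. This is what makes distinct level lines disjoint. -/
theorem chainNW_succ_le (X : Finset (ℤ × ℤ)) (P : ℤ × ℤ) :
    chainNW X (P.1 + 1, P.2 + 1) ≤ chainNW X P + 1 := by
  by_contra h
  obtain ⟨R, -, h1, h2, h3⟩ := exists_mem_of_lt_chainNW (X := X) (P := (P.1 + 1, P.2 + 1))
    (m := chainNW X P + 1) (by omega)
  have := chainNW_le_chainNW X (P := R) (Q := P) (by simp at h1; omega) (by simp at h2; omega)
  omega

/-! ### Lattice paths as functions on diagonals. -/

/-- A point lies on the path whose point on the diagonal `j - i = t` is in row `f t`. -/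
def OnPath (f : ℤ → ℤ) (P : ℤ × ℤ) : Prop := f (P.2 - P.1) = P.1

/-- `f` describes a bi-infinite lattice path by the row of its point on each diagonal. -/
def IsPathFun (f : ℤ → ℤ) : Prop := ∀ t, f (t + 1) = f t ∨ f (t + 1) = f t - 1

theorem IsPathFun.anti {f : ℤ → ℤ} (hf : IsPathFun f) {s t : ℤ} (h : s ≤ t) : f t ≤ f s := by
  induction t, h using Int.leInduction with
  | base => exact le_rfl
  | succ t _ ih => have := hf t; omega

/-- The column on diagonal `t` is `f t + t`; together with `anti` this is the monotonicity of both
coordinates along a path. -/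
theorem IsPathFun.mono_add {f : ℤ → ℤ} (hf : IsPathFun f) {s t : ℤ} (h : s ≤ t) :
    f s + s ≤ f t + t := by
  induction t, h using Int.leInduction with
  | base => exact le_rfl
  | succ t _ ih => have := hf t; omega

theorem IsPathFun.pred {f : ℤ → ℤ} (hf : IsPathFun f) (t : ℤ) :
    f t = f (t - 1) ∨ f t = f (t - 1) - 1 := by
  have := hf (t - 1)
  rwa [sub_add_cancel] at this

/-- The first integer from `lo` on satisfying `P`. -/
theorem Int.exists_first {P : ℤ → Prop} {lo hi : ℤ} (h : lo ≤ hi) (hP : P hi) :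
    ∃ m, lo ≤ m ∧ m ≤ hi ∧ P m ∧ ∀ k, lo ≤ k → k < m → ¬ P k := by
  classical
  obtain ⟨m, hm, hmin⟩ := Int.exists_least_of_bdd (P := fun z => lo ≤ z ∧ P z)
    ⟨lo, fun z hz => hz.1⟩ ⟨hi, h, hP⟩
  exact ⟨m, hm.1, hmin hi ⟨h, hP⟩, hm.2, fun k hk hkm hPk =>
    absurd (hmin k ⟨hk, hPk⟩) (by omega)⟩

/-- The last integer up to `hi` satisfying `P`. -/
theorem Int.exists_last {P : ℤ → Prop} {lo hi : ℤ} (h : lo ≤ hi) (hP : P lo) :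
    ∃ m, lo ≤ m ∧ m ≤ hi ∧ P m ∧ ∀ k, m < k → k ≤ hi → ¬ P k := by
  classical
  obtain ⟨m, hm, hmax⟩ := Int.exists_greatest_of_bdd (P := fun z => z ≤ hi ∧ P z)
    ⟨hi, fun z hz => hz.1⟩ ⟨lo, h, hP⟩
  exact ⟨m, hmax lo ⟨h, hP⟩, hm.1, hm.2, fun k hk hkm hPk =>
    absurd (hmax k ⟨hkm, hPk⟩) (by omega)⟩

/-- The path `f` goes up to, and then to the right from, its point on diagonal `t`. -/
def IsNWCorner (f : ℤ → ℤ) (t : ℤ) : Prop := f (t - 1) = f t + 1 ∧ f (t + 1) = f t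

/-- The path `f` goes right to, and then up from, its point on diagonal `t`. -/
def IsSECorner (f : ℤ → ℤ) (t : ℤ) : Prop := f (t - 1) = f t ∧ f (t + 1) = f t - 1

theorem IsPathFun.exists_isNWCorner {f : ℤ → ℤ} (hf : IsPathFun f) {d e : ℤ} (hde : d + 1 < e)
    (hd : f (d + 1) = f d - 1) (he : f e = f (e - 1)) : ∃ t, d < t ∧ t < e ∧ IsNWCorner f t := by
  obtain ⟨t, h1, h2, h3, h4⟩ := Int.exists_first (P := fun t => f (t + 1) = f t) (lo := d + 1)
    (hi := e - 1) (by omega) (by simpa using he)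
  refine ⟨t, by omega, by omega, ?_, h3⟩
  rcases eq_or_lt_of_le h1 with rfl | h1
  · rw [hd]; simp
  · have h5 := h4 (t - 1) (by omega) (by omega)
    have h6 := hf.pred t
    rw [sub_add_cancel] at h5
    omega

/-- If `f` goes up at `t` and does not go up forever, there is a vertical run from `t` to a
corner. -/
theorem IsPathFun.exists_run {f : ℤ → ℤ} (hf : IsPathFun f) {t : ℤ} (ht : f (t + 1) = f t - 1)
    {lo : ℤ} (hlo : ∀ s, lo ≤ f s) :
    ∃ s, t < s ∧ IsNWCorner f s ∧ ∀ r, t ≤ r → r < s → f (r + 1) = f r - 1 := by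
  have hex : ∃ s, t + 1 ≤ s ∧ f (s + 1) = f s := by
    by_contra! hcon
    have key : ∀ s, t + 1 ≤ s → f s + s ≤ f (t + 1) + (t + 1) := by
      intro s hs
      induction s, hs using Int.leInduction with
      | base => exact le_rfl
      | succ s hs ih => have := hf s; have := hcon s hs; omega
    have h1 := key (max (t + 1) (f (t + 1) + (t + 1) - lo + 1)) (le_max_left _ _)
    have h2 := hlo (max (t + 1) (f (t + 1) + (t + 1) - lo + 1))
    omega
  obtain ⟨s', hs', hs''⟩ := hex
  obtain ⟨s, h1, h2, h3, h4⟩ := Int.exists_first (P := fun t => f (t + 1) = f t) hs' hs''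
  have hrun : ∀ r, t ≤ r → r < s → f (r + 1) = f r - 1 := by
    intro r hr hrs
    rcases eq_or_lt_of_le hr with rfl | hr
    · exact ht
    · have := h4 r (by omega) hrs
      have := hf r
      omega
  refine ⟨s, by omega, ⟨?_, h3⟩, hrun⟩
  have := hrun (s - 1) (by omega) (by omega)
  rw [sub_add_cancel] at this
  omega

/-- The vertices of the path `f` on the `m` diagonals from `t₀` on. -/
def pathList (f : ℤ → ℤ) (t₀ : ℤ) (m : ℕ) : List (ℤ × ℤ) :=
  (List.range m).map fun i : ℕ => (f (t₀ + i), f (t₀ + i) + (t₀ + i))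

theorem pathList_succ (f : ℤ → ℤ) (t₀ : ℤ) (m : ℕ) :
    pathList f t₀ (m + 1) = (f t₀, f t₀ + t₀) :: pathList f (t₀ + 1) m := by
  unfold pathList
  rw [List.range_succ_eq_map, List.map_cons, List.map_map]
  simp only [Nat.cast_zero, add_zero, List.cons.injEq, true_and]
  refine List.map_congr_left fun i _ => ?_
  simp only [Function.comp, Nat.succ_eq_add_one, Nat.cast_add, Nat.cast_one]
  rw [show t₀ + 1 + (i : ℤ) = t₀ + (i + 1) by ring]

theorem mem_pathList {f : ℤ → ℤ} {t₀ : ℤ} {m : ℕ} {P : ℤ × ℤ} :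
    P ∈ pathList f t₀ m ↔ t₀ ≤ P.2 - P.1 ∧ P.2 - P.1 < t₀ + m ∧ OnPath f P := by
  unfold pathList OnPath
  simp only [List.mem_map, List.mem_range]
  constructor
  · rintro ⟨i, hi, rfl⟩
    simp
    omega
  · rintro ⟨h1, h2, h3⟩
    refine ⟨(P.2 - P.1 - t₀).toNat, by omega, ?_⟩
    rw [show t₀ + ((P.2 - P.1 - t₀).toNat : ℤ) = P.2 - P.1 by omega, h3]
    ext <;> simp

theorem isLatticePath_pathList {f : ℤ → ℤ} (hf : IsPathFun f) (t₀ : ℤ) (m : ℕ) :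
    IsLatticePath (f t₀, f t₀ + t₀) (f (t₀ + m), f (t₀ + m) + (t₀ + m))
      (pathList f t₀ (m + 1)) := by
  induction m generalizing t₀ with
  | zero => simp [IsLatticePath, pathList]
  | succ m ih =>
    obtain ⟨h1, h2, h3⟩ := ih (t₀ + 1)
    rw [pathList_succ]
    refine ⟨?_, rfl, ?_⟩
    · rw [pathList_succ] at h1 ⊢
      rw [List.isChain_cons_cons]
      refine ⟨?_, h1⟩
      rcases hf t₀ with h | h
      · left; simp [h]; ring
      · right; simp [h]
    · rw [List.getLast?_cons, h3]
      simp only [Option.getD_some]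
      rw [show t₀ + 1 + (m : ℤ) = t₀ + ((m + 1 : ℕ) : ℤ) by push_cast; ring]

/-- Constant values of `f` beyond the ends are horizontal rays. They make `f` total, so that paths
can be compared on every diagonal. -/
theorem IsLatticePath.exists_pathFun {P Q : ℤ × ℤ} {l : List (ℤ × ℤ)} (h : IsLatticePath P Q l) :
    ∃ f, IsPathFun f ∧ (∀ t ≤ P.2 - P.1, f t = P.1) ∧ (∀ t, Q.2 - Q.1 ≤ t → f t = Q.1) ∧
      P.2 - P.1 ≤ Q.2 - Q.1 ∧
      l = pathList f (P.2 - P.1) (Q.2 - Q.1 - (P.2 - P.1) + 1).toNat := by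
  induction l generalizing P with
  | nil => simp [IsLatticePath] at h
  | cons R l ih =>
    obtain ⟨h1, h2, h3⟩ := h
    simp only [List.head?_cons, Option.some.injEq] at h2
    subst h2
    cases l with
    | nil =>
      simp only [List.getLast?_singleton, Option.some.injEq] at h3
      subst h3
      refine ⟨fun _ => R.1, fun t => Or.inl rfl, fun _ _ => rfl, fun _ _ => rfl, le_rfl, ?_⟩
      simp [pathList]
    | cons R' l =>
      rw [List.isChain_cons_cons] at h1
      obtain ⟨f, hf, hf1, hf2, hf3, hf4⟩ := ih (P := R') ⟨h1.2, rfl, by simpa using h3⟩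
      have hstep : R'.2 - R'.1 = R.2 - R.1 + 1 ∧ (R'.1 = R.1 ∨ R'.1 = R.1 - 1) := by
        rcases h1.1 with h | h <;> subst h <;> simp <;> omega
      have hg : ∀ t, R.2 - R.1 < t → (if t ≤ R.2 - R.1 then R.1 else f t) = f t :=
        fun t ht => if_neg (by omega)
      refine ⟨fun t => if t ≤ R.2 - R.1 then R.1 else f t, fun t => ?_, fun t ht => if_pos ht,
        fun t ht => ?_, by omega, ?_⟩
      · rcases lt_trichotomy t (R.2 - R.1) with ht | ht | ht
        · simp only [if_pos (show t + 1 ≤ R.2 - R.1 by omega), if_pos ht.le]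
          simp
        · subst ht
          simp only [le_refl, if_true]
          rw [hg _ (by omega), hf1 _ (by omega)]
          exact hstep.2
        · simp only [hg t ht, hg (t + 1) (by omega)]
          exact hf t
      · simp only [hg t (by omega)]
        exact hf2 t ht
      · rw [hf4, show (Q.2 - Q.1 - (R.2 - R.1) + 1).toNat =
          (Q.2 - Q.1 - (R'.2 - R'.1) + 1).toNat + 1 by omega, pathList_succ, ← hstep.1]
        congr 1
        · simp
        · unfold pathList
          refine List.map_congr_left fun i _ => ?_
          simp only [hg (R'.2 - R'.1 + i) (by omega)]

theorem infix_pathList {f : ℤ → ℤ} {t₀ : ℤ} {m : ℕ} {P Q : ℤ × ℤ} :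
    [P, Q] <:+: pathList f t₀ m ↔ ∃ t, t₀ ≤ t ∧ t + 1 < t₀ + m ∧ P = (f t, f t + t) ∧
      Q = (f (t + 1), f (t + 1) + (t + 1)) := by
  induction m generalizing t₀ with
  | zero =>
    simp only [pathList, List.range_zero, List.map_nil, List.infix_nil]
    constructor
    · simp
    · rintro ⟨t, h1, h2, -⟩
      simp at h2
      omega
  | succ m ih =>
    rw [pathList_succ, List.infix_cons_iff, ih]
    constructor
    · rintro (h | ⟨t, h1, h2, h3⟩)
      · cases m with
        | zero => simp [pathList] at h
        | succ m =>
          rw [pathList_succ] at h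
          simp only [List.cons_prefix_cons, List.nil_prefix, and_true] at h
          exact ⟨t₀, le_rfl, by push_cast; omega, h.1, h.2⟩
      · exact ⟨t, by omega, by push_cast; omega, h3⟩
    · rintro ⟨t, h1, h2, rfl, rfl⟩
      rcases eq_or_lt_of_le h1 with rfl | h1
      · left
        cases m with
        | zero => simp at h2
        | succ m => rw [pathList_succ]; simp
      · exact Or.inr ⟨t, by omega, by push_cast at h2; omega, rfl, rfl⟩

theorem isPathCorner_pathList {f : ℤ → ℤ} {t₀ : ℤ} {m : ℕ} {R : ℤ × ℤ} :
    IsPathCorner (pathList f t₀ m) R ↔ ∃ t, t₀ < t ∧ t + 1 < t₀ + m ∧ R = (f t, f t + t) ∧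
      (IsNWCorner f t ∨ IsSECorner f t) := by
  constructor
  · rintro ⟨⟨P, Q, h1, h2, h3⟩, P', Q', h1', h2', h3'⟩
    obtain ⟨s, hs1, hs2, rfl, rfl⟩ := infix_pathList.1 h1
    obtain ⟨t, ht1, ht2, rfl, rfl⟩ := infix_pathList.1 h1'
    simp only at h2 h2'
    have hne : s ≠ t := by rintro rfl; omega
    have key : ∀ r r', R = (f r, f r + r) → R = (f r', f r' + r') → r = r' := by
      intro r r' e e'
      rw [e, Prod.mk.injEq] at e'
      omega
    rcases h3 with h3 | h3 <;> rcases h3' with h3' | h3'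
    · exact absurd (key _ _ h3 h3') hne
    · obtain rfl := key _ _ h3 h3'
      refine ⟨t + 1, by omega, by omega, h3, Or.inl ⟨?_, by omega⟩⟩
      rw [add_sub_cancel_right]; omega
    · obtain rfl := key _ _ h3' h3
      refine ⟨s + 1, by omega, by omega, h3, Or.inr ⟨?_, by omega⟩⟩
      rw [add_sub_cancel_right]; omega
    · exact absurd (key _ _ h3 h3') (by omega)
  · rintro ⟨t, h1, h2, rfl, h | h⟩
    · refine ⟨⟨_, _, infix_pathList.2 ⟨t, by omega, by omega, rfl, rfl⟩, ?_, Or.inl rfl⟩,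
        ⟨_, _, infix_pathList.2 ⟨t - 1, by omega, by omega, rfl, rfl⟩, ?_, Or.inr ?_⟩⟩
      · exact h.2.symm
      · simp only [sub_add_cancel, h.1]; ring
      · simp
    · refine ⟨⟨_, _, infix_pathList.2 ⟨t - 1, by omega, by omega, rfl, rfl⟩, ?_, Or.inr ?_⟩,
        ⟨_, _, infix_pathList.2 ⟨t, by omega, by omega, rfl, rfl⟩, ?_, Or.inl rfl⟩⟩
      · simp [h.1]
      · simp
      · simp only [h.2]; ring

/-- Transposition turns an east step into a south step and a north step into a west step, so the
list is reversed to run again from south-west to north-east. -/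
theorem isLatticePath_swap {P Q : ℤ × ℤ} {l : List (ℤ × ℤ)} (h : IsLatticePath P Q l) :
    IsLatticePath Q.swap P.swap (l.map Prod.swap).reverse := by
  obtain ⟨h1, h2, h3⟩ := h
  refine ⟨?_, ?_, ?_⟩
  · rw [List.isChain_reverse, List.isChain_map]
    refine h1.imp fun R R' hR => ?_
    rcases hR with rfl | rfl
    · exact Or.inr (by simp [Prod.swap])
    · exact Or.inl (by simp [Prod.swap])
  · rw [List.head?_reverse, List.getLast?_map, h3]; rfl
  · rw [List.getLast?_reverse, List.head?_map, h2]; rfl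

theorem swap_swap_list (l : List (ℤ × ℤ)) :
    ((l.map Prod.swap).reverse.map Prod.swap).reverse = l := by
  simp

theorem IsPathCorner.swap {l : List (ℤ × ℤ)} {R : ℤ × ℤ} (h : IsPathCorner l R) :
    IsPathCorner (l.map Prod.swap).reverse R.swap := by
  have key : ∀ P Q, [P, Q] <:+: l → [Q.swap, P.swap] <:+: (l.map Prod.swap).reverse := by
    intro P Q h
    have := (List.reverse_infix (l₁ := [P.swap, Q.swap])).2 (h.map Prod.swap)
    simpa using this
  obtain ⟨⟨P, Q, h1, h2, h3⟩, ⟨P', Q', h1', h2', h3'⟩⟩ := h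
  refine ⟨⟨_, _, key _ _ h1', h2'.symm, ?_⟩, ⟨_, _, key _ _ h1, h2.symm, ?_⟩⟩
  · rcases h3' with rfl | rfl <;> simp
  · rcases h3 with rfl | rfl <;> simp

/-! ### Horizontal and vertical paths crossing one page. -/

/-- Two families of pairwise disjoint paths crossing a page with `r` rows and `c` columns, the paths
`F p` from left to right and the paths `G q` from bottom to top, such that each corner of north-west
type of a path is on a path of the other family. -/
structure PageSystem (r c u v : ℕ) (F : Fin u → ℤ → ℤ) (G : Fin v → ℤ → ℤ) : Prop where
  isPathFun_F : ∀ p, IsPathFun (F p)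
  isPathFun_G : ∀ q, IsPathFun (G q)
  row_F : ∀ p t, 1 ≤ F p t ∧ F p t ≤ r
  col_G : ∀ q t, 1 ≤ G q t + t ∧ G q t + t ≤ c
  lt_F : ∀ p p' t, p < p' → F p t < F p' t
  lt_G : ∀ q q' t, q < q' → G q t < G q' t
  corner_F : ∀ p t, IsNWCorner (F p) t → 1 ≤ F p t + t → F p t + t ≤ c → ∃ q, G q t = F p t
  corner_G : ∀ q t, IsNWCorner (G q) t → 1 ≤ G q t → G q t ≤ r → ∃ p, F p t = G q t

namespace PageSystem

variable {r c u v : ℕ} {F : Fin u → ℤ → ℤ} {G : Fin v → ℤ → ℤ}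

/-- A path from left to right changes only once from the north-west to the south-east of a path
from bottom to top. -/
theorem sign_mono (h : PageSystem r c u v F G) (p : Fin u) (q : Fin v) :
    (∀ s t, s < t → G q s ≤ F p s → G q t ≤ F p t) ∧
    (∀ s t, s < t → G q s < F p s → G q t < F p t) := by
  -- Both claims are proved together: a corner inside a forbidden excursion lies on a path of
  -- smaller index of the other family, the weak claim then uses the strict one for that pair, and
  -- the strict claim uses the weak one.
  suffices H : ∀ N : ℕ, ∀ p : Fin u, ∀ q : Fin v, p.val + q.val = N →
      (∀ s t, s < t → G q s ≤ F p s → G q t ≤ F p t) ∧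
      (∀ s t, s < t → G q s < F p s → G q t < F p t) from H _ p q rfl
  intro N
  induction N using Nat.strong_induction_on with
  | _ N ih =>
  intro p q hN
  have hF := h.isPathFun_F p
  have hG := h.isPathFun_G q
  constructor
  · intro s t hst hs
    by_contra! ht
    obtain ⟨d, hd1, hd2, hd3, hd4⟩ := Int.exists_last (P := fun x => G q x ≤ F p x) hst.le hs
    have hdt : d < t := by
      rcases eq_or_lt_of_le hd2 with rfl | h'
      · exact absurd hd3 (by omega)
      · exact h'
    -- The excursion must end: from diagonal `c` on, the column bound puts `G q` in rows at most
    -- `0`, above the whole page.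
    obtain ⟨e, he1, he2, he3, he4⟩ := Int.exists_first (P := fun x => G q x ≤ F p x)
      (lo := t) (hi := max t c) (le_max_left _ _) (by
        have := h.col_G q (max t c)
        have := h.row_F p (max t c)
        have := le_max_right t (c : ℤ)
        omega)
    have hlt : ∀ x, d < x → x < e → F p x < G q x := by
      intro x h1 h2
      rcases le_or_gt x t with h3 | h3
      · exact not_le.1 (hd4 x h1 h3)
      · exact not_le.1 (he4 x h3.le h2)
    have hte : t < e := by
      rcases eq_or_lt_of_le he1 with rfl | h'
      · exact absurd he3 (by omega)
      · exact h'
    have h1 := hlt (d + 1) (by omega) (by omega)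
    have h2 := hlt (e - 1) (by omega) (by omega)
    have h3 := hF d
    have h4 := hG d
    have h5 := hF.pred e
    have h6 := hG.pred e
    have hne : d + 1 < e := by omega
    -- To leave `G q` the path `F p` steps up, to return it steps right, so it turns in between; its
    -- column there lies between two columns of `G q`, hence in the page.
    obtain ⟨τ, hτ1, hτ2, hτ⟩ := hF.exists_isNWCorner hne (by omega) (by omega)
    have h7 := hF.mono_add hτ1.le
    have h8 := hF.mono_add hτ2.le
    have h9 := h.col_G q d
    have h10 := h.col_G q e
    obtain ⟨q', hq'⟩ := h.corner_F p τ hτ (by omega) (by omega)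
    have h11 := hlt τ hτ1 hτ2
    have hqq : q' < q := by
      by_contra hcon
      rcases eq_or_lt_of_le (not_lt.1 hcon) with rfl | hcon
      · omega
      · have := h.lt_G _ _ τ hcon
        omega
    -- On diagonal `d` the path `q'` is strictly north-west of `F p`, so by the strict claim it
    -- cannot touch `F p` at `τ`.
    have h12 := (ih (p.val + q'.val) (by have := Fin.lt_def.1 hqq; omega) p q' rfl).2 d τ hτ1 (by
      have := h.lt_G _ _ d hqq
      omega)
    omega
  · intro s t hst hs
    by_contra! ht
    obtain ⟨e, he1, he2, he3, he4⟩ := Int.exists_first (P := fun x => F p x ≤ G q x) hst.le ht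
    have hse : s < e := by
      rcases eq_or_lt_of_le he1 with rfl | h'
      · exact absurd he3 (by omega)
      · exact h'
    obtain ⟨d, hd1, hd2, hd3, hd4⟩ := Int.exists_last (P := fun x => F p x ≤ G q x)
      (lo := min s (-r)) (hi := s) (min_le_left _ _) (by
        have := h.col_G q (min s (-r))
        have := h.row_F p (min s (-r))
        have := min_le_right s (-r : ℤ)
        omega)
    have hlt : ∀ x, d < x → x < e → G q x < F p x := by
      intro x h1 h2
      rcases le_or_gt x s with h3 | h3
      · exact not_le.1 (hd4 x h1 h3)
      · exact not_le.1 (he4 x h3.le h2)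
    have hds : d < s := by
      rcases eq_or_lt_of_le hd2 with rfl | h'
      · exact absurd hd3 (by omega)
      · exact h'
    have h1 := hlt (d + 1) (by omega) (by omega)
    have h2 := hlt (e - 1) (by omega) (by omega)
    have h3 := hF d
    have h4 := hG d
    have h5 := hF.pred e
    have h6 := hG.pred e
    have hne : d + 1 < e := by omega
    obtain ⟨τ, hτ1, hτ2, hτ⟩ := hG.exists_isNWCorner hne (by omega) (by omega)
    have h7 := hG.anti hτ1.le
    have h8 := hG.anti hτ2.le
    have h9 := h.row_F p d
    have h10 := h.row_F p e
    obtain ⟨p', hp'⟩ := h.corner_G q τ hτ (by omega) (by omega)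
    have h11 := hlt τ hτ1 hτ2
    have hpp : p' < p := by
      by_contra hcon
      rcases eq_or_lt_of_le (not_lt.1 hcon) with rfl | hcon
      · omega
      · have := h.lt_F _ _ τ hcon
        omega
    -- From `τ` on, `G q` stays weakly north-west of `F p'`, hence strictly north-west of `F p`, and
    -- cannot reach it at `e`.
    have h12 := (ih (p'.val + q.val) (by have := Fin.lt_def.1 hpp; omega) p' q rfl).1 τ e hτ2 (by
      omega)
    have := h.lt_F _ _ e hpp
    omega

/-- Each vertical edge of a path from left to right is on a path from bottom to top. -/
theorem vertical (h : PageSystem r c u v F G) {p : Fin u} {t : ℤ} (ht : F p (t + 1) = F p t - 1)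
    (h1 : 1 ≤ F p t + t) (h2 : F p t + t ≤ c) :
    ∃ q, G q t = F p t ∧ G q (t + 1) = F p (t + 1) := by
  obtain ⟨s, hts, hs, hrun⟩ := (h.isPathFun_F p).exists_run ht (fun s => (h.row_F p s).1)
  have hcol : ∀ r, t ≤ r → r ≤ s → F p r + r = F p t + t := by
    intro r hr
    induction r, hr using Int.leInduction with
    | base => exact fun _ => rfl
    | succ r hr ih =>
      intro hrs
      have := ih (by omega)
      have := hrun r hr (by omega)
      omega
  have hs' := hcol s hts.le le_rfl
  obtain ⟨q, hq⟩ := h.corner_F p s hs (by omega) (by omega)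
  -- `G q` passes through the upper end of the run. Below it, monotone columns give `G q ≤ F p`, and
  -- a strict inequality would persist up to `s` by `sign_mono`.
  have key : ∀ r, t ≤ r → r < s → G q r = F p r := by
    intro r hr hrs
    have h3 := hcol r hr hrs.le
    have h4 := (h.isPathFun_G q).mono_add hrs.le
    have h5 := (h.sign_mono p q).2 r s hrs
    omega
  refine ⟨q, key t le_rfl hts, ?_⟩
  rcases eq_or_lt_of_le (show t + 1 ≤ s by omega) with rfl | h6
  · exact hq
  · exact key _ (by omega) h6

/-- Two crossing paths have exactly one more common vertex than common edges. -/
theorem exists_Icc (h : PageSystem r c u v F G) (p : Fin u) (q : Fin v) :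
    ∃ m M : ℤ, m ≤ M ∧ ∀ t, G q t = F p t ↔ m ≤ t ∧ t ≤ M := by
  have hF := h.isPathFun_F p
  have hG := h.isPathFun_G q
  obtain ⟨hM1, hM2⟩ := h.sign_mono p q
  have hlo := h.row_F p (-r)
  have hlo' := h.col_G q (-r)
  have hhi := h.row_F p c
  have hhi' := h.col_G q c
  -- The interval runs from the first diagonal with `G q ≤ F p` to the last one with `F p ≤ G q`.
  obtain ⟨m, h1, h2, h3, h4⟩ := Int.exists_first (P := fun x => G q x ≤ F p x)
    (lo := -r) (hi := c) (by omega) (by omega)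
  obtain ⟨M, h1', h2', h3', h4'⟩ := Int.exists_last (P := fun x => F p x ≤ G q x)
    (lo := -r) (hi := c) (by omega) (by omega)
  have hm : G q m = F p m := by
    rcases eq_or_lt_of_le h1 with rfl | hlt
    · omega
    · have := h4 (m - 1) (by omega) (by omega)
      have := hF.pred m
      have := hG.pred m
      omega
  have hmM : m ≤ M := by
    by_contra hlt
    exact h4' m (by omega) h2 hm.ge
  have hM : G q M = F p M := by
    rcases eq_or_lt_of_le hmM with rfl | hlt
    · exact hm
    · have := hM1 m M hlt hm.le
      omega
  refine ⟨m, M, hmM, fun t => ⟨fun ht => ⟨?_, ?_⟩, fun ⟨ht1, ht2⟩ => ?_⟩⟩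
  · by_contra hlt
    have h5 := h.row_F p t
    have h6 := h.col_G q t
    exact h4 t (by omega) (by omega) ht.le
  · by_contra hlt
    have h5 := h.row_F p t
    have h6 := h.col_G q t
    exact h4' t (by omega) (by omega) ht.ge
  · rcases eq_or_lt_of_le ht1 with rfl | ht1
    · exact hm
    rcases eq_or_lt_of_le ht2 with rfl | ht2
    · exact hM
    have h5 := hM1 m t ht1 hm.le
    by_contra hne
    have := hM2 t M ht2 (by omega)
    omega

end PageSystem

/-! ### Systems of disjoint paths in one matrix. -/

/-- `u` pairwise disjoint lattice paths in an `a` by `b` matrix, the path with index `p` going from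
`(a - u + p + 1, 1)` to `(p + 1, b)`, all extended by horizontal rays at both ends. -/
structure IsPathSystem (a b u : ℕ) (f : Fin u → ℤ → ℤ) : Prop where
  step : ∀ p, IsPathFun (f p)
  left : ∀ p t, (a : ℤ) - u + (p.val + 1) + t ≤ 1 → f p t = (a : ℤ) - u + (p.val + 1)
  right : ∀ p t, (b : ℤ) ≤ (p.val + 1) + t → f p t = p.val + 1
  lt : ∀ p p' t, p < p' → f p t < f p' t

namespace IsPathSystem

variable {a b u : ℕ} {f : Fin u → ℤ → ℤ}

theorem le_row (h : IsPathSystem a b u f) (p : Fin u) (t : ℤ) : (p.val : ℤ) + 1 ≤ f p t := by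
  have h1 := (h.step p).anti (le_max_left t b)
  rw [h.right p (max t b) (by have := le_max_right t (b : ℤ); omega)] at h1
  exact h1

theorem row_le (h : IsPathSystem a b u f) (p : Fin u) (t : ℤ) :
    f p t ≤ (a : ℤ) - u + (p.val + 1) := by
  have h1 := (h.step p).anti (min_le_left t (-a))
  rw [h.left p (min t (-a)) (by have := min_le_right t (-a : ℤ); have := p.2; omega)] at h1
  exact h1

/-- The added rays are horizontal, so vertical steps occur only in columns of the matrix. -/
theorem left_lt (h : IsPathSystem a b u f) {p : Fin u} {t : ℤ} (ht : f p (t + 1) = f p t - 1) :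
    1 ≤ f p t + t ∧ f p t + t ≤ b := by
  constructor
  · by_contra hcon
    by_cases h1 : (a : ℤ) - u + (p.val + 1) + t ≤ 0
    · have := h.left p t (by omega)
      have := h.left p (t + 1) (by omega)
      omega
    · have h2 := (h.step p).mono_add (show 1 - ((a : ℤ) - u + (p.val + 1)) ≤ t by omega)
      rw [h.left p (1 - ((a : ℤ) - u + (p.val + 1))) (by omega)] at h2
      omega
  · by_contra hcon
    by_cases h1 : (b : ℤ) ≤ (p.val + 1) + t
    · have := h.right p t h1
      have := h.right p (t + 1) (by omega)
      omega
    · have h2 := (h.step p).mono_add (show t ≤ b - (p.val + 1) by omega)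
      rw [h.right p (b - (p.val + 1)) (by omega)] at h2
      omega

theorem onPath_unique (h : IsPathSystem a b u f) {p p' : Fin u} {P : ℤ × ℤ}
    (hp : OnPath (f p) P) (hp' : OnPath (f p') P) : p = p' := by
  unfold OnPath at hp hp'
  rcases lt_trichotomy p p' with hlt | rfl | hlt
  · have := h.lt _ _ (P.2 - P.1) hlt; omega
  · rfl
  · have := h.lt _ _ (P.2 - P.1) hlt; omega

end IsPathSystem

/-! ### Level lines of r̄. -/

/-- The number `r̄` of the set `X` of positions in an `a` by `b` matrix. -/
def rho (a b u : ℕ) (X : Finset (ℤ × ℤ)) (P : ℤ × ℤ) : ℤ :=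
  max (chainNW X P : ℤ) (min (P.1 - 1) ((u : ℤ) - 1 - min ((a : ℤ) - P.1) ((b : ℤ) - P.2)))

/-- The number `s̄` of the set `X` of positions in a matrix with `a` rows. -/
def sigma (a u : ℕ) (X : Finset (ℤ × ℤ)) (P : ℤ × ℤ) : ℤ :=
  max (chainSE X P : ℤ) (min ((a : ℤ) - P.1) ((u : ℤ) - min P.1 P.2))

theorem rho_mono (a b u : ℕ) (X : Finset (ℤ × ℤ)) {P Q : ℤ × ℤ} (h1 : P.1 ≤ Q.1)
    (h2 : P.2 ≤ Q.2) : rho a b u X P ≤ rho a b u X Q := by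
  have := chainNW_le_chainNW X h1 h2
  unfold rho
  omega

theorem rho_succ_le (a b u : ℕ) (X : Finset (ℤ × ℤ)) (P : ℤ × ℤ) :
    rho a b u X (P.1 + 1, P.2 + 1) ≤ rho a b u X P + 1 := by
  have := chainNW_succ_le X P
  unfold rho
  simp only
  omega

/-- For each `p`, the path `f p` is the boundary of the region where `r̄` exceeds `p`. -/
def IsLevelSystem (a b u : ℕ) (X : Finset (ℤ × ℤ)) (f : Fin u → ℤ → ℤ) : Prop :=
  ∀ p t, rho a b u X (f p t, f p t + t) ≤ p.val ∧
    (p.val : ℤ) + 1 ≤ rho a b u X (f p t + 1, f p t + t + 1)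

theorem InBox.exists_isLevelSystem {a b u : ℕ} {X : Finset (ℤ × ℤ)} (hX : InBox a b X)
    (hua : u ≤ a) : ∃ f, IsLevelSystem a b u X f := by
  have key : ∀ (p : Fin u) (t : ℤ), ∃ i, rho a b u X (i, i + t) ≤ p.val ∧
      (p.val : ℤ) + 1 ≤ rho a b u X (i + 1, i + t + 1) := by
    intro p t
    -- On each diagonal `rho` is at most `0` in row `1`, and in row `a + 1` its correction term is
    -- at least `u`.
    obtain ⟨i, h1, h2, h3, h4⟩ := Int.exists_last
      (P := fun i => rho a b u X (i, i + t) ≤ p.val) (lo := 1) (hi := a + 1) (by omega) (by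
        have := hX.chainNW_le_fst (1, 1 + t)
        unfold rho
        simp only at this ⊢
        omega)
    refine ⟨i, h3, ?_⟩
    have hi : i < a + 1 := by
      rcases eq_or_lt_of_le h2 with rfl | h'
      · have := p.2
        unfold rho at h3
        simp only at h3
        omega
      · exact h'
    have := h4 (i + 1) (by omega) (by omega)
    rw [show i + t + 1 = i + 1 + t by ring]
    omega
  choose f hf using key
  exact ⟨f, hf⟩

namespace IsLevelSystem

variable {a b u : ℕ} {X : Finset (ℤ × ℤ)} {f : Fin u → ℤ → ℤ}

/-- `rho` is monotone, so on each diagonal it passes from `≤ p` to `≥ p + 1` only once. -/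
theorem onPath_iff (h : IsLevelSystem a b u X f) {p : Fin u} {P : ℤ × ℤ} :
    OnPath (f p) P ↔ rho a b u X P ≤ p.val ∧ (p.val : ℤ) + 1 ≤ rho a b u X (P.1 + 1, P.2 + 1) := by
  obtain ⟨h1, h2⟩ := h p (P.2 - P.1)
  unfold OnPath
  constructor
  · intro hP
    rw [hP] at h1 h2
    rw [show P.1 + (P.2 - P.1) = P.2 by ring] at h1 h2
    exact ⟨h1, h2⟩
  · rintro ⟨h3, h4⟩
    by_contra hne
    rcases lt_or_gt_of_ne hne with hlt | hlt
    · have := rho_mono a b u X (P := (f p (P.2 - P.1) + 1, f p (P.2 - P.1) + (P.2 - P.1) + 1))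
        (Q := P) (by simp; omega) (by simp; omega)
      omega
    · have := rho_mono a b u X (P := (P.1 + 1, P.2 + 1))
        (Q := (f p (P.2 - P.1), f p (P.2 - P.1) + (P.2 - P.1))) (by simp; omega) (by simp; omega)
      omega

theorem eq_of (h : IsLevelSystem a b u X f) {p : Fin u} {t i : ℤ}
    (h1 : rho a b u X (i, i + t) ≤ p.val)
    (h2 : (p.val : ℤ) + 1 ≤ rho a b u X (i + 1, i + t + 1)) : f p t = i := by
  have := (h.onPath_iff (p := p) (P := (i, i + t))).2 ⟨h1, h2⟩
  simpa [OnPath] using this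

/-- Unit steps come from the monotonicity of `rho`, and disjointness from its growth by at most one
along a diagonal. On the rays the correction term yields the prescribed rows, since chains there are
too short to exceed `p`. -/
theorem isPathSystem (h : IsLevelSystem a b u X f) (hX : InBox a b X) (hua : u ≤ a)
    (hub : u ≤ b) : IsPathSystem a b u f where
  step p t := by
    obtain ⟨h1, h2⟩ := h p t
    obtain ⟨h3, h4⟩ := h p (t + 1)
    have h5 : f p (t + 1) ≤ f p t := by
      by_contra hcon
      have := rho_mono a b u X (P := (f p t + 1, f p t + t + 1))
        (Q := (f p (t + 1), f p (t + 1) + (t + 1))) (by simp; omega) (by simp; omega)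
      omega
    have h6 : f p t - 1 ≤ f p (t + 1) := by
      by_contra hcon
      have := rho_mono a b u X (P := (f p (t + 1) + 1, f p (t + 1) + (t + 1) + 1))
        (Q := (f p t, f p t + t)) (by simp; omega) (by simp; omega)
      omega
    omega
  left p t ht := by
    have := p.2
    refine h.eq_of ?_ ?_
    · have h1 := hX.chainNW_le_snd ((a : ℤ) - u + (p.val + 1), (a : ℤ) - u + (p.val + 1) + t)
      unfold rho
      simp only at h1 ⊢
      omega
    · unfold rho
      simp only
      omega
  right p t ht := by
    have := p.2
    refine h.eq_of ?_ ?_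
    · have h1 := hX.chainNW_le_fst ((p.val : ℤ) + 1, (p.val : ℤ) + 1 + t)
      unfold rho
      simp only at h1 ⊢
      omega
    · unfold rho
      simp only
      omega
  lt p p' t hp := by
    obtain ⟨h1, h2⟩ := h p t
    obtain ⟨h3, h4⟩ := h p' t
    have := Fin.lt_def.1 hp
    by_contra hcon
    have h5 := rho_succ_le a b u X (f p t, f p t + t)
    have h6 := rho_mono a b u X (P := (f p' t + 1, f p' t + t + 1))
        (Q := (f p t + 1, f p t + t + 1)) (by simp; omega) (by simp; omega)
    simp only at h5
    omega

theorem exists_onPath (h : IsLevelSystem a b u X f) (hX : InBox a b X)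
    (hc : maxChainSize X ≤ u) {P : ℤ × ℤ} (hP : P ∈ X) : ∃ p, OnPath (f p) P := by
  have h1 := chainNW_add_chainSE_add_one_le hP
  have h2 := hX P hP
  have h3 := chainNW_add_one_le (Q := (P.1 + 1, P.2 + 1)) hP (by simp) (by simp)
  -- The index is `rho` at `P`: from `P` to `P + (1, 1)` the chain size grows because `P ∈ X`, and
  -- the correction term grows by one.
  refine ⟨⟨(rho a b u X P).toNat, ?_⟩, h.onPath_iff.2 ⟨?_, ?_⟩⟩
  · unfold rho; omega
  · simp
  · unfold rho
    simp only
    omega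

/-- If a chain of size `p + 1` accounts for the jump at `P`, compatibility leaves at most `u - 1 -
p` for chains to the south-east; if the correction term does, the distance to the border gives the
same bound. -/
theorem rho_add_sigma_le (h : IsLevelSystem a b u X f) (hX : InBox a b X)
    (hub : u ≤ b) (hc : maxChainSize X ≤ u) {p : Fin u} {P : ℤ × ℤ}
    (hP : 1 ≤ P.1 ∧ P.1 ≤ a ∧ 1 ≤ P.2 ∧ P.2 ≤ b)
    (hon : OnPath (f p) P) : rho a b u X P + sigma a u X P ≤ u - 1 := by
  obtain ⟨h1, h2⟩ := h.onPath_iff.1 hon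
  have h3 := chainNW_add_chainSE_le X (P := (P.1 + 1, P.2 + 1)) (Q := P) le_rfl le_rfl
  have h4 := hX.chainSE_le_fst P
  have h5 := hX.chainSE_le_snd P
  have h6 := hX.chainNW_le_fst (P.1 + 1, P.2 + 1)
  have h7 := hX.chainNW_le_snd (P.1 + 1, P.2 + 1)
  unfold rho at h1 h2 ⊢
  unfold sigma
  simp only at h2 h6 h7
  omega

/-- A chain of size `p + 1` north-west of the corner shifted by `(1, 1)` must end at the corner:
otherwise it would already count at the neighbour below or at the neighbour to the right, where `rho
≤ p`. In the second alternative only the correction term jumps. -/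
theorem mem_of_isNWCorner (h : IsLevelSystem a b u X f) {p : Fin u} {t : ℤ}
    (ht : IsNWCorner (f p) t) : (f p t, f p t + t) ∈ X ∨
      (f p t = p.val + 1 ∧ f p t + t = (b : ℤ) - u + (p.val + 1)) := by
  obtain ⟨-, h2⟩ := h p t
  obtain ⟨h3, -⟩ := h p (t - 1)
  obtain ⟨h4, -⟩ := h p (t + 1)
  rw [ht.1] at h3
  rw [ht.2] at h4
  by_cases h5 : p.val + 1 ≤ chainNW X (f p t + 1, f p t + t + 1)
  · left
    obtain ⟨R, hR, h6, h7, h8⟩ := exists_mem_of_lt_chainNW h5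
    simp only at h6 h7
    have h9 : R.2 = f p t + t := by
      by_contra hne
      have := chainNW_add_one_le (Q := (f p t + 1, f p t + 1 + (t - 1))) hR (by simpa using h6)
        (by simp only; omega)
      unfold rho at h3
      omega
    have h10 : R.1 = f p t := by
      by_contra hne
      have := chainNW_add_one_le (Q := (f p t, f p t + (t + 1))) hR (by simp only; omega)
        (by simp only; omega)
      unfold rho at h4
      omega
    rw [← h9, ← h10]
    exact hR
  · right
    unfold rho at h2 h3 h4
    simp only at h2 h3 h4
    omega

end IsLevelSystem

/-! ### Sets containing the corners: r̄ and s̄ count paths. -/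

theorem Fin.add_sub_le_of_lt_succ {u : ℕ} {c : Fin u → ℤ}
    (h : ∀ p (hp : p + 1 < u), c ⟨p, by omega⟩ < c ⟨p + 1, hp⟩) {p p' : Fin u} (hp : p ≤ p') :
    c p + (p'.val - p.val : ℤ) ≤ c p' := by
  obtain ⟨m, hm⟩ := p'
  induction m with
  | zero =>
    obtain rfl : p = ⟨0, hm⟩ := le_antisymm hp (by simp [Fin.le_def])
    simp
  | succ m ih =>
    rcases eq_or_lt_of_le hp with rfl | hlt
    · simp
    · have h1 := ih (by omega) (by rw [Fin.lt_def] at hlt; rw [Fin.le_def]; simp only at *; omega)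
      have h2 := h m hm
      simp only at h1 ⊢
      push_cast
      omega

/-- The set `X` of points of the paths `f` contains their corners. -/
structure ContainsCorners (b u : ℕ) (f : Fin u → ℤ → ℤ) (X : Finset (ℤ × ℤ)) : Prop where
  exists_onPath : ∀ P ∈ X, ∃ p, OnPath (f p) P
  nw : ∀ p t, IsNWCorner (f p) t → f p t + t + 1 ≤ b → (f p t, f p t + t) ∈ X
  se : ∀ p t, IsSECorner (f p) t → 2 ≤ f p t + t → (f p t, f p t + t) ∈ X

namespace IsPathSystem

variable {a b u : ℕ} {f : Fin u → ℤ → ℤ} {X : Finset (ℤ × ℤ)}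

/-- The point reflection reverses the order of the paths and exchanges the two types of corners; it
yields `sigma_eq` from `rho_eq`. -/
theorem rotate (h : IsPathSystem a b u f) :
    IsPathSystem a b u fun p t => (a : ℤ) + 1 - f p.rev ((b : ℤ) - a - t) where
  step p t := by
    have := h.step p.rev ((b : ℤ) - a - (t + 1))
    rw [show (b : ℤ) - a - (t + 1) + 1 = b - a - t by ring] at this
    simp only
    omega
  left p t ht := by
    have := Fin.val_rev p
    have := p.2
    rw [h.right p.rev _ (by omega)]
    omega
  right p t ht := by
    have := Fin.val_rev p
    have := p.2
    rw [h.left p.rev _ (by omega)]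
    omega
  lt p p' t hp := by
    have := h.lt p'.rev p.rev ((b : ℤ) - a - t) (Fin.rev_lt_rev.2 hp)
    omega

theorem onPath_rotate {p : Fin u} {P : ℤ × ℤ} :
    OnPath (fun t => (a : ℤ) + 1 - f p.rev ((b : ℤ) - a - t)) (pointReflection a b P) ↔
      OnPath (f p.rev) P := by
  unfold OnPath pointReflection
  simp only
  rw [show (b : ℤ) - a - (b + 1 - P.2 - (a + 1 - P.1)) = P.2 - P.1 by ring]
  omega

theorem _root_.ContainsCorners.rotate (hX : ContainsCorners b u f X) :
    ContainsCorners b u (fun p t => (a : ℤ) + 1 - f p.rev ((b : ℤ) - a - t))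
      (X.image (pointReflection a b)) where
  exists_onPath P hP := by
    obtain ⟨Q, hQ, rfl⟩ := mem_image.1 hP
    obtain ⟨p, hp⟩ := hX.exists_onPath Q hQ
    exact ⟨p.rev, onPath_rotate.2 (by rwa [Fin.rev_rev])⟩
  nw p t ht hb := by
    simp only [IsNWCorner] at ht hb
    rw [show (b : ℤ) - a - (t - 1) = (b - a - t) + 1 by ring,
      show (b : ℤ) - a - (t + 1) = (b - a - t) - 1 by ring] at ht
    refine mem_image.2 ⟨_, hX.se p.rev ((b : ℤ) - a - t) ⟨by omega, by omega⟩ (by omega), ?_⟩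
    simp only [pointReflection, Prod.mk.injEq, true_and]
    ring
  se p t ht hb := by
    simp only [IsSECorner] at ht hb
    rw [show (b : ℤ) - a - (t - 1) = (b - a - t) + 1 by ring,
      show (b : ℤ) - a - (t + 1) = (b - a - t) - 1 by ring] at ht
    refine mem_image.2 ⟨_, hX.nw p.rev ((b : ℤ) - a - t) ⟨by omega, by omega⟩ (by omega), ?_⟩
    simp only [pointReflection, Prod.mk.injEq, true_and]
    ring

/-- Monotone rows and columns force a path through `Q` to pass strictly north-west of any point
strictly south-east of `Q`. In particular a path contains at most one point of a chain. -/
theorem lt_of_onPath_of_lt {f : ℤ → ℤ} (h : IsPathFun f) {P Q : ℤ × ℤ}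
    (hQ : OnPath f Q) (h1 : Q.1 < P.1) (h2 : Q.2 < P.2) : f (P.2 - P.1) < P.1 := by
  unfold OnPath at hQ
  rcases le_total (Q.2 - Q.1) (P.2 - P.1) with hle | hle
  · have := h.anti hle; omega
  · have := h.mono_add hle; omega

/-- The points of a chain north-west of `P` lie on distinct paths, all passing north-west of `P`. -/
theorem chainNW_le (h : IsPathSystem a b u f) (hX : ∀ P ∈ X, ∃ p, OnPath (f p) P) {P : ℤ × ℤ}
    {m : ℕ} (hm : ∀ q : Fin u, f q (P.2 - P.1) < P.1 → q.val < m) : chainNW X P ≤ m := by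
  obtain ⟨Y, hY, hYc, hYe⟩ := exists_chain_card_eq
    (X.filter fun R => R.1 ≤ P.1 - 1 ∧ R.2 ≤ P.2 - 1)
  rw [chainNW, ← hYe, ← card_range m]
  have hY' : ∀ R ∈ Y, ∃ p, OnPath (f p) R := fun R hR => hX R (mem_filter.1 (hY hR)).1
  refine card_le_card_of_forall_subsingleton (fun R q => ∃ p : Fin u, p.val = q ∧ OnPath (f p) R)
    (fun R hR => ?_) fun q _ R hR R' hR' => ?_
  · have := (mem_filter.1 (hY hR)).2
    obtain ⟨p, hp⟩ := hY' R hR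
    exact ⟨p.val, mem_range.2 (hm _ (lt_of_onPath_of_lt (h.step _) hp (by omega) (by omega))),
      p, rfl, hp⟩
  · obtain ⟨hR, p, rfl, h1⟩ := hR
    obtain ⟨hR', p', e, h2⟩ := hR'
    rw [Fin.val_injective e] at h2
    by_contra hne
    rcases hYc R hR R' hR' hne with h3 | h3
    · have := lt_of_onPath_of_lt (h.step _) h1 h3.1 h3.2
      unfold OnPath at h2
      omega
    · have := lt_of_onPath_of_lt (h.step _) h2 h3.1 h3.2
      unfold OnPath at h1
      omega

/-- Unless path `p` starts above row `P.1`, it enters the rows above `P` by a vertical step and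
leaves the columns left of `P` by a horizontal one. It turns in between, at a point of `X` strictly
north-west of `P`; the preceding path passes north-west of that point, which continues the chain. -/
theorem le_chainNW_or (h : IsPathSystem a b u f) (hX : ContainsCorners b u f X) (p : Fin u)
    (P : ℤ × ℤ) (hP : P.2 ≤ b) (hp : f p (P.2 - P.1) < P.1) :
    p.val + 1 ≤ chainNW X P ∨ (p.val : ℤ) + 1 ≤ P.1 - 1 - (a - u) := by
  obtain ⟨m, hm⟩ := p
  induction m generalizing P with
  | zero => ?_
  | succ m ih => ?_
  -- The search for the corner is the same in the base case and in the inductive step.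
  all_goals
    generalize hpp : (⟨_, hm⟩ : Fin u) = p at hp
    by_cases hleft : (a : ℤ) - u + (p.val + 1) ≤ P.1 - 1
    · subst hpp
      simp only at hleft ⊢
      omega
    obtain ⟨s, h1, h2, h3, h4⟩ := Int.exists_last (P := fun x => P.1 ≤ f p x)
      (lo := min (P.2 - P.1) (1 - ((a : ℤ) - u + (p.val + 1)))) (min_le_left _ _)
      (by rw [h.left p _ (by have := min_le_right (P.2 - P.1) (1 - ((a : ℤ) - u + (p.val + 1))); omega)]
          omega)
    obtain ⟨e, h1', h2', h3', h4'⟩ := Int.exists_first (P := fun x => P.2 ≤ f p x + x)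
      (hi := max (P.2 - P.1) P.2) (le_max_left _ _)
      (by have := h.le_row p (max (P.2 - P.1) P.2); have := le_max_right (P.2 - P.1) P.2; omega)
    have hs : s < P.2 - P.1 := by
      rcases eq_or_lt_of_le h2 with rfl | h'
      · omega
      · exact h'
    have he : P.2 - P.1 < e := by
      rcases eq_or_lt_of_le h1' with rfl | h'
      · omega
      · exact h'
    have h5 := h4 (s + 1) (by omega) (by omega)
    have h6 : ¬ P.2 ≤ f p (e - 1) + (e - 1) := by
      rcases eq_or_lt_of_le (show P.2 - P.1 ≤ e - 1 by omega) with h' | h'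
      · rw [← h']; omega
      · exact h4' (e - 1) (by omega) (by omega)
    have h7 := h.step p s
    have h8 := (h.step p).pred e
    obtain ⟨τ, hτ1, hτ2, hτ⟩ := (h.step p).exists_isNWCorner (d := s) (e := e) (by omega)
      (by omega) (by omega)
    have h9 : f p τ < P.1 := by
      have := (h.step p).anti (show s + 1 ≤ τ by omega)
      omega
    have h10 : f p τ + τ < P.2 := by
      have := (h.step p).mono_add (show τ ≤ e - 1 by omega)
      omega
    have hmem := hX.nw p τ hτ (by omega)
    have h11 := chainNW_add_one_le hmem (Q := P) h9 h10
  · subst hpp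
    left
    simp only
    omega
  · subst hpp
    have h12 := ih (f ⟨m + 1, hm⟩ τ, f ⟨m + 1, hm⟩ τ + τ) (by omega) (by omega) (by
      simp only [add_sub_cancel_left]
      exact h.lt _ _ τ (Fin.mk_lt_mk.2 (by omega)))
    simp only at h12 ⊢
    omega

theorem add_sub_le (h : IsPathSystem a b u f) (p p' : Fin u) (hp : p ≤ p') (t : ℤ) :
    f p t + (p'.val - p.val : ℤ) ≤ f p' t :=
  Fin.add_sub_le_of_lt_succ (c := fun p => f p t)
    (fun _ _ => h.lt _ _ t (Fin.mk_lt_mk.2 (Nat.lt_succ_self _))) hp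

theorem le_rows (h : IsPathSystem a b u f) : u ≤ a := by
  rcases Nat.eq_zero_or_pos u with rfl | hu
  · exact Nat.zero_le a
  · have h1 := h.le_row ⟨0, hu⟩ 0
    have h2 := h.row_le ⟨0, hu⟩ 0
    omega

/-- Here `m` is the number of paths passing north-west of `P`. The correction term counts only paths
forced there by their endpoints, so it does not exceed `m`. -/
theorem rho_eq (h : IsPathSystem a b u f) (hX : ContainsCorners b u f X) {P : ℤ × ℤ}
    (hP2 : P.1 ≤ a) (hP4 : P.2 ≤ b) {m : ℕ} (hmu : m ≤ u)
    (hm : ∀ q : Fin u, f q (P.2 - P.1) < P.1 ↔ q.val < m) :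
    rho a b u X P = m ∧ (m ≤ chainNW X P ∨ (m : ℤ) ≤ P.1 - 1 - (a - u)) := by
  have h1 := h.chainNW_le hX.exists_onPath (P := P) (m := m) fun q hq => (hm q).1 hq
  have h2 : m ≤ chainNW X P ∨ (m : ℤ) ≤ P.1 - 1 - (a - u) := by
    cases m with
    | zero => left; omega
    | succ m =>
      have := h.le_chainNW_or hX ⟨m, hmu⟩ P hP4 ((hm ⟨m, hmu⟩).2 (Nat.lt_succ_self m))
      simp only at this
      push_cast
      omega
  have h3 : P.1 - 1 - ((a : ℤ) - u) ≤ m := by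
    by_contra hcon
    have h4 := (hm ⟨m, by omega⟩).1 (by
      have := h.row_le ⟨m, by omega⟩ (P.2 - P.1)
      simp only at this
      omega)
    simp at h4
  have h5 : min (P.1 - 1) (P.2 - 1 - ((b : ℤ) - u)) ≤ m := by
    by_contra hcon
    have hmu' : m < u := by omega
    have h6 : ¬ f ⟨m, hmu'⟩ (P.2 - P.1) < P.1 := fun h' => by
      have := (hm ⟨m, hmu'⟩).1 h'
      simp at this
    -- Path `m` is at least `u - 1 - m` rows above the last path on the same diagonal, and the
    -- latter is controlled by its endpoint `(u, b)`.
    have h7 := h.add_sub_le ⟨m, hmu'⟩ ⟨u - 1, by omega⟩ (by rw [Fin.le_def]; simp only; omega)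
      (P.2 - P.1)
    have h8 : ((u - 1 : ℕ) : ℤ) = u - 1 := by omega
    simp only [h8] at h7
    rcases le_or_gt (b : ℤ) (u + (P.2 - P.1)) with h9 | h9
    · rw [h.right ⟨u - 1, by omega⟩ _ (by simp only; omega)] at h7
      simp only at h7
      omega
    · have h10 := (h.step ⟨u - 1, by omega⟩).mono_add (show P.2 - P.1 ≤ b - u by omega)
      rw [h.right ⟨u - 1, by omega⟩ (b - u) (by simp only; omega)] at h10
      simp only at h10
      omega
  have h6 := h.le_rows
  refine ⟨?_, h2⟩
  unfold rho
  omega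

theorem sigma_eq (h : IsPathSystem a b u f) (hX : ContainsCorners b u f X) {P : ℤ × ℤ}
    (hP1 : 1 ≤ P.1) (hP3 : 1 ≤ P.2) {m : ℕ} (hmu : m ≤ u)
    (hm : ∀ q : Fin u, P.1 < f q (P.2 - P.1) ↔ u ≤ q.val + m) :
    sigma a u X P = m ∧ (m ≤ chainSE X P ∨ (m : ℤ) ≤ u - P.1) := by
  have := (h.rotate).rho_eq (hX.rotate (a := a)) (P := pointReflection a b P)
    (by simp only [pointReflection]; omega) (by simp only [pointReflection]; omega) hmu (by
      intro q
      have h1 := hm q.rev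
      have h2 := Fin.val_rev q
      simp only [pointReflection]
      rw [show (b : ℤ) - a - (b + 1 - P.2 - (a + 1 - P.1)) = P.2 - P.1 by ring]
      constructor
      · intro h3
        have := h1.1 (by omega)
        omega
      · intro h3
        have := h1.2 (by omega)
        omega)
  rw [chainNW_image_pointReflection] at this
  simp only [rho, chainNW_image_pointReflection, sigma] at this ⊢
  simp only [pointReflection] at this
  omega

theorem rho_sigma_of_onPath (h : IsPathSystem a b u f) (hX : ContainsCorners b u f X) {P : ℤ × ℤ}
    (hP1 : 1 ≤ P.1) (hP2 : P.1 ≤ a) (hP3 : 1 ≤ P.2) (hP4 : P.2 ≤ b) {p : Fin u}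
    (hp : OnPath (f p) P) : rho a b u X P = p.val ∧ sigma a u X P = u - 1 - p.val := by
  have hlt : ∀ q, f q (P.2 - P.1) < P.1 ↔ q.val < p.val := by
    intro q
    unfold OnPath at hp
    rcases lt_trichotomy q p with hq | rfl | hq
    · have := h.lt _ _ (P.2 - P.1) hq
      simp only [Fin.lt_def] at hq
      omega
    · omega
    · have := h.lt _ _ (P.2 - P.1) hq
      simp only [Fin.lt_def] at hq
      omega
  have hgt : ∀ q, P.1 < f q (P.2 - P.1) ↔ u ≤ q.val + (u - 1 - p.val) := by
    intro q
    have := p.2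
    unfold OnPath at hp
    rcases lt_trichotomy q p with hq | rfl | hq
    · have := h.lt _ _ (P.2 - P.1) hq
      simp only [Fin.lt_def] at hq
      omega
    · omega
    · have := h.lt _ _ (P.2 - P.1) hq
      simp only [Fin.lt_def] at hq
      omega
  have h1 := p.2
  have h2 := (h.rho_eq hX hP2 hP4 p.2.le hlt).1
  have h3 := (h.sigma_eq hX hP1 hP3 (by omega) hgt).1
  omega

/-- Off the paths actual chains reach the bound: if the starting row were needed to count `m` paths,
it would also keep path `m` weakly above `P`, although that path passes strictly south-east. The
argument for `chainSE` is dual. -/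
theorem rho_sigma_of_not_onPath (h : IsPathSystem a b u f) (hX : ContainsCorners b u f X)
    {P : ℤ × ℤ} (hP1 : 1 ≤ P.1) (hP2 : P.1 ≤ a) (hP3 : 1 ≤ P.2) (hP4 : P.2 ≤ b)
    (hp : ∀ p, ¬ OnPath (f p) P) :
    rho a b u X P + sigma a u X P = u ∧ u ≤ chainNW X P + chainSE X P := by
  obtain ⟨m, hmu, hm⟩ : ∃ m ≤ u, ∀ q : Fin u, f q (P.2 - P.1) < P.1 ↔ q.val < m := by
    classical
    have hex : ∃ m, ∀ q : Fin u, m = q.val → P.1 ≤ f q (P.2 - P.1) := ⟨u, fun q hq => by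
      have := q.2; omega⟩
    refine ⟨Nat.find hex, Nat.find_min' hex fun q hq => by have := q.2; omega, fun q => ?_⟩
    constructor
    · intro hq
      by_contra hcon
      have hlt : Nat.find hex < u := by have := q.2; omega
      have h1 := Nat.find_spec hex ⟨Nat.find hex, hlt⟩ rfl
      rcases eq_or_lt_of_le (not_lt.1 hcon) with h' | h'
      · have := Nat.find_spec hex q h'
        omega
      · have := h.lt ⟨Nat.find hex, hlt⟩ q (P.2 - P.1) (by rw [Fin.lt_def]; exact h')
        omega
    · intro hq
      have := Nat.find_min hex hq
      push Not at this
      obtain ⟨q', h1, h2⟩ := this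
      rwa [Fin.val_injective h1]
  have hgt : ∀ q : Fin u, P.1 < f q (P.2 - P.1) ↔ u ≤ q.val + (u - m) := by
    intro q
    have h1 := hm q
    have h2 := hp q
    unfold OnPath at h2
    omega
  obtain ⟨h1, h2⟩ := h.rho_eq hX hP2 hP4 hmu hm
  obtain ⟨h3, h4⟩ := h.sigma_eq hX hP1 hP3 (by omega) hgt
  refine ⟨by omega, ?_⟩
  have h5 : m ≤ chainNW X P := by
    rcases h2 with h2 | h2
    · exact h2
    · exfalso
      have hmu' : m < u := by omega
      have h6 := h.row_le ⟨m, hmu'⟩ (P.2 - P.1)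
      have h7 := (hgt ⟨m, hmu'⟩).2 (by simp only; omega)
      simp only at h6
      omega
  have h6 : u - m ≤ chainSE X P := by
    rcases h4 with h4 | h4
    · exact h4
    · exfalso
      have hm0 : m - 1 < u := by omega
      have h6 := h.le_row ⟨m - 1, hm0⟩ (P.2 - P.1)
      have h7 := (hm ⟨m - 1, hm0⟩).2 (by simp only; omega)
      simp only at h6
      omega
  omega

end IsPathSystem

/-! ### Pages, block matrices and transposition. -/

namespace BipartiteDatum

variable {S T : Type*} {n : ℕ} (D : BipartiteDatum S T n)

/-- The reversed quiver. -/
def op : BipartiteDatum T S n := ⟨D.tgt, D.src, D.mT, D.mS, D.uT, D.uS⟩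

/-- Transposition of the positions of a page. -/
def flip (x : ℤ × ℤ × Fin n) : ℤ × ℤ × Fin n := (x.2.1, x.1, x.2.2)

theorem flip_injective : Function.Injective (flip (n := n)) :=
  Function.LeftInverse.injective (g := flip) fun _ => rfl

open scoped Classical in
/-- The number of columns of the block matrix at a target that precede page `k`. -/
def offT (k : Fin n) : ℤ :=
  ∑ l ∈ Finset.univ.filter (fun l => l < k ∧ D.tgt l = D.tgt k), (D.mS (D.src l) : ℤ)

theorem posT_eq (x : ℤ × ℤ × Fin n) : D.posT x = (x.1, D.offT x.2.2 + x.2.1) := rfl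

open scoped Classical in
/-- The number of columns in the pages `l < m` at the target `α`. -/
def prefixT (α : T) (m : ℕ) : ℕ :=
  ∑ l ∈ Finset.univ.filter (fun l : Fin n => l.val < m ∧ D.tgt l = α), D.mS (D.src l)

theorem offT_eq (k : Fin n) : D.offT k = D.prefixT (D.tgt k) k.val := by
  unfold offT prefixT
  rw [Nat.cast_sum]
  rfl

theorem prefixT_mono (α : T) {m m' : ℕ} (h : m ≤ m') : D.prefixT α m ≤ D.prefixT α m' :=
  sum_le_sum_of_subset fun l hl => by
    simp only [mem_filter, mem_univ, true_and] at hl ⊢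
    exact ⟨by omega, hl.2⟩

theorem prefixT_zero (α : T) : D.prefixT α 0 = 0 := by simp [prefixT]

theorem prefixT_length (α : T) : D.prefixT α n = D.bT α := by
  classical
  unfold prefixT bT
  exact sum_congr (ext fun l => by simp) fun _ _ => rfl

theorem prefixT_succ (k : Fin n) :
    D.prefixT (D.tgt k) (k.val + 1) = D.prefixT (D.tgt k) k.val + D.mS (D.src k) := by
  classical
  unfold prefixT
  rw [add_comm (∑ _ ∈ _, _), ← sum_insert (f := fun l => D.mS (D.src l)) (a := k) (by simp)]
  refine sum_congr (ext fun l => ?_) fun _ _ => rfl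
  simp only [mem_filter, mem_univ, true_and, mem_insert]
  constructor
  · rintro ⟨h1, h2⟩
    rcases Nat.lt_succ_iff_lt_or_eq.1 h1 with h | h
    · exact Or.inr ⟨h, h2⟩
    · exact Or.inl (Fin.ext h)
  · rintro (rfl | h)
    · exact ⟨by omega, rfl⟩
    · exact ⟨by omega, h.2⟩

theorem prefixT_succ_of_ne {α : T} {k : Fin n} (h : D.tgt k ≠ α) :
    D.prefixT α (k.val + 1) = D.prefixT α k.val := by
  classical
  unfold prefixT
  refine sum_congr (ext fun l => ?_) fun _ _ => rfl
  simp only [mem_filter, mem_univ, true_and]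
  constructor
  · rintro ⟨h1, h2⟩
    refine ⟨lt_of_le_of_ne (by omega) fun e => h ?_, h2⟩
    rw [← h2, Fin.ext e]
  · rintro ⟨h1, h2⟩
    exact ⟨by omega, h2⟩

theorem offT_nonneg (k : Fin n) : 0 ≤ D.offT k := by rw [offT_eq]; omega

theorem offT_add_le {k k' : Fin n} (h : k < k') (ht : D.tgt k = D.tgt k') :
    D.offT k + D.mS (D.src k) ≤ D.offT k' := by
  have h1 := D.prefixT_succ k
  have h2 := D.prefixT_mono (D.tgt k) (show k.val + 1 ≤ k'.val from h)
  rw [offT_eq, offT_eq, ← ht]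
  omega

theorem offT_add_le_bT (k : Fin n) : D.offT k + D.mS (D.src k) ≤ D.bT (D.tgt k) := by
  have h1 := D.prefixT_succ k
  have h2 := D.prefixT_mono (D.tgt k) (show k.val + 1 ≤ n from k.2)
  rw [prefixT_length] at h2
  rw [offT_eq]
  omega

theorem exists_page {α : T} {j : ℤ} (h1 : 1 ≤ j) (h2 : j ≤ D.bT α) :
    ∃ k, D.tgt k = α ∧ D.offT k + 1 ≤ j ∧ j ≤ D.offT k + D.mS (D.src k) := by
  classical
  have hex : ∃ m, j ≤ D.prefixT α m := ⟨n, by rwa [prefixT_length]⟩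
  have hm := Nat.find_spec hex
  have hmn : Nat.find hex ≤ n := Nat.find_min' hex (by rwa [prefixT_length])
  obtain ⟨m, hm'⟩ : ∃ m, Nat.find hex = m + 1 := by
    refine Nat.exists_eq_succ_of_ne_zero fun h0 => ?_
    rw [h0, prefixT_zero] at hm
    omega
  have hlt := Nat.find_min hex (m := m) (by omega)
  rw [hm'] at hm
  have hk : D.tgt ⟨m, by omega⟩ = α := by
    by_contra hne
    have := D.prefixT_succ_of_ne hne
    simp only at this
    omega
  have h3 := D.prefixT_succ ⟨m, by omega⟩
  refine ⟨⟨m, by omega⟩, hk, ?_⟩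
  rw [offT_eq]
  rw [hk] at h3 ⊢
  simp only at h3 ⊢
  omega

theorem mem_L_iff {x : ℤ × ℤ × Fin n} :
    x ∈ D.L ↔ 1 ≤ x.1 ∧ x.1 ≤ D.mT (D.tgt x.2.2) ∧ 1 ≤ x.2.1 ∧ x.2.1 ≤ D.mS (D.src x.2.2) :=
  Iff.rfl

theorem flip_mem_L {x : ℤ × ℤ × Fin n} : flip x ∈ D.op.L ↔ x ∈ D.L := by
  rw [mem_L_iff, mem_L_iff]
  simp only [flip, op]
  tauto

theorem posT_bounds {x : ℤ × ℤ × Fin n} (hx : x ∈ D.L) :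
    1 ≤ (D.posT x).1 ∧ (D.posT x).1 ≤ D.aT (D.tgt x.2.2) ∧
      1 ≤ (D.posT x).2 ∧ (D.posT x).2 ≤ D.bT (D.tgt x.2.2) := by
  rw [mem_L_iff] at hx
  have h1 := D.offT_nonneg x.2.2
  have h2 := D.offT_add_le_bT x.2.2
  rw [posT_eq]
  simp only [aT]
  omega

theorem exists_mem_L {α : T} {P : ℤ × ℤ} (h1 : 1 ≤ P.1) (h2 : P.1 ≤ D.aT α) (h3 : 1 ≤ P.2)
    (h4 : P.2 ≤ D.bT α) : ∃ x ∈ D.L, D.tgt x.2.2 = α ∧ D.posT x = P := by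
  obtain ⟨k, hk, h5, h6⟩ := D.exists_page h3 h4
  refine ⟨(P.1, P.2 - D.offT k, k), ?_, hk, ?_⟩
  · rw [mem_L_iff]
    simp only [hk]
    exact ⟨h1, h2, by omega, by omega⟩
  · rw [posT_eq]
    ext <;> simp

theorem page_eq {k k' : Fin n} (ht : D.tgt k = D.tgt k') {j : ℤ} (h1 : D.offT k + 1 ≤ j)
    (h2 : j ≤ D.offT k + D.mS (D.src k)) (h3 : D.offT k' + 1 ≤ j)
    (h4 : j ≤ D.offT k' + D.mS (D.src k')) : k = k' := by
  rcases lt_trichotomy k k' with h | h | h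
  · have := D.offT_add_le h ht; omega
  · exact h
  · have := D.offT_add_le h ht.symm; omega

theorem posT_inj {x y : ℤ × ℤ × Fin n} (hx : x ∈ D.L) (hy : y ∈ D.L)
    (ht : D.tgt x.2.2 = D.tgt y.2.2) (h : D.posT x = D.posT y) : x = y := by
  rw [mem_L_iff] at hx hy
  obtain ⟨i, j, k⟩ := x
  obtain ⟨i', j', k'⟩ := y
  simp only [posT_eq, Prod.mk.injEq] at *
  have hk : k = k' := D.page_eq ht (j := D.offT k + j) (by omega) (by omega) (by omega) (by omega)
  subst hk
  refine ⟨h.1, by omega, rfl⟩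

theorem mem_partT {C : Finset (ℤ × ℤ × Fin n)} {α : T} {P : ℤ × ℤ} :
    P ∈ D.partT C α ↔ ∃ x ∈ C, D.tgt x.2.2 = α ∧ D.posT x = P := by
  classical
  simp only [partT, mem_image, mem_filter, and_assoc]

theorem mem_partS {C : Finset (ℤ × ℤ × Fin n)} {β : S} {P : ℤ × ℤ} :
    P ∈ D.partS C β ↔ ∃ x ∈ C, D.src x.2.2 = β ∧ D.posS x = P := by
  classical
  simp only [partS, mem_image, mem_filter, and_assoc]

theorem posT_mem_partT {C : Finset (ℤ × ℤ × Fin n)} (hC : (C : Set (ℤ × ℤ × Fin n)) ⊆ D.L)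
    {x : ℤ × ℤ × Fin n} (hx : x ∈ D.L) : D.posT x ∈ D.partT C (D.tgt x.2.2) ↔ x ∈ C := by
  rw [mem_partT]
  constructor
  · rintro ⟨y, hy, h1, h2⟩
    rwa [← D.posT_inj (hC hy) hx h1 h2]
  · exact fun h => ⟨x, h, rfl, rfl⟩

theorem partT_inBox {C : Finset (ℤ × ℤ × Fin n)} (hC : (C : Set (ℤ × ℤ × Fin n)) ⊆ D.L) (α : T) :
    InBox (D.aT α) (D.bT α) (D.partT C α) := by
  intro P hP
  obtain ⟨x, hx, rfl, rfl⟩ := D.mem_partT.1 hP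
  exact D.posT_bounds (hC hx)

open scoped Classical in
/-- The transposed set of positions. -/
def flipSet (C : Finset (ℤ × ℤ × Fin n)) : Finset (ℤ × ℤ × Fin n) := C.image flip

theorem flip_mem_flipSet {C : Finset (ℤ × ℤ × Fin n)} {x : ℤ × ℤ × Fin n} :
    flip x ∈ flipSet C ↔ x ∈ C := by
  classical
  unfold flipSet
  exact flip_injective.mem_finset_image

theorem mem_flipSet {C : Finset (ℤ × ℤ × Fin n)} {x : ℤ × ℤ × Fin n} :
    x ∈ flipSet C ↔ flip x ∈ C := flip_mem_flipSet (x := flip x)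

theorem flipSet_flipSet (C : Finset (ℤ × ℤ × Fin n)) : flipSet (flipSet C) = C := by
  ext x
  rw [mem_flipSet, mem_flipSet]
  rfl

theorem flipSet_subset_L {C : Finset (ℤ × ℤ × Fin n)} (hC : (C : Set (ℤ × ℤ × Fin n)) ⊆ D.L) :
    (flipSet C : Set (ℤ × ℤ × Fin n)) ⊆ D.op.L := fun x hx => by
  rw [mem_coe, mem_flipSet] at hx
  exact (D.flip_mem_L (x := flip x)).2 (hC hx)

/-- Definitional: the block matrix at a source is the transpose of the one at the same vertex viewed
as a target of `op`. All later statements about sources rest on it. -/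
theorem op_posT_flip (x : ℤ × ℤ × Fin n) : D.op.posT (flip x) = (D.posS x).swap := rfl

theorem partS_eq (C : Finset (ℤ × ℤ × Fin n)) (β : S) :
    D.op.partT (flipSet C) β = (D.partS C β).image Prod.swap := by
  classical
  ext P
  rw [mem_partT, mem_image]
  constructor
  · rintro ⟨x, hx, h1, rfl⟩
    exact ⟨D.posS (flip x), D.mem_partS.2 ⟨flip x, mem_flipSet.1 hx, h1, rfl⟩, rfl⟩
  · rintro ⟨Q, hQ, rfl⟩
    obtain ⟨x, hx, h1, rfl⟩ := D.mem_partS.1 hQ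
    exact ⟨flip x, flip_mem_flipSet.2 hx, h1, rfl⟩

theorem maxChainSize_partS (C : Finset (ℤ × ℤ × Fin n)) (β : S) :
    maxChainSize (D.op.partT (flipSet C) β) = maxChainSize (D.partS C β) := by
  rw [partS_eq]
  exact maxChainSize_image _ _ Prod.swap_injective isDiagonalChain_image_swap

theorem rS_eq (C : Finset (ℤ × ℤ × Fin n)) (x : ℤ × ℤ × Fin n) :
    D.rS C x = D.op.rT (flipSet C) (flip x) := by
  unfold rS rT
  rw [op_posT_flip, show D.op.tgt (flip x).2.2 = D.src x.2.2 from rfl, partS_eq,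
    chainNW_image_swap]

theorem sS_eq (C : Finset (ℤ × ℤ × Fin n)) (x : ℤ × ℤ × Fin n) :
    D.sS C x = D.op.sT (flipSet C) (flip x) := by
  unfold sS sT
  rw [op_posT_flip, show D.op.tgt (flip x).2.2 = D.src x.2.2 from rfl, partS_eq,
    chainSE_image_swap]

theorem rbarT_eq (C : Finset (ℤ × ℤ × Fin n)) (x : ℤ × ℤ × Fin n) :
    D.rbarT C x = rho (D.aT (D.tgt x.2.2)) (D.bT (D.tgt x.2.2)) (D.uT (D.tgt x.2.2))
      (D.partT C (D.tgt x.2.2)) (D.posT x) := rfl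

theorem sbarT_eq (C : Finset (ℤ × ℤ × Fin n)) (x : ℤ × ℤ × Fin n) :
    D.sbarT C x = sigma (D.aT (D.tgt x.2.2)) (D.uT (D.tgt x.2.2))
      (D.partT C (D.tgt x.2.2)) (D.posT x) := rfl

theorem rbarS_eq (C : Finset (ℤ × ℤ × Fin n)) (x : ℤ × ℤ × Fin n) :
    D.rbarS C x = D.op.rbarT (flipSet C) (flip x) := by
  unfold rbarS
  rw [rS_eq]
  rfl

theorem sbarS_eq (C : Finset (ℤ × ℤ × Fin n)) (x : ℤ × ℤ × Fin n) :
    D.sbarS C x = D.op.sbarT (flipSet C) (flip x) := by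
  unfold sbarS
  rw [sS_eq, min_comm (D.posS x).1]
  rfl

theorem isUCompatible_iff (C : Finset (ℤ × ℤ × Fin n)) :
    D.IsUCompatible C ↔ (C : Set (ℤ × ℤ × Fin n)) ⊆ D.L ∧
      (∀ α, maxChainSize (D.partT C α) ≤ D.uT α) ∧
      (∀ β, maxChainSize (D.op.partT (flipSet C) β) ≤ D.uS β) := by
  unfold IsUCompatible
  simp only [maxChainSize_partS, maxChainSize_le_iff_not_exists]

theorem Admissible.op {D : BipartiteDatum S T n} (h : D.Admissible) : D.op.Admissible := by
  obtain ⟨h1, h2⟩ := h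
  exact ⟨fun β => by rw [min_comm]; exact h2 β, fun α => by rw [min_comm]; exact h1 α⟩

/-- The point `x` lies on one of the paths `f` at the target of its arrow. -/
def Meets (f : ∀ α, Fin (D.uT α) → ℤ → ℤ) (x : ℤ × ℤ × Fin n) : Prop :=
  ∃ p, OnPath (f (D.tgt x.2.2) p) (D.posT x)

/-- Systems of paths in the block matrices at all targets. -/
def IsPathMap (f : ∀ α, Fin (D.uT α) → ℤ → ℤ) : Prop :=
  ∀ α, IsPathSystem (D.aT α) (D.bT α) (D.uT α) (f α)

/-- The corners of north-west type of the paths `f` at the targets, extended by horizontal rays, lie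
on the (transposed) paths `g` at the sources. -/
def NWCornersMeet (f : ∀ α, Fin (D.uT α) → ℤ → ℤ) (g : ∀ β, Fin (D.uS β) → ℤ → ℤ) : Prop :=
  ∀ x ∈ D.L, ∀ p, OnPath (f (D.tgt x.2.2) p) (D.posT x) →
    IsNWCorner (f (D.tgt x.2.2) p) ((D.posT x).2 - (D.posT x).1) → D.op.Meets g (flip x)

/-- The corners of the paths `f` at the targets lie on the (transposed) paths `g` at the sources. -/
def CornersMeet (f : ∀ α, Fin (D.uT α) → ℤ → ℤ) (g : ∀ β, Fin (D.uS β) → ℤ → ℤ) : Prop :=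
  ∀ x ∈ D.L, ∀ p, OnPath (f (D.tgt x.2.2) p) (D.posT x) →
    ((IsNWCorner (f (D.tgt x.2.2) p) ((D.posT x).2 - (D.posT x).1) ∧
        (D.posT x).2 + 1 ≤ D.bT (D.tgt x.2.2)) ∨
      (IsSECorner (f (D.tgt x.2.2) p) ((D.posT x).2 - (D.posT x).1) ∧ 2 ≤ (D.posT x).2)) →
    D.op.Meets g (flip x)

/-- The path `p` at the target of arrow `k` in the coordinates of page `k`. -/
def pageF (f : ∀ α, Fin (D.uT α) → ℤ → ℤ) (k : Fin n) (p : Fin (D.uT (D.tgt k))) (t : ℤ) : ℤ :=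
  f (D.tgt k) p (t + D.offT k)

/-- The transposed path `q` at the source of arrow `k` in the coordinates of page `k`. -/
def pageG (g : ∀ β, Fin (D.uS β) → ℤ → ℤ) (k : Fin n) (q : Fin (D.uS (D.src k))) (t : ℤ) : ℤ :=
  g (D.src k) q (D.op.offT k - t) - t

variable {D} {f : ∀ α, Fin (D.uT α) → ℤ → ℤ} {g : ∀ β, Fin (D.uS β) → ℤ → ℤ}

theorem onPath_posT_iff {x : ℤ × ℤ × Fin n} {p : Fin (D.uT (D.tgt x.2.2))} :
    OnPath (f (D.tgt x.2.2) p) (D.posT x) ↔ D.pageF f x.2.2 p (x.2.1 - x.1) = x.1 := by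
  unfold OnPath pageF
  rw [posT_eq]
  simp only
  rw [show D.offT x.2.2 + x.2.1 - x.1 = x.2.1 - x.1 + D.offT x.2.2 by ring]

/-- After transposition the page diagonal `t` becomes `D.op.offT k - t`, and `g` returns a column;
subtracting `t` turns it into a row. Hence the formula for `pageG`. -/
theorem onPath_op_posT_iff {x : ℤ × ℤ × Fin n} {q : Fin (D.uS (D.src x.2.2))} :
    OnPath (g (D.src x.2.2) q) (D.op.posT (flip x)) ↔ D.pageG g x.2.2 q (x.2.1 - x.1) = x.1 := by
  unfold OnPath pageG
  rw [posT_eq]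
  simp only [flip]
  rw [show D.op.offT x.2.2 + x.1 - x.2.1 = D.op.offT x.2.2 - (x.2.1 - x.1) by ring]
  omega

theorem pageF_row (hf : D.IsPathMap f) (k : Fin n) (p : Fin (D.uT (D.tgt k))) (t : ℤ) :
    1 ≤ D.pageF f k p t ∧ D.pageF f k p t ≤ D.mT (D.tgt k) := by
  have h1 := (hf (D.tgt k)).le_row p (t + D.offT k)
  have h2 := (hf (D.tgt k)).row_le p (t + D.offT k)
  have h3 := p.2
  unfold pageF
  unfold aT at h2
  omega

theorem pageG_col (hg : D.op.IsPathMap g) (k : Fin n) (q : Fin (D.uS (D.src k))) (t : ℤ) :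
    1 ≤ D.pageG g k q t + t ∧ D.pageG g k q t + t ≤ D.mS (D.src k) := by
  have := pageF_row hg k q (-t)
  unfold pageF at this
  unfold pageG
  rw [neg_add_eq_sub] at this
  exact ⟨by have := this.1; simp only [op] at this ⊢; omega,
    by have := this.2; simp only [op] at this ⊢; omega⟩

theorem isPathFun_pageF (hf : D.IsPathMap f) (k : Fin n) (p : Fin (D.uT (D.tgt k))) :
    IsPathFun (D.pageF f k p) := fun t => by
  have := (hf (D.tgt k)).step p (t + D.offT k)
  unfold pageF
  rwa [show t + 1 + D.offT k = t + D.offT k + 1 by ring]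

theorem isPathFun_pageG (hg : D.op.IsPathMap g) (k : Fin n) (q : Fin (D.uS (D.src k))) :
    IsPathFun (D.pageG g k q) := fun t => by
  have := (hg (D.src k)).step q (D.op.offT k - (t + 1))
  unfold pageG
  rw [show D.op.offT k - (t + 1) + 1 = D.op.offT k - t by ring] at this
  omega

theorem pageSystem (hf : D.IsPathMap f) (hg : D.op.IsPathMap g) (hfg : D.NWCornersMeet f g)
    (hgf : D.op.NWCornersMeet g f) (k : Fin n) :
    PageSystem (D.mT (D.tgt k)) (D.mS (D.src k)) (D.uT (D.tgt k)) (D.uS (D.src k))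
      (D.pageF f k) (D.pageG g k) where
  isPathFun_F := isPathFun_pageF hf k
  isPathFun_G := isPathFun_pageG hg k
  row_F := pageF_row hf k
  col_G := pageG_col hg k
  lt_F p p' t h := (hf (D.tgt k)).lt p p' _ h
  lt_G q q' t h := by
    have := (hg (D.src k)).lt q q' (D.op.offT k - t) h
    unfold pageG
    omega
  corner_F p t ht h1 h2 := by
    have hrow := pageF_row hf k p t
    have hx : (D.pageF f k p t, D.pageF f k p t + t, k) ∈ D.L := ⟨hrow.1, hrow.2, h1, h2⟩
    obtain ⟨q, hq⟩ := hfg _ hx p (onPath_posT_iff.2 (by simp)) (by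
      simp only [posT_eq]
      rw [show D.offT k + (D.pageF f k p t + t) - D.pageF f k p t = t + D.offT k by ring]
      obtain ⟨h3, h4⟩ := ht
      unfold pageF at h3 h4
      rw [show t - 1 + D.offT k = t + D.offT k - 1 by ring] at h3
      rw [show t + 1 + D.offT k = t + D.offT k + 1 by ring] at h4
      exact ⟨h3, h4⟩)
    have hq := onPath_op_posT_iff.1 hq
    exact ⟨q, by simpa using hq⟩
  corner_G q t ht h1 h2 := by
    have hcol := pageG_col hg k q t
    have hx : (D.pageG g k q t, D.pageG g k q t + t, k) ∈ D.L := ⟨h1, h2, hcol.1, hcol.2⟩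
    obtain ⟨p, hp⟩ := hgf _ ((D.flip_mem_L).2 hx) q (onPath_op_posT_iff.2 (by simp)) (by
      simp only [posT_eq, flip]
      rw [show D.op.offT k + D.pageG g k q t - (D.pageG g k q t + t) = D.op.offT k - t by ring]
      obtain ⟨h3, h4⟩ := ht
      unfold pageG at h3 h4
      rw [show D.op.offT k - (t - 1) = D.op.offT k - t + 1 by ring] at h3
      rw [show D.op.offT k - (t + 1) = D.op.offT k - t - 1 by ring] at h4
      constructor
      · change g (D.src k) q _ = g (D.src k) q _ + 1; omega
      · change g (D.src k) q _ = g (D.src k) q _; omega)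
    have hp := onPath_posT_iff.1 hp
    refine ⟨p, ?_⟩
    change D.pageF f k p _ = _ at hp
    simpa [flip] using hp

end BipartiteDatum

/-! ### Translation between road maps and path functions. -/

/-- The vertices in the matrix of the path with index `p` of a path system. -/
def systemList (a b u p : ℕ) (f : ℤ → ℤ) : List (ℤ × ℤ) :=
  pathList f (1 - ((a : ℤ) - u + (p + 1)))
    ((b : ℤ) - (p + 1) - (1 - ((a : ℤ) - u + (p + 1))) + 1).toNat

namespace IsPathSystem

variable {a b u : ℕ} {f : Fin u → ℤ → ℤ}

theorem start_add (h : IsPathSystem a b u f) (p : Fin u) :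
    f p (1 - ((a : ℤ) - u + (p.val + 1))) = (a : ℤ) - u + (p.val + 1) :=
  h.left p _ (by omega)

theorem end_add (h : IsPathSystem a b u f) (p : Fin u) :
    f p ((b : ℤ) - (p.val + 1)) = p.val + 1 :=
  h.right p _ (by omega)

theorem start_le_iff (h : IsPathSystem a b u f) (p : Fin u) (t : ℤ) :
    1 - ((a : ℤ) - u + (p.val + 1)) ≤ t ↔ 1 ≤ f p t + t := by
  constructor
  · intro ht
    have := (h.step p).mono_add ht
    rw [h.start_add] at this
    omega
  · intro ht
    by_contra hcon
    rw [h.left p t (by omega)] at ht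
    omega

theorem le_end_iff (h : IsPathSystem a b u f) (p : Fin u) (t : ℤ) :
    t ≤ (b : ℤ) - (p.val + 1) ↔ f p t + t ≤ b := by
  constructor
  · intro ht
    have := (h.step p).mono_add ht
    rw [h.end_add] at this
    omega
  · intro ht
    by_contra hcon
    rw [h.right p t (by omega)] at ht
    omega

theorem mem_systemList (h : IsPathSystem a b u f) {p : Fin u} {P : ℤ × ℤ} :
    P ∈ systemList a b u p (f p) ↔ OnPath (f p) P ∧ 1 ≤ P.2 ∧ P.2 ≤ b := by
  unfold systemList
  rw [mem_pathList]
  have h1 := h.start_le_iff p (P.2 - P.1)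
  have h2 := h.le_end_iff p (P.2 - P.1)
  unfold OnPath
  constructor
  · rintro ⟨h3, h4, h5⟩
    rw [h5] at h1 h2
    omega
  · rintro ⟨h3, h4, h5⟩
    rw [h3] at h1 h2
    omega

/-- Attaching the rays may create a north-west corner in column `b` and a south-east corner in
column `1` that the finite path does not have; the column conditions discard them. -/
theorem isPathCorner_systemList (h : IsPathSystem a b u f) {p : Fin u} {R : ℤ × ℤ} :
    IsPathCorner (systemList a b u p (f p)) R ↔ ∃ t, R = (f p t, f p t + t) ∧
      (IsNWCorner (f p) t ∧ f p t + t + 1 ≤ b ∨ IsSECorner (f p) t ∧ 2 ≤ f p t + t) := by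
  unfold systemList
  rw [isPathCorner_pathList]
  refine exists_congr fun t => ?_
  have h1 := h.start_le_iff p (t - 1)
  have h2 := h.le_end_iff p (t + 1)
  have h3 := h.left_lt (p := p) (t := t - 1)
  have h4 := h.left_lt (p := p) (t := t)
  rw [sub_add_cancel] at h3
  unfold IsNWCorner IsSECorner
  constructor
  · rintro ⟨h5, h6, h7, h8 | h8⟩
    · exact ⟨h7, Or.inl ⟨h8, by omega⟩⟩
    · exact ⟨h7, Or.inr ⟨h8, by omega⟩⟩
  · rintro ⟨h7, ⟨h8, h9⟩ | ⟨h8, h9⟩⟩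
    · exact ⟨by omega, by omega, h7, Or.inl h8⟩
    · exact ⟨by omega, by omega, h7, Or.inr h8⟩

theorem isLatticePath_systemList (h : IsPathSystem a b u f) (hub : u ≤ b) (p : Fin u) :
    IsLatticePath ((a : ℤ) - u + (p.val + 1 : ℤ), 1) ((p.val + 1 : ℤ), (b : ℤ))
      (systemList a b u p (f p)) := by
  have h1 := h.le_rows
  have h2 := p.2
  have h3 := isLatticePath_pathList (h.step p) (1 - ((a : ℤ) - u + (p.val + 1)))
    ((b : ℤ) - (p.val + 1) - (1 - ((a : ℤ) - u + (p.val + 1)))).toNat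
  have h4 : (((b : ℤ) - (p.val + 1) - (1 - ((a : ℤ) - u + (p.val + 1)))).toNat : ℤ) =
    (b : ℤ) - (p.val + 1) - (1 - ((a : ℤ) - u + (p.val + 1))) := Int.toNat_of_nonneg (by omega)
  rw [h4, add_sub_cancel, h.start_add, h.end_add, add_sub_cancel, add_sub_cancel] at h3
  unfold systemList
  rwa [Int.toNat_add (by omega) (by omega)]

theorem disjoint_systemList (h : IsPathSystem a b u f) {p p' : Fin u} (hp : p ≠ p') :
    (systemList a b u p (f p)).Disjoint (systemList a b u p' (f p')) := fun _ h1 h2 =>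
  hp (h.onPath_unique (h.mem_systemList.1 h1).1 (h.mem_systemList.1 h2).1)

/-- Two path functions change their distance by at most one per diagonal, so they cannot exchange
order without meeting. Far to the left the starting rows order them by index. -/
theorem exists_of_lists {l : Fin u → List (ℤ × ℤ)}
    (hl : ∀ p, IsLatticePath ((a : ℤ) - u + (p.val + 1 : ℤ), 1) ((p.val + 1 : ℤ), (b : ℤ)) (l p))
    (hd : ∀ p p', p ≠ p' → (l p).Disjoint (l p')) :
    ∃ f, IsPathSystem a b u f ∧ ∀ p, l p = systemList a b u p (f p) := by
  choose f hf1 hf2 hf3 hf4 hf5 using fun p => (hl p).exists_pathFun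
  simp only at hf2 hf3 hf4 hf5
  have hne : ∀ p p' t, p ≠ p' → f p t ≠ f p' t := by
    intro p p' t hp ht
    have hv : p.val ≠ p'.val := fun e => hp (Fin.ext e)
    -- Each point is on the left ray, on the right ray or in the list; its column tells these cases
    -- apart, so a coincidence of two points occurs within one case.
    have key : ∀ p : Fin u, (t < 1 - ((a : ℤ) - u + (p.val + 1)) ∧
        f p t = (a : ℤ) - u + (p.val + 1)) ∨ (b - ((p.val : ℤ) + 1) < t ∧ f p t = p.val + 1) ∨
        (1 ≤ f p t + t ∧ f p t + t ≤ b ∧ (f p t, f p t + t) ∈ l p) := by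
      intro p
      by_cases h1 : t < 1 - ((a : ℤ) - u + (p.val + 1))
      · exact Or.inl ⟨h1, hf2 p t h1.le⟩
      by_cases h2 : (b : ℤ) - (p.val + 1) < t
      · exact Or.inr (Or.inl ⟨h2, hf3 p t h2.le⟩)
      refine Or.inr (Or.inr ?_)
      have h3 := (hf1 p).mono_add (not_lt.1 h1)
      have h4 := (hf1 p).mono_add (not_lt.1 h2)
      rw [hf2 p _ le_rfl] at h3
      rw [hf3 p (b - (p.val + 1)) le_rfl] at h4
      refine ⟨by omega, by omega, ?_⟩
      rw [hf5 p, mem_pathList]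
      unfold OnPath
      simp only [add_sub_cancel_left, and_true]
      omega
    rcases key p with h | h | h <;> rcases key p' with h' | h' | h' <;> try omega
    rw [← ht] at h'
    exact hd p p' hp h.2.2 h'.2.2
  refine ⟨f, ⟨hf1, fun p t ht => hf2 p t (by omega), fun p t ht => hf3 p t (by omega), ?_⟩, hf5⟩
  intro p p' t hp
  have hv := Fin.lt_def.1 hp
  by_contra hcon
  obtain ⟨s, h1, h2, h3, h4⟩ := Int.exists_first (P := fun x => f p' x ≤ f p x)
    (lo := min t (-(a : ℤ))) (min_le_left _ _) (not_lt.1 hcon)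
  have hmin := min_le_right t (-(a : ℤ))
  have h5 := p.2
  have h6 := p'.2
  have h7 := hne p p' s hp.ne
  rcases eq_or_lt_of_le h1 with rfl | h1
  · rw [hf2 p _ (by omega), hf2 p' _ (by omega)] at h3
    omega
  · have h8 := h4 (s - 1) (by omega) (by omega)
    have h9 := (hf1 p).pred s
    have h10 := (hf1 p').pred s
    omega

end IsPathSystem

namespace BipartiteDatum

variable {S T : Type*} {n : ℕ} {D : BipartiteDatum S T n}

/-- The road map `R` consists of the paths `f` at the targets and of the transposed paths `g` at the
sources. -/
structure RoadMap.IsGivenBy (R : D.RoadMap) (f : ∀ α, Fin (D.uT α) → ℤ → ℤ)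
    (g : ∀ β, Fin (D.uS β) → ℤ → ℤ) : Prop where
  isPathMap_H : D.IsPathMap f
  isPathMap_V : D.op.IsPathMap g
  H_eq : ∀ α p, R.H α p = systemList (D.aT α) (D.bT α) (D.uT α) p (f α p)
  V_eq : ∀ β q, ((R.V β q).map Prod.swap).reverse =
    systemList (D.bS β) (D.aS β) (D.uS β) q (g β q)

theorem RoadMap.exists_isGivenBy (R : D.RoadMap) : ∃ f g, R.IsGivenBy f g := by
  have h1 := fun α => IsPathSystem.exists_of_lists (R.isPath_H α) (R.disjoint_H α)
  have h2 := fun β => IsPathSystem.exists_of_lists (a := D.bS β) (b := D.aS β)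
    (l := fun q => ((R.V β q).map Prod.swap).reverse)
    (fun q => isLatticePath_swap (R.isPath_V β q)) fun q q' hq P hP hP' => by
      simp only [List.mem_reverse, List.mem_map] at hP hP'
      obtain ⟨Q, hQ, rfl⟩ := hP
      obtain ⟨Q', hQ', e⟩ := hP'
      rw [Prod.swap_injective e] at hQ'
      exact R.disjoint_V β q q' hq hQ hQ'
  choose f hf hf' using h1
  choose g hg hg' using h2
  exact ⟨f, g, hf, hg, hf', hg'⟩

theorem exists_roadMap (hD : D.Admissible) {f : ∀ α, Fin (D.uT α) → ℤ → ℤ}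
    {g : ∀ β, Fin (D.uS β) → ℤ → ℤ} (hf : D.IsPathMap f) (hg : D.op.IsPathMap g) :
    ∃ R : D.RoadMap, R.IsGivenBy f g := by
  have hT : ∀ α, D.uT α ≤ D.bT α := fun α => (le_min_iff.1 (hD.1 α).2.1).2
  have hS : ∀ β, D.uS β ≤ D.aS β := fun β => (le_min_iff.1 (hD.2 β).2.1).1
  refine ⟨{ H := fun α p => systemList (D.aT α) (D.bT α) (D.uT α) p (f α p)
            V := fun β q => ((systemList (D.bS β) (D.aS β) (D.uS β) q (g β q)).map
              Prod.swap).reverse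
            isPath_H := fun α p => (hf α).isLatticePath_systemList (hT α) p
            isPath_V := fun β q => isLatticePath_swap ((hg β).isLatticePath_systemList (hS β) q)
            disjoint_H := fun α p p' hp => (hf α).disjoint_systemList hp
            disjoint_V := fun β q q' hq P hP hP' => ?_ }, hf, hg, fun _ _ => rfl, fun β q => ?_⟩
  · simp only [List.mem_reverse, List.mem_map] at hP hP'
    obtain ⟨Q, hQ, rfl⟩ := hP
    obtain ⟨Q', hQ', e⟩ := hP'
    rw [Prod.swap_injective e] at hQ'
    exact (hg β).disjoint_systemList hq hQ hQ'
  · exact swap_swap_list _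

namespace RoadMap.IsGivenBy

variable {R : D.RoadMap} {f : ∀ α, Fin (D.uT α) → ℤ → ℤ} {g : ∀ β, Fin (D.uS β) → ℤ → ℤ}

theorem mem_H_iff (h : R.IsGivenBy f g) {x : ℤ × ℤ × Fin n} (hx : x ∈ D.L)
    (p : Fin (D.uT (D.tgt x.2.2))) :
    D.posT x ∈ R.H (D.tgt x.2.2) p ↔ OnPath (f (D.tgt x.2.2) p) (D.posT x) := by
  have := D.posT_bounds hx
  rw [h.H_eq, (h.isPathMap_H _).mem_systemList]
  tauto

theorem mem_V_iff (h : R.IsGivenBy f g) {x : ℤ × ℤ × Fin n} (hx : x ∈ D.L)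
    (q : Fin (D.uS (D.src x.2.2))) :
    D.posS x ∈ R.V (D.src x.2.2) q ↔ OnPath (g (D.src x.2.2) q) (D.op.posT (flip x)) := by
  have h1 := D.op.posT_bounds (D.flip_mem_L.2 hx)
  have h2 : D.posS x ∈ R.V (D.src x.2.2) q ↔
      D.op.posT (flip x) ∈ ((R.V (D.src x.2.2) q).map Prod.swap).reverse := by
    rw [List.mem_reverse, op_posT_flip, List.mem_map_of_injective Prod.swap_injective]
  rw [h2, h.V_eq]
  refine (h.isPathMap_V (D.src x.2.2)).mem_systemList.trans ?_
  exact and_iff_left h1.2.2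

theorem onH_iff (h : R.IsGivenBy f g) {x : ℤ × ℤ × Fin n} (hx : x ∈ D.L) :
    R.OnH x ↔ D.Meets f x := exists_congr fun p => h.mem_H_iff hx p

theorem onV_iff (h : R.IsGivenBy f g) {x : ℤ × ℤ × Fin n} (hx : x ∈ D.L) :
    R.OnV x ↔ D.op.Meets g (flip x) := exists_congr fun p => h.mem_V_iff hx p

theorem induces_iff (h : R.IsGivenBy f g) {C : Finset (ℤ × ℤ × Fin n)} :
    R.Induces C ↔ ∀ x, x ∈ C ↔ x ∈ D.L ∧ D.Meets f x ∧ D.op.Meets g (flip x) := by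
  refine forall_congr' fun x => ?_
  rw [and_congr_right fun hx => and_congr (h.onH_iff hx) (h.onV_iff hx)]

end RoadMap.IsGivenBy

theorem corners_in_box {a b u : ℕ} {f : Fin u → ℤ → ℤ} (h : IsPathSystem a b u f) {p : Fin u}
    {t : ℤ} (ht : IsNWCorner (f p) t ∨ IsSECorner (f p) t) :
    1 ≤ f p t ∧ f p t ≤ a ∧ 1 ≤ f p t + t ∧ f p t + t ≤ b := by
  have h1 := h.le_row p t
  have h2 := h.row_le p t
  have h3 := p.2
  rcases ht with ht | ht
  · have h4 := h.left_lt (p := p) (t := t - 1) (by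
      have := ht.1
      rw [sub_add_cancel]
      omega)
    have := ht.1
    omega
  · have h4 := h.left_lt ht.2
    omega

theorem cornersMeet_iff {f : ∀ α, Fin (D.uT α) → ℤ → ℤ} {g : ∀ β, Fin (D.uS β) → ℤ → ℤ}
    (hf : D.IsPathMap f) : D.CornersMeet f g ↔ ∀ α (p : Fin (D.uT α)) P,
      IsPathCorner (systemList (D.aT α) (D.bT α) (D.uT α) p (f α p)) P →
        ∃ x ∈ D.L, D.tgt x.2.2 = α ∧ D.posT x = P ∧ D.op.Meets g (flip x) := by
  constructor
  · intro h α p P hP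
    obtain ⟨t, rfl, ht⟩ := (hf α).isPathCorner_systemList.1 hP
    obtain ⟨h1, h2, h3, h4⟩ := corners_in_box (hf α) (p := p) (t := t)
      (ht.imp And.left And.left)
    obtain ⟨x, hx, rfl, hxP⟩ := D.exists_mem_L (P := (f α p t, f α p t + t)) h1 h2 h3 h4
    refine ⟨x, hx, rfl, hxP, h x hx p ?_ ?_⟩
    · rw [hxP]; simp [OnPath]
    · rw [hxP]
      simp only [add_sub_cancel_left]
      exact ht
  · intro h x hx p hp hcorner
    obtain ⟨y, hy, h1, h2, h3⟩ := h (D.tgt x.2.2) p (D.posT x) ((hf _).isPathCorner_systemList.2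
      ⟨(D.posT x).2 - (D.posT x).1, by rw [show f (D.tgt x.2.2) p ((D.posT x).2 - (D.posT x).1) = (D.posT x).1 from hp]; ext <;> simp, by
        rw [show f (D.tgt x.2.2) p ((D.posT x).2 - (D.posT x).1) = (D.posT x).1 from hp,
          add_sub_cancel]
        exact hcorner⟩)
    rwa [← D.posT_inj hy hx h1 h2]

theorem RoadMap.IsGivenBy.isStraight_iff {R : D.RoadMap} {f : ∀ α, Fin (D.uT α) → ℤ → ℤ}
    {g : ∀ β, Fin (D.uS β) → ℤ → ℤ} (h : R.IsGivenBy f g) :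
    R.IsStraight ↔ D.CornersMeet f g ∧ D.op.CornersMeet g f := by
  unfold RoadMap.IsStraight
  refine (and_congr ?_ ?_).trans (and_congr (cornersMeet_iff h.isPathMap_H).symm
    (cornersMeet_iff (D := D.op) h.isPathMap_V).symm)
  · simp only [← h.H_eq]
    refine forall₄_congr fun α p P _ => exists_congr fun x => and_congr_right fun hx => ?_
    rw [h.onV_iff hx]
  · have hV : ∀ β (q : Fin (D.uS β)) P,
        IsPathCorner (systemList (D.bS β) (D.aS β) (D.uS β) q (g β q)) P ↔
          IsPathCorner (R.V β q) P.swap := by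
      intro β q P
      rw [← h.V_eq]
      constructor <;> intro hP
      · simpa [swap_swap_list] using hP.swap
      · simpa using hP.swap
    constructor
    · intro H β q P hP
      obtain ⟨x, hx, h1, h2, h3⟩ := H β q P.swap ((hV β q P).1 hP)
      refine ⟨flip x, D.flip_mem_L.2 hx, h1, ?_, (h.onH_iff hx).1 h3⟩
      rw [op_posT_flip, h2, Prod.swap_swap]
    · intro H β q P hP
      obtain ⟨x, hx, h1, h2, h3⟩ := H β q P.swap ((hV β q P.swap).2 hP)
      have hx' : flip x ∈ D.L := D.flip_mem_L.1 (show flip (flip x) ∈ D.op.L from hx)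
      refine ⟨flip x, hx', h1, ?_, (h.onH_iff hx').2 h3⟩
      have h4 : D.op.posT x = (D.posS (flip x)).swap := rfl
      rw [h4] at h2
      exact Prod.swap_injective h2

end BipartiteDatum

/-! ### Straight road maps: the bounds on and off the paths, and the two corner conditions. -/

namespace BipartiteDatum

variable {S T : Type*} {n : ℕ} {D : BipartiteDatum S T n}
  {f : ∀ α, Fin (D.uT α) → ℤ → ℤ} {g : ∀ β, Fin (D.uS β) → ℤ → ℤ} {C : Finset (ℤ × ℤ × Fin n)}

variable (D) in
/-- `C` consists of the points of `L` on the paths `f` and on the (transposed) paths `g`. -/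
def IsInducedBy (f : ∀ α, Fin (D.uT α) → ℤ → ℤ) (g : ∀ β, Fin (D.uS β) → ℤ → ℤ)
    (C : Finset (ℤ × ℤ × Fin n)) : Prop :=
  ∀ x, x ∈ C ↔ x ∈ D.L ∧ D.Meets f x ∧ D.op.Meets g (flip x)

theorem IsInducedBy.op (h : D.IsInducedBy f g C) : D.op.IsInducedBy g f (flipSet C) := by
  intro x
  rw [mem_flipSet, h, ← D.flip_mem_L, and_comm (a := D.Meets f (flip x))]
  rfl

theorem CornersMeet.containsCorners (h : D.CornersMeet f g) (hf : D.IsPathMap f)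
    (hI : D.IsInducedBy f g C) (α : T) :
    ContainsCorners (D.bT α) (D.uT α) (f α) (D.partT C α) := by
  have key : ∀ (p : Fin (D.uT α)) t,
      (IsNWCorner (f α p) t ∧ f α p t + t + 1 ≤ D.bT α ∨ IsSECorner (f α p) t ∧ 2 ≤ f α p t + t) →
      (f α p t, f α p t + t) ∈ D.partT C α := by
    intro p t ht
    obtain ⟨x, hx, h1, h2, h3⟩ := (cornersMeet_iff hf).1 h α p _
      ((hf α).isPathCorner_systemList.2 ⟨t, rfl, ht⟩)
    subst h1
    refine D.mem_partT.2 ⟨x, (hI x).2 ⟨hx, ⟨p, ?_⟩, h3⟩, rfl, h2⟩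
    rw [h2]
    simp [OnPath]
  refine ⟨fun P hP => ?_, fun p t h1 h2 => key p t (Or.inl ⟨h1, h2⟩),
    fun p t h1 h2 => key p t (Or.inr ⟨h1, h2⟩)⟩
  obtain ⟨x, hx, rfl, rfl⟩ := D.mem_partT.1 hP
  exact ((hI x).1 hx).2.1

theorem CornersMeet.bar_of_onPath (h : D.CornersMeet f g) (hf : D.IsPathMap f)
    (hI : D.IsInducedBy f g C) {x : ℤ × ℤ × Fin n} (hx : x ∈ D.L) {p : Fin (D.uT (D.tgt x.2.2))}
    (hp : OnPath (f (D.tgt x.2.2) p) (D.posT x)) :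
    D.rbarT C x = p.val ∧ D.sbarT C x = D.uT (D.tgt x.2.2) - 1 - p.val := by
  obtain ⟨h1, h2, h3, h4⟩ := D.posT_bounds hx
  exact (hf _).rho_sigma_of_onPath (h.containsCorners hf hI _) h1 h2 h3 h4 hp

theorem CornersMeet.bar_of_not_meets (h : D.CornersMeet f g) (hf : D.IsPathMap f)
    (hI : D.IsInducedBy f g C) {x : ℤ × ℤ × Fin n} (hx : x ∈ D.L) (hp : ¬ D.Meets f x) :
    D.rbarT C x + D.sbarT C x = D.uT (D.tgt x.2.2) ∧
      D.uT (D.tgt x.2.2) ≤ D.rT C x + D.sT C x := by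
  obtain ⟨h1, h2, h3, h4⟩ := D.posT_bounds hx
  exact (hf _).rho_sigma_of_not_onPath (h.containsCorners hf hI _) h1 h2 h3 h4
    (not_exists.1 hp)

theorem rT_le_rbarT (C : Finset (ℤ × ℤ × Fin n)) (x : ℤ × ℤ × Fin n) :
    (D.rT C x : ℤ) ≤ D.rbarT C x := le_max_left _ _

theorem sT_le_sbarT (C : Finset (ℤ × ℤ × Fin n)) (x : ℤ × ℤ × Fin n) :
    (D.sT C x : ℤ) ≤ D.sbarT C x := le_max_left _ _

theorem CornersMeet.onPath_iff (h : D.CornersMeet f g) (hf : D.IsPathMap f)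
    (hI : D.IsInducedBy f g C) {x : ℤ × ℤ × Fin n} (hx : x ∈ D.L) (p : Fin (D.uT (D.tgt x.2.2))) :
    OnPath (f (D.tgt x.2.2) p) (D.posT x) ↔
      D.rbarT C x = p.val ∧ D.sbarT C x = D.uT (D.tgt x.2.2) - 1 - p.val := by
  refine ⟨h.bar_of_onPath hf hI hx, fun hp => ?_⟩
  by_cases hm : D.Meets f x
  · obtain ⟨p', hp'⟩ := hm
    have := h.bar_of_onPath hf hI hx hp'
    rwa [← show p' = p from Fin.ext (by omega)]
  · have := h.bar_of_not_meets hf hI hx hm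
    omega

theorem CornersMeet.meets_iff (h : D.CornersMeet f g) (hf : D.IsPathMap f)
    (hI : D.IsInducedBy f g C) {x : ℤ × ℤ × Fin n} (hx : x ∈ D.L) :
    (D.Meets f x ↔ D.rbarT C x + D.sbarT C x = D.uT (D.tgt x.2.2) - 1) ∧
    (D.Meets f x ↔ D.rT C x + D.sT C x < D.uT (D.tgt x.2.2)) ∧
    (D.rbarT C x + D.sbarT C x = D.uT (D.tgt x.2.2) - 1 ∨
      D.rbarT C x + D.sbarT C x = D.uT (D.tgt x.2.2)) := by
  have h1 := rT_le_rbarT (D := D) C x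
  have h2 := sT_le_sbarT (D := D) C x
  by_cases hm : D.Meets f x
  · obtain ⟨p, hp⟩ := hm
    have h3 := h.bar_of_onPath hf hI hx hp
    refine ⟨iff_of_true ⟨p, hp⟩ (by omega), iff_of_true ⟨p, hp⟩ (by omega), Or.inl (by omega)⟩
  · have h3 := h.bar_of_not_meets hf hI hx hm
    refine ⟨iff_of_false hm (by omega), iff_of_false hm (by omega), Or.inr h3.1⟩

/-- A vertical edge starts at each south-east corner, and `PageSystem.vertical` places this edge on
a transverse path. -/
theorem NWCornersMeet.cornersMeet (hfg : D.NWCornersMeet f g) (hgf : D.op.NWCornersMeet g f)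
    (hf : D.IsPathMap f) (hg : D.op.IsPathMap g) : D.CornersMeet f g := by
  rintro x hx p hp (⟨h1, -⟩ | ⟨h1, -⟩)
  · exact hfg x hx p hp h1
  · have hp' := onPath_posT_iff.1 hp
    have hx' := D.mem_L_iff.1 hx
    obtain ⟨q, hq, -⟩ := (pageSystem hf hg hfg hgf x.2.2).vertical (p := p) (t := x.2.1 - x.1) (by
      have h2 := h1.2
      rw [posT_eq] at h2
      simp only at h2
      rw [show D.offT x.2.2 + x.2.1 - x.1 = x.2.1 - x.1 + D.offT x.2.2 by ring] at h2
      unfold pageF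
      rw [show x.2.1 - x.1 + 1 + D.offT x.2.2 = x.2.1 - x.1 + D.offT x.2.2 + 1 by ring]
      exact h2) (by rw [hp']; omega) (by rw [hp']; omega)
    rw [hp'] at hq
    exact ⟨q, onPath_op_posT_iff.2 hq⟩

/-- The only additional corner is the one formed in the last column with the right ray. It suffices
to find a transverse path that has reached this column on an earlier or equal diagonal: its column
never decreases, so it passes through the corner. -/
theorem CornersMeet.nwCornersMeet (h : D.CornersMeet f g) (hf : D.IsPathMap f)
    (hg : D.op.IsPathMap g) (hu : ∀ β, 0 < D.uS β) : D.NWCornersMeet f g := by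
  intro x hx p hp hcorner
  obtain ⟨h1, h2, h3, h4⟩ := D.posT_bounds hx
  by_cases hb : (D.posT x).2 + 1 ≤ D.bT (D.tgt x.2.2)
  · exact h x hx p hp (Or.inl ⟨hcorner, hb⟩)
  have hx' := D.mem_L_iff.1 hx
  have hle := D.offT_add_le_bT x.2.2
  have hcol : (D.posT x).2 = D.offT x.2.2 + x.2.1 := rfl
  have hrow : (D.posT x).1 = x.1 := rfl
  obtain ⟨q, hq⟩ : ∃ q : Fin (D.uS (D.src x.2.2)), ∃ s ≤ x.2.1 - x.1,
      D.pageG g x.2.2 q s + s = x.2.1 := by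
    -- In a matrix with a single column any transverse path will do; this uses `0 < uS`.
    rcases le_or_gt (D.bT (D.tgt x.2.2)) 1 with hb1 | hb1
    · have hoff := D.offT_nonneg x.2.2
      refine ⟨⟨0, hu _⟩, x.2.1 - x.1, le_rfl, ?_⟩
      have := pageG_col hg x.2.2 ⟨0, hu _⟩ (x.2.1 - x.1)
      omega
    have hPf := (hf (D.tgt x.2.2)).step p
    set φ := f (D.tgt x.2.2) p with hφ
    set t := (D.posT x).2 - (D.posT x).1 with ht
    have hpt : φ t = x.1 := hp
    have hst := (hf (D.tgt x.2.2)).start_add p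
    have ht0 := ((hf (D.tgt x.2.2)).start_le_iff p t).2 (by rw [← hφ, hpt]; omega)
    -- The path enters the last column by a horizontal step and then climbs, so its first point
    -- there is a genuine south-east corner, lying on a transverse path by hypothesis.
    obtain ⟨s, hs1, hs2, hs3, hs4⟩ := Int.exists_first
      (P := fun r => φ r + r = D.bT (D.tgt x.2.2)) ht0 (by rw [hpt]; omega)
    have hs0 : 1 - ((D.aT (D.tgt x.2.2) : ℤ) - D.uT (D.tgt x.2.2) + (p.val + 1)) < s := by
      rcases eq_or_lt_of_le hs1 with h' | h'
      · rw [← h', hφ, hst] at hs3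
        omega
      · exact h'
    have hst' : s < t := by
      rcases eq_or_lt_of_le hs2 with h' | h'
      · have h5 := hs4 (t - 1) (by omega) (by omega)
        have h6 := hcorner.1
        omega
      · exact h'
    have h5 := hPf.mono_add (show s - 1 ≤ t by omega)
    have h6 := hs4 (s - 1) (by omega) (by omega)
    have h7 := hPf.pred s
    have h8 := hPf.mono_add (show s ≤ s + 1 by omega)
    have h9 := hPf.mono_add (show s + 1 ≤ t by omega)
    have h10 := (hf (D.tgt x.2.2)).le_row p s
    have h11 := (hf (D.tgt x.2.2)).row_le p s
    have h12 := hPf.anti hs2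
    have h13 := p.2
    have hy : (φ s, x.2.1, x.2.2) ∈ D.L := by
      refine ⟨by simp only; omega, ?_, hx'.2.2⟩
      change φ s ≤ D.mT (D.tgt x.2.2)
      rw [← hφ] at h11
      unfold aT at h11
      omega
    have hdiag : (D.posT (φ s, x.2.1, x.2.2)).2 - (D.posT (φ s, x.2.1, x.2.2)).1 = s := by
      rw [posT_eq]
      simp only
      omega
    obtain ⟨q, hq⟩ := h _ hy p (by unfold OnPath; rw [hdiag]; rfl) (Or.inr ⟨by
      rw [hdiag]
      exact ⟨show φ (s - 1) = φ s by omega, show φ (s + 1) = φ s - 1 by omega⟩, by rw [posT_eq]; simp only; omega⟩)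
    refine ⟨q, x.2.1 - φ s, by omega, ?_⟩
    have := onPath_op_posT_iff.1 hq
    simp only at this
    rw [this]
    omega
  obtain ⟨s, hs, hs'⟩ := hq
  have h5 := pageG_col hg x.2.2 q (x.2.1 - x.1)
  have h6 := (isPathFun_pageG hg x.2.2 q).mono_add hs
  exact ⟨q, onPath_op_posT_iff.2 (by omega)⟩

end BipartiteDatum

/-! ### Counting the points of a concurrent vertex map. -/

/-- The diagonals on which two paths crossing a page meet. -/
def meetSet (r c : ℕ) (φ ψ : ℤ → ℤ) : Finset ℤ := (Icc (-(r : ℤ)) c).filter fun t => ψ t = φ t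

/-- The common vertical edges of two paths crossing a page. -/
def verticalSet (r c : ℕ) (φ ψ : ℤ → ℤ) : Finset ℤ :=
  (meetSet r c φ ψ).filter fun t => φ (t + 1) = φ t - 1 ∧ ψ (t + 1) = ψ t - 1

/-- The common horizontal edges of two paths crossing a page. -/
def horizontalSet (r c : ℕ) (φ ψ : ℤ → ℤ) : Finset ℤ :=
  (meetSet r c φ ψ).filter fun t => φ (t + 1) = φ t ∧ ψ (t + 1) = ψ t

namespace PageSystem

variable {r c u v : ℕ} {F : Fin u → ℤ → ℤ} {G : Fin v → ℤ → ℤ}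

theorem mem_meetSet (h : PageSystem r c u v F G) {p : Fin u} {q : Fin v} {t : ℤ} :
    t ∈ meetSet r c (F p) (G q) ↔ G q t = F p t := by
  unfold meetSet
  rw [mem_filter, mem_Icc, and_iff_right_iff_imp]
  intro ht
  have := h.row_F p t
  have := h.col_G q t
  omega

/-- The common diagonals form an interval, and each step between consecutive ones is a common edge,
vertical or horizontal. -/
theorem card_meetSet (h : PageSystem r c u v F G) (p : Fin u) (q : Fin v) :
    (meetSet r c (F p) (G q)).card =
      1 + (verticalSet r c (F p) (G q)).card + (horizontalSet r c (F p) (G q)).card := by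
  obtain ⟨m, M, hmM, hmem⟩ := h.exists_Icc p q
  have h1 : meetSet r c (F p) (G q) = Icc m M := by
    ext t
    rw [h.mem_meetSet, hmem, mem_Icc]
  have h2 : Disjoint (verticalSet r c (F p) (G q)) (horizontalSet r c (F p) (G q)) := by
    refine disjoint_left.2 fun t ht ht' => ?_
    have := (mem_filter.1 ht).2
    have := (mem_filter.1 ht').2
    omega
  have h3 : verticalSet r c (F p) (G q) ∪ horizontalSet r c (F p) (G q) = Icc m (M - 1) := by
    unfold verticalSet horizontalSet
    rw [← filter_or, h1]
    ext t
    have h4 := hmem t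
    have h5 := hmem (t + 1)
    have h6 := h.isPathFun_F p t
    have h7 := h.isPathFun_G q t
    simp only [mem_filter, mem_Icc]
    omega
  rw [add_assoc, ← card_union_of_disjoint h2, h3, h1, Int.card_Icc, Int.card_Icc]
  omega

end PageSystem

theorem IsPathFun.card_descents {f : ℤ → ℤ} (hf : IsPathFun f) {lo hi : ℤ} (h : lo ≤ hi) :
    (((Ico lo hi).filter fun t => f (t + 1) = f t - 1).card : ℤ) = f lo - f hi := by
  induction hi, h using Int.leInduction with
  | base => simp
  | succ hi h ih =>
    have h1 : Ico lo (hi + 1) = insert hi (Ico lo hi) := by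
      ext t
      simp only [mem_Ico, mem_insert]
      omega
    rw [h1, filter_insert]
    split_ifs with h2
    · rw [card_insert_of_notMem (by simp)]
      push_cast
      omega
    · have := hf hi
      omega

namespace BipartiteDatum

variable {S T : Type*} {n : ℕ} {D : BipartiteDatum S T n}
  {f : ∀ α, Fin (D.uT α) → ℤ → ℤ} {g : ∀ β, Fin (D.uS β) → ℤ → ℤ} {C : Finset (ℤ × ℤ × Fin n)}

theorem card_eq_sum_meetSet (hf : D.IsPathMap f) (hg : D.op.IsPathMap g)
    (hfg : D.NWCornersMeet f g) (hgf : D.op.NWCornersMeet g f) (hI : D.IsInducedBy f g C) :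
    C.card = ∑ k : Fin n, ∑ pq : Fin (D.uT (D.tgt k)) × Fin (D.uS (D.src k)),
      (meetSet (D.mT (D.tgt k)) (D.mS (D.src k)) (D.pageF f k pq.1) (D.pageG g k pq.2)).card := by
  have hP := pageSystem hf hg hfg hgf
  simp only [← card_sigma]
  symm
  refine card_bij (fun y _ => (D.pageF f y.1 y.2.1.1 y.2.2,
    D.pageF f y.1 y.2.1.1 y.2.2 + y.2.2, y.1)) ?_ ?_ ?_
  · rintro ⟨k, ⟨p, q⟩, t⟩ hy
    simp only [mem_sigma, mem_univ, true_and] at hy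
    rw [(hP k).mem_meetSet] at hy
    have h1 := (hP k).row_F p t
    have h2 := (hP k).col_G q t
    rw [hy] at h2
    refine (hI _).2 ⟨⟨h1.1, h1.2, h2⟩, ⟨p, onPath_posT_iff.2 (by simp)⟩,
      ⟨q, onPath_op_posT_iff.2 (by simpa using hy)⟩⟩
  · rintro ⟨k, ⟨p, q⟩, t⟩ hy ⟨k', ⟨p', q'⟩, t'⟩ hy' e
    simp only [mem_sigma, mem_univ, true_and] at hy hy'
    rw [(hP _).mem_meetSet] at hy hy'
    simp only [Prod.mk.injEq] at e
    obtain ⟨e1, e2, rfl⟩ := e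
    obtain rfl : t = t' := by omega
    have hp : p = p' := by
      rcases lt_trichotomy p p' with h | h | h
      · have := (hP k).lt_F _ _ t h; omega
      · exact h
      · have := (hP k).lt_F _ _ t h; omega
    have hq : q = q' := by
      rcases lt_trichotomy q q' with h | h | h
      · have := (hP k).lt_G _ _ t h; omega
      · exact h
      · have := (hP k).lt_G _ _ t h; omega
    subst hp hq
    rfl
  · rintro ⟨i, j, k⟩ hx
    obtain ⟨hL, ⟨p, hp⟩, ⟨q, hq⟩⟩ := (hI _).1 hx
    have hp := onPath_posT_iff.1 hp
    have hq := onPath_op_posT_iff.1 hq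
    simp only at hp hq
    refine ⟨⟨k, ⟨p, q⟩, j - i⟩, ?_, ?_⟩
    · simp only [mem_sigma, mem_univ, true_and]
      exact (hP k).mem_meetSet.2 (hq.trans hp.symm)
    · simp only [hp, Prod.mk.injEq, true_and, and_true]
      omega

/-- Each vertical edge of a horizontal path lies on exactly one page and on exactly one vertical
path, by `PageSystem.vertical` and disjointness. A path at `α` descends from row `a - u + p + 1` to
row `p + 1` in the index, hence has `a - u` such edges. -/
theorem sum_card_verticalSet [Fintype T] (hf : D.IsPathMap f) (hg : D.op.IsPathMap g)
    (hfg : D.NWCornersMeet f g) (hgf : D.op.NWCornersMeet g f) :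
    ∑ k : Fin n, ∑ pq : Fin (D.uT (D.tgt k)) × Fin (D.uS (D.src k)),
      ((verticalSet (D.mT (D.tgt k)) (D.mS (D.src k)) (D.pageF f k pq.1)
        (D.pageG g k pq.2)).card : ℤ) = ∑ α : T, (D.uT α : ℤ) * ((D.aT α : ℤ) - D.uT α) := by
  have hP := pageSystem hf hg hfg hgf
  have h1 : ∀ α : T, (D.uT α : ℤ) * ((D.aT α : ℤ) - D.uT α) = ∑ p : Fin (D.uT α),
      (((Ico (-(D.aT α : ℤ)) (D.bT α)).filter fun t => f α p (t + 1) = f α p t - 1).card : ℤ) := by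
    intro α
    have h2 : ∀ p : Fin (D.uT α),
        (((Ico (-(D.aT α : ℤ)) (D.bT α)).filter fun t => f α p (t + 1) = f α p t - 1).card : ℤ) =
          (D.aT α : ℤ) - D.uT α := by
      intro p
      rw [((hf α).step p).card_descents (by omega), (hf α).left p _ (by have := p.2; omega),
        (hf α).right p _ (by omega)]
      ring
    rw [sum_congr rfl fun p _ => h2 p]
    simp only [sum_const, card_univ, Fintype.card_fin, nsmul_eq_mul]
  simp only [h1, ← Nat.cast_sum, ← card_sigma]
  congr 1
  refine card_bij (fun y _ => ⟨D.tgt y.1, y.2.1.1, y.2.2 + D.offT y.1⟩) ?_ ?_ ?_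
  · rintro ⟨k, ⟨p, q⟩, t⟩ hy
    simp only [mem_sigma, mem_univ, true_and, verticalSet, mem_filter, (hP _).mem_meetSet,
      mem_Ico] at hy ⊢
    have h2 := hy.2.1
    unfold pageF at h2
    rw [show t + 1 + D.offT k = t + D.offT k + 1 by ring] at h2
    refine ⟨?_, h2⟩
    have h3 := (hf (D.tgt k)).left_lt h2
    have h4 := (hf (D.tgt k)).le_row p (t + D.offT k)
    have h5 := (hf (D.tgt k)).row_le p (t + D.offT k)
    have := p.2
    omega
  · rintro ⟨k, ⟨p, q⟩, t⟩ hy ⟨k', ⟨p', q'⟩, t'⟩ hy' e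
    simp only [mem_sigma, mem_univ, true_and, verticalSet, mem_filter, (hP _).mem_meetSet] at hy hy'
    have e1 := congrArg (fun z : (Σ α : T, (_ : Fin (D.uT α)) × ℤ) => z.1) e
    have e2 := congrArg (fun z : (Σ α : T, (_ : Fin (D.uT α)) × ℤ) =>
      f z.1 z.2.1 z.2.2 + z.2.2) e
    simp only at e1 e2
    have h2 := (hP k).col_G q t
    have h3 := (hP k').col_G q' t'
    rw [hy.1] at h2
    rw [hy'.1] at h3
    unfold pageF at h2 h3
    have hk : k = k' := D.page_eq e1 (j := f (D.tgt k) p (t + D.offT k) + (t + D.offT k))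
      (by omega) (by omega) (by omega) (by omega)
    subst hk
    simp only [Sigma.mk.injEq, heq_eq_eq, true_and, add_left_inj] at e
    obtain ⟨rfl, rfl⟩ := e
    have hq : q = q' := by
      rcases lt_trichotomy q q' with h | h | h
      · have := (hP k).lt_G _ _ t h; omega
      · exact h
      · have := (hP k).lt_G _ _ t h; omega
    rw [hq]
  · rintro ⟨α, p, t⟩ hy
    simp only [mem_sigma, mem_univ, true_and, mem_filter] at hy
    have h2 := (hf α).left_lt hy.2
    have h3 := (hf α).le_row p t
    have h4 := (hf α).row_le p t
    have := p.2
    obtain ⟨x, hx, rfl, hx'⟩ := D.exists_mem_L (α := α) (P := (f α p t, f α p t + t))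
      (by simp only; omega) (by simp only; omega) h2.1 h2.2
    rw [posT_eq, Prod.mk.injEq] at hx'
    have hL := D.mem_L_iff.1 hx
    have h5 : t - D.offT x.2.2 + D.offT x.2.2 = t := by ring
    have h6 : t - D.offT x.2.2 + 1 + D.offT x.2.2 = t + 1 := by ring
    obtain ⟨q, hq1, hq2⟩ := (hP x.2.2).vertical (p := p) (t := t - D.offT x.2.2)
      (by unfold pageF; rw [h5, h6]; exact hy.2) (by unfold pageF; rw [h5]; omega)
      (by unfold pageF; rw [h5]; omega)
    refine ⟨⟨x.2.2, ⟨p, q⟩, t - D.offT x.2.2⟩, ?_, ?_⟩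
    · simp only [mem_sigma, mem_univ, true_and, verticalSet, mem_filter, (hP _).mem_meetSet]
      refine ⟨hq1, ?_, ?_⟩
      · unfold pageF; rw [h5, h6]; exact hy.2
      · rw [hq1, hq2]
        unfold pageF; rw [h5, h6]; exact hy.2
    · simp only [h5]

theorem card_horizontalSet (k : Fin n) (p : Fin (D.uT (D.tgt k))) (q : Fin (D.uS (D.src k)))
    (hP : PageSystem (D.mT (D.tgt k)) (D.mS (D.src k)) (D.uT (D.tgt k)) (D.uS (D.src k))
      (D.pageF f k) (D.pageG g k))
    (hP' : PageSystem (D.mS (D.src k)) (D.mT (D.tgt k)) (D.uS (D.src k)) (D.uT (D.tgt k))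
      (D.op.pageF g k) (D.op.pageG f k)) :
    (horizontalSet (D.mT (D.tgt k)) (D.mS (D.src k)) (D.pageF f k p) (D.pageG g k q)).card =
      (verticalSet (D.mS (D.src k)) (D.mT (D.tgt k)) (D.op.pageF g k q)
        (D.op.pageG f k p)).card := by
  have hF : ∀ t, D.op.pageF g k q (-t) = D.pageG g k q t + t := by
    intro t
    unfold pageF pageG
    rw [neg_add_eq_sub, sub_add_cancel]
    rfl
  have hG : ∀ t, D.op.pageG f k p (-t) = D.pageF f k p t + t := by
    intro t
    unfold pageF pageG
    rw [show D.op.op.offT k - -t = t + D.offT k by rw [sub_neg_eq_add, add_comm]; rfl,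
      sub_neg_eq_add]
    rfl
  -- Transposition negates diagonals, so the edge from `t` to `t + 1` becomes the edge from `-(t +
  -- 1)` to `-t`.
  refine card_nbij' (fun t => -(t + 1)) (fun t => -(t + 1)) ?_ ?_ ?_ ?_
  · intro t ht
    simp only [horizontalSet, coe_filter, hP.mem_meetSet, Set.mem_ofPred_eq] at ht
    simp only [verticalSet, coe_filter, hP'.mem_meetSet, Set.mem_ofPred_eq]
    rw [show -(t + 1) + 1 = -t by ring]
    simp only [hF, hG]
    omega
  · intro t ht
    simp only [verticalSet, coe_filter, hP'.mem_meetSet, Set.mem_ofPred_eq] at ht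
    simp only [horizontalSet, coe_filter, hP.mem_meetSet, Set.mem_ofPred_eq]
    have h1 := hF (-t)
    have h2 := hG (-t)
    have h3 := hF (-(t + 1))
    have h4 := hG (-(t + 1))
    rw [neg_neg] at h1 h2 h3 h4
    rw [show -(t + 1) + 1 = -t by ring]
    omega
  · intro t _; simp
  · intro t _; simp

/-- The `1` in `card_meetSet`, summed over all pairs of paths on all pages, gives the first sum in
`N`; the vertical and horizontal edges give the other two. -/
theorem card_eq_N [Fintype S] [Fintype T] (hf : D.IsPathMap f) (hg : D.op.IsPathMap g)
    (hfg : D.NWCornersMeet f g) (hgf : D.op.NWCornersMeet g f) (hI : D.IsInducedBy f g C) :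
    (C.card : ℤ) = D.N := by
  have hP := pageSystem hf hg hfg hgf
  have hP' := pageSystem hg hf hgf hfg
  have h1 := sum_card_verticalSet hf hg hfg hgf
  have h2 := sum_card_verticalSet hg hf hgf hfg
  have h3 : ∑ k : Fin n, ∑ pq : Fin (D.uT (D.tgt k)) × Fin (D.uS (D.src k)),
      ((horizontalSet (D.mT (D.tgt k)) (D.mS (D.src k)) (D.pageF f k pq.1)
        (D.pageG g k pq.2)).card : ℤ) = ∑ β : S, (D.uS β : ℤ) * ((D.bS β : ℤ) - D.uS β) := by
    refine Eq.trans (sum_congr rfl fun k _ => ?_) h2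
    refine Fintype.sum_equiv (Equiv.prodComm _ _) _ _ fun pq => ?_
    rw [card_horizontalSet k pq.1 pq.2 (hP k) (hP' k)]
    rfl
  have h4 := card_eq_sum_meetSet hf hg hfg hgf hI
  simp only [(hP _).card_meetSet] at h4
  rw [h4]
  push_cast
  simp only [sum_add_distrib]
  rw [h1, h3]
  simp only [N, sum_const, card_univ, Fintype.card_prod, Fintype.card_fin, nsmul_eq_mul, mul_one]
  congr 2
  refine sum_congr rfl fun k _ => ?_
  push_cast
  ring

end BipartiteDatum

/-! ### From a saturated set to its straight road map. -/

namespace BipartiteDatum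

variable {S T : Type*} {n : ℕ} {D : BipartiteDatum S T n}
  {f : ∀ α, Fin (D.uT α) → ℤ → ℤ} {g : ∀ β, Fin (D.uS β) → ℤ → ℤ} {C : Finset (ℤ × ℤ × Fin n)}

variable (D) in
/-- A compatible set that contains all points satisfying the bounds which points of a compatible set
satisfy. -/
structure IsSaturated (C : Finset (ℤ × ℤ × Fin n)) : Prop where
  subset_L : (C : Set (ℤ × ℤ × Fin n)) ⊆ D.L
  compatible_T : ∀ α, maxChainSize (D.partT C α) ≤ D.uT α
  compatible_S : ∀ β, maxChainSize (D.op.partT (flipSet C) β) ≤ D.uS β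
  mem : ∀ x ∈ D.L, D.rbarT C x + D.sbarT C x ≤ D.uT (D.tgt x.2.2) - 1 →
    D.op.rbarT (flipSet C) (flip x) + D.op.sbarT (flipSet C) (flip x) ≤ D.uS (D.src x.2.2) - 1 →
    x ∈ C

theorem IsSaturated.op (h : D.IsSaturated C) : D.op.IsSaturated (flipSet C) where
  subset_L := D.flipSet_subset_L h.subset_L
  compatible_T := h.compatible_S
  compatible_S α := by
    rw [flipSet_flipSet]
    exact h.compatible_T α
  mem x hx h1 h2 := by
    rw [flipSet_flipSet] at h2
    exact mem_flipSet.2 (h.mem (flip x) (D.flip_mem_L.1 (show flip (flip x) ∈ D.op.L from hx))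
      h2 h1)

variable (D) in
/-- The paths `f` are the level paths of `C` at the targets. -/
def IsLevelMap (C : Finset (ℤ × ℤ × Fin n)) (f : ∀ α, Fin (D.uT α) → ℤ → ℤ) : Prop :=
  ∀ α, IsLevelSystem (D.aT α) (D.bT α) (D.uT α) (D.partT C α) (f α)

theorem IsSaturated.exists_isLevelMap (h : D.IsSaturated C) (hD : D.Admissible) :
    ∃ f, D.IsLevelMap C f := by
  have := fun α => (D.partT_inBox h.subset_L α).exists_isLevelSystem
    (le_min_iff.1 (hD.1 α).2.1).1
  choose f hf using this
  exact ⟨f, hf⟩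

theorem IsLevelMap.isPathMap (hf : D.IsLevelMap C f) (h : D.IsSaturated C) (hD : D.Admissible) :
    D.IsPathMap f := fun α => (hf α).isPathSystem (D.partT_inBox h.subset_L α)
      (le_min_iff.1 (hD.1 α).2.1).1 (le_min_iff.1 (hD.1 α).2.1).2

theorem IsLevelMap.meets (hf : D.IsLevelMap C f) (h : D.IsSaturated C) {x : ℤ × ℤ × Fin n}
    (hx : x ∈ C) : D.Meets f x :=
  (hf _).exists_onPath (D.partT_inBox h.subset_L _) (h.compatible_T _)
    ((D.posT_mem_partT h.subset_L (h.subset_L hx)).2 hx)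

theorem IsLevelMap.bar_le (hf : D.IsLevelMap C f) (h : D.IsSaturated C) (hD : D.Admissible)
    {x : ℤ × ℤ × Fin n} (hx : x ∈ D.L) (hm : D.Meets f x) :
    D.rbarT C x + D.sbarT C x ≤ D.uT (D.tgt x.2.2) - 1 := by
  obtain ⟨p, hp⟩ := hm
  exact (hf _).rho_add_sigma_le (D.partT_inBox h.subset_L _) (le_min_iff.1 (hD.1 _).2.1).2
    (h.compatible_T _) (D.posT_bounds hx) hp

theorem IsLevelMap.isInducedBy (hf : D.IsLevelMap C f) (hg : D.op.IsLevelMap (flipSet C) g)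
    (h : D.IsSaturated C) (hD : D.Admissible) : D.IsInducedBy f g C := by
  intro x
  constructor
  · exact fun hx => ⟨h.subset_L hx, hf.meets h hx, hg.meets h.op (flip_mem_flipSet.2 hx)⟩
  · rintro ⟨hx, h1, h2⟩
    exact h.mem x hx (hf.bar_le h hD hx h1)
      (hg.bar_le h.op hD.op (D.flip_mem_L.2 hx) h2)

/-- Columns stay within the page, so the row takes arbitrarily large and small values along the
prolonged path. The chosen point is the one from which the path leaves row `i` upwards. -/
theorem exists_crossing (hg : D.op.IsPathMap g) (k : Fin n) (q : Fin (D.uS (D.src k))) (i : ℤ) :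
    ∃ t, D.pageG g k q t = i ∧ D.pageG g k q (t + 1) = i - 1 := by
  have h1 := pageG_col hg k q (1 - i)
  obtain ⟨t, h2, h3, h4, h5⟩ := Int.exists_last (P := fun t => i ≤ D.pageG g k q t)
    (lo := 1 - i) (hi := D.mS (D.src k) - i + 1) (by omega) (by omega)
  have h6 := pageG_col hg k q (D.mS (D.src k) - i + 1)
  have h7 : t < D.mS (D.src k) - i + 1 := by
    rcases eq_or_lt_of_le h3 with rfl | h'
    · omega
    · exact h'
  have h8 := h5 (t + 1) (by omega) (by omega)
  have h9 := isPathFun_pageG hg k q t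
  exact ⟨t, by omega, by omega⟩

theorem pageG_lt (hg : D.op.IsPathMap g) (k : Fin n) {q q' : Fin (D.uS (D.src k))} (h : q < q')
    (t : ℤ) : D.pageG g k q t < D.pageG g k q' t := by
  have := (hg (D.src k)).lt q q' (D.op.offT k - t) h
  unfold pageG
  omega

/-- The last crossings of consecutive rows with an increasing sequence of paths are strictly
increasing. -/
theorem crossing_lt (hg : D.op.IsPathMap g) {w w' : Σₗ k : Fin n, Fin (D.uS (D.src k))}
    (hw : w < w') (ht : D.tgt w.1 = D.tgt w'.1) {i t t' : ℤ} (h1 : D.pageG g w.1 w.2 t = i)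
    (h2 : D.pageG g w'.1 w'.2 t' = i + 1) (h3 : D.pageG g w'.1 w'.2 (t' + 1) = i) :
    D.offT w.1 + (i + t) < D.offT w'.1 + (i + 1 + t') := by
  obtain ⟨k, q⟩ := w
  obtain ⟨k', q'⟩ := w'
  simp only at ht h1 h2 h3 ⊢
  have h4 := pageG_col hg k q t
  have h5 := pageG_col hg k' q' t'
  rcases Sigma.Lex.lt_def.1 hw with hk | ⟨hk, hq⟩
  · have hk : k < k' := hk
    have := D.offT_add_le hk ht
    omega
  · simp only at hk
    subst hk
    have hq : q < q' := hq
    by_contra hcon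
    have h6 := (isPathFun_pageG hg k q').anti (show t' + 1 ≤ t by omega)
    have h7 := pageG_lt hg k hq t
    omega

/-- The map `e` lists all vertical paths on the pages at `α`, by page and then by index. Points of a
chain of `C` south-east of a point of path `m` lie on distinct later paths. -/
theorem IsLevelMap.chainSE_le (hg : D.op.IsLevelMap (flipSet C) g)
    (h : D.IsSaturated C) (hD : D.Admissible) {α : T} {v : ℕ}
    (e : Fin v ↪o Σₗ k : Fin n, Fin (D.uS (D.src k)))
    (he : ∀ w : Σₗ k : Fin n, Fin (D.uS (D.src k)), (∃ m, e m = w) ↔ D.tgt w.1 = α)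
    (m : Fin v) {i t : ℤ} (ht : D.pageG g (e m).1 (e m).2 t = i) :
    chainSE (D.partT C α) (i, D.offT (e m).1 + (i + t)) ≤ v - 1 - m := by
  have hgP := hg.isPathMap h.op hD.op
  obtain ⟨Y, hY, hYc, hYe⟩ := exists_chain_card_eq ((D.partT C α).filter
    fun R => i + 1 ≤ R.1 ∧ D.offT (e m).1 + (i + t) + 1 ≤ R.2)
  rw [chainSE, ← hYe, ← Fin.card_Ioi]
  have hm := (he (e m)).1 ⟨m, rfl⟩
  refine card_le_card_of_forall_subsingleton
    (fun R m' => ∃ j, R.2 = D.offT (e m').1 + j ∧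
      OnPath (D.pageG g (e m').1 (e m').2) (R.1, j)) (fun R hR => ?_) fun m' _ R hR R' hR' => ?_
  · obtain ⟨hRX, hR1, hR2⟩ := mem_filter.1 (hY hR)
    obtain ⟨⟨i', j', k'⟩, hx, hxα, rfl⟩ := D.mem_partT.1 hRX
    obtain ⟨q', hq'⟩ := hg.meets h.op (flip_mem_flipSet.2 hx)
    have hq' := onPath_op_posT_iff.1 hq'
    have hL := D.mem_L_iff.1 (h.subset_L hx)
    obtain ⟨m', hm'⟩ := (he ⟨k', q'⟩).2 hxα
    simp only [posT_eq] at hR1 hR2 hq' hL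
    refine ⟨m', mem_Ioi.2 (e.lt_iff_lt.1 ?_), ?_⟩
    · rw [hm']
      generalize e m = w at *
      obtain ⟨k, q⟩ := w
      simp only at hR2 ht hm
      have hcol := pageG_col hgP k q t
      refine Sigma.Lex.lt_def.2 ?_
      rcases lt_trichotomy k k' with hk | hk | hk
      · exact Or.inl hk
      · subst hk
        refine Or.inr ⟨rfl, ?_⟩
        have h1 := IsPathSystem.lt_of_onPath_of_lt (isPathFun_pageG hgP k q) (P := (i', j'))
          (Q := (i, i + t)) (by unfold OnPath; simpa using ht) (by simp only; omega)
          (by simp only; omega)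
        change q < q'
        by_contra hcon
        rcases eq_or_lt_of_le (not_lt.1 hcon) with rfl | hlt
        · exact absurd hq' h1.ne
        · have h2 := pageG_lt hgP k hlt (j' - i')
          simp only at h1
          have h3 : D.pageG g k q' (j' - i') = i' := hq'
          omega
      · have := D.offT_add_le hk (hxα.trans hm.symm)
        omega
    · rw [hm']
      exact ⟨j', rfl, hq'⟩
  · obtain ⟨hRY, j, hj, hon⟩ := hR
    obtain ⟨hRY', j', hj', hon'⟩ := hR'
    by_contra hne
    rcases hYc R hRY R' hRY' hne with h1 | h1
    · have := IsPathSystem.lt_of_onPath_of_lt (isPathFun_pageG hgP _ _) hon (P := (R'.1, j'))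
        h1.1 (by simp only; omega)
      exact absurd hon' this.ne
    · have := IsPathSystem.lt_of_onPath_of_lt (isPathFun_pageG hgP _ _) hon' (P := (R.1, j))
        h1.1 (by simp only; omega)
      exact absurd hon this.ne

/-- The set `C` contains a chain of length `u` in the first rows of the block matrix at `α`. -/
theorem IsLevelMap.exists_mem_row (hg : D.op.IsLevelMap (flipSet C) g)
    (h : D.IsSaturated C) (hD : D.Admissible) (α : T) :
    ∃ c : Fin (D.uT α) → ℤ, ∀ p, ((p.val : ℤ) + 1, c p) ∈ D.partT C α ∧
      c p ≤ (D.bT α : ℤ) - D.uT α + (p.val + 1) ∧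
      p.val ≤ chainNW (D.partT C α) ((p.val : ℤ) + 1, c p) := by
  classical
  have hgP := hg.isPathMap h.op hD.op
  obtain ⟨hu0, hu, huv⟩ := hD.1 α
  let I : Finset (Σₗ k : Fin n, Fin (D.uS (D.src k))) :=
    ((univ.filter fun k => D.tgt k = α).sigma fun _ => univ).map toLex.toEmbedding
  have hI : I.card = D.vT α := by
    rw [card_map, card_sigma, vT]
    refine sum_congr (by ext; simp) fun k _ => ?_
    simp
  have hImem : ∀ w, w ∈ I ↔ D.tgt w.1 = α := by
    intro w
    simp only [I, mem_map_equiv, mem_sigma, mem_filter, mem_univ, true_and, and_true]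
    rfl
  let e := I.orderEmbOfFin hI
  have he : ∀ w : Σₗ k : Fin n, Fin (D.uS (D.src k)), (∃ m, e m = w) ↔ D.tgt w.1 = α := by
    intro w
    rw [← hImem, ← mem_coe, ← range_orderEmbOfFin I hI]
    rfl
  -- The last `u` of the `v` vertical paths at `α`, available because `u ≤ v`; the `p`-th of them is
  -- taken where it leaves row `p + 1`.
  let ix : Fin (D.uT α) → Fin (D.vT α) := fun p => ⟨D.vT α - D.uT α + p.val, by omega⟩
  choose τ hτ1 hτ2 using fun p : Fin (D.uT α) =>
    exists_crossing hgP (e (ix p)).1 (e (ix p)).2 ((p.val : ℤ) + 1)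
  have htgt : ∀ p, D.tgt (e (ix p)).1 = α := fun p => (he _).1 ⟨_, rfl⟩
  let c : Fin (D.uT α) → ℤ := fun p => D.offT (e (ix p)).1 + ((p.val : ℤ) + 1 + τ p)
  have hsucc : ∀ p (hp : p + 1 < D.uT α), c ⟨p, by omega⟩ < c ⟨p + 1, hp⟩ := by
    intro p hp
    have h1 := crossing_lt hgP (w := e (ix ⟨p, by omega⟩)) (w' := e (ix ⟨p + 1, hp⟩))
      (i := (p : ℤ) + 1) (t := τ ⟨p, by omega⟩) (t' := τ ⟨p + 1, hp⟩)
      (e.lt_iff_lt.2 (Fin.mk_lt_mk.2 (by simp only; omega)))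
      ((htgt _).trans (htgt _).symm) (hτ1 ⟨p, by omega⟩)
      ((hτ1 ⟨p + 1, hp⟩).trans (by push_cast; ring)) ((hτ2 ⟨p + 1, hp⟩).trans (by push_cast; ring))
    simp only [c]
    push_cast
    exact h1
  have hcol : ∀ p, 1 ≤ (p.val : ℤ) + 1 + τ p ∧
      (p.val : ℤ) + 1 + τ p ≤ D.mS (D.src (e (ix p)).1) := by
    intro p
    have := pageG_col hgP (e (ix p)).1 (e (ix p)).2 (τ p)
    rwa [hτ1] at this
  have hc1 : ∀ p, (p.val : ℤ) + 1 ≤ c p := by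
    intro p
    have h1 := Fin.add_sub_le_of_lt_succ hsucc (p := ⟨0, hu0⟩) (p' := p) (by simp [Fin.le_def])
    have h2 := D.offT_nonneg (e (ix ⟨0, hu0⟩)).1
    have h3 := (hcol ⟨0, hu0⟩).1
    have h4 : c ⟨0, hu0⟩ = D.offT (e (ix ⟨0, hu0⟩)).1 + (((0 : ℕ) : ℤ) + 1 + τ ⟨0, hu0⟩) := rfl
    simp only at h1 h3
    omega
  have hc2 : ∀ p, c p ≤ (D.bT α : ℤ) - D.uT α + (p.val + 1) := by
    intro p
    have hlt : D.uT α - 1 < D.uT α := by omega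
    have h1 := Fin.add_sub_le_of_lt_succ hsucc (p := p) (p' := ⟨D.uT α - 1, hlt⟩)
      (by rw [Fin.le_def]; simp only; omega)
    have h2 := D.offT_add_le_bT (e (ix ⟨D.uT α - 1, hlt⟩)).1
    rw [htgt] at h2
    have h3 := (hcol ⟨D.uT α - 1, hlt⟩).2
    have h4 : c ⟨D.uT α - 1, hlt⟩ = D.offT (e (ix ⟨D.uT α - 1, hlt⟩)).1 +
      (((D.uT α - 1 : ℕ) : ℤ) + 1 + τ ⟨D.uT α - 1, hlt⟩) := rfl
    simp only at h1 h3
    omega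
  have hmem : ∀ p, ((p.val : ℤ) + 1, c p) ∈ D.partT C α := by
    intro p
    have hp := p.2
    have hx : ((p.val : ℤ) + 1, (p.val : ℤ) + 1 + τ p, (e (ix p)).1) ∈ D.L := by
      refine ⟨by simp only; omega, ?_, hcol p⟩
      change (p.val : ℤ) + 1 ≤ D.aT (D.tgt (e (ix p)).1)
      rw [htgt]
      omega
    refine D.mem_partT.2 ⟨_, h.mem _ hx ?_ ?_, htgt p, rfl⟩
    -- At most `u - 1 - p` vertical paths come later, and only `p` rows lie above. With `p + 1 ≤ c
    -- p` the correction terms obey the same bounds, so saturation puts the point in `C`.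
    · have h1 := hg.chainSE_le h hD e he (ix p) (hτ1 p)
      have h2 := (D.partT_inBox h.subset_L α).chainNW_le_fst ((p.val : ℤ) + 1, c p)
      have h3 := hc1 p
      have h4 : ((D.vT α - 1 - (ix p).val : ℕ) : ℤ) = D.uT α - 1 - p.val := by
        simp only [ix]
        omega
      rw [rbarT_eq, sbarT_eq]
      simp only [htgt]
      change rho _ _ _ _ ((p.val : ℤ) + 1, c p) + sigma _ _ _ ((p.val : ℤ) + 1, c p) ≤ _
      change chainSE (D.partT C α) ((p.val : ℤ) + 1, c p) ≤ _ at h1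
      unfold rho sigma
      simp only at h2 ⊢
      omega
    · refine hg.bar_le h.op hD.op (D.flip_mem_L.2 hx) ⟨(e (ix p)).2, onPath_op_posT_iff.2 ?_⟩
      simp only [add_sub_cancel_left]
      exact hτ1 p
  refine ⟨c, fun p => ⟨hmem p, hc2 p, ?_⟩⟩
  obtain ⟨m, hm⟩ := p
  induction m with
  | zero => exact Nat.zero_le _
  | succ m ih =>
    exact (Nat.succ_le_succ (ih (by omega))).trans
      (chainNW_add_one_le (hmem ⟨m, by omega⟩) (by simp) (hsucc m hm))

/-- At the exceptional corner the chain of `exists_mem_row` is used: either its point in row `p + 1`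
is the corner, or that point lies further left and yields a chain of size `p + 1` north-west of the
path point just below the corner, where `rho ≤ p`. -/
theorem IsLevelMap.nwCornersMeet (hf : D.IsLevelMap C f) (hg : D.op.IsLevelMap (flipSet C) g)
    (h : D.IsSaturated C) (hD : D.Admissible) : D.NWCornersMeet f g := by
  intro x hx p hp hcorner
  suffices hmem : D.posT x ∈ D.partT C (D.tgt x.2.2) from
    hg.meets h.op (flip_mem_flipSet.2 ((D.posT_mem_partT h.subset_L hx).1 hmem))
  have hP : f (D.tgt x.2.2) p ((D.posT x).2 - (D.posT x).1) = (D.posT x).1 := hp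
  have h1 := (hf (D.tgt x.2.2)).mem_of_isNWCorner hcorner
  rw [hP, add_sub_cancel] at h1
  rcases h1 with h1 | ⟨h1, h2⟩
  · exact h1
  obtain ⟨c, hc⟩ := hg.exists_mem_row h hD (D.tgt x.2.2)
  obtain ⟨h3, h4, h5⟩ := hc p
  rcases eq_or_lt_of_le h4 with h6 | h6
  · rw [h6, ← h2, ← h1] at h3
    exact h3
  · have h7 := chainNW_add_one_le (Q := (f (D.tgt x.2.2) p ((D.posT x).2 - (D.posT x).1 - 1),
      f (D.tgt x.2.2) p ((D.posT x).2 - (D.posT x).1 - 1) + ((D.posT x).2 - (D.posT x).1 - 1))) h3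
      (by rw [hcorner.1, hP]; simp only; omega) (by rw [hcorner.1, hP]; simp only; omega)
    have h8 := (hf (D.tgt x.2.2) p ((D.posT x).2 - (D.posT x).1 - 1)).1
    unfold rho at h8
    omega

end BipartiteDatum

/-! ### The equivalences and the uniqueness of the road map. -/

theorem pathList_congr {f f' : ℤ → ℤ} {t₀ : ℤ} {m : ℕ}
    (h : ∀ P ∈ pathList f t₀ m, OnPath f' P) : pathList f t₀ m = pathList f' t₀ m := by
  unfold pathList at h ⊢
  refine List.map_congr_left fun i hi => ?_
  have := h _ (List.mem_map_of_mem hi)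
  simp only [OnPath, add_sub_cancel_left] at this
  rw [this]

theorem IsPathSystem.systemList_congr {a b u : ℕ} {f f' : Fin u → ℤ → ℤ}
    (hf : IsPathSystem a b u f) {p : Fin u}
    (h : ∀ P : ℤ × ℤ, 1 ≤ P.1 → P.1 ≤ a → 1 ≤ P.2 → P.2 ≤ b → OnPath (f p) P →
      OnPath (f' p) P) :
    systemList a b u p (f p) = systemList a b u p (f' p) := by
  refine pathList_congr fun P hP => ?_
  obtain ⟨h1, h2, h3⟩ := hf.mem_systemList.1 hP
  have h4 := hf.le_row p (P.2 - P.1)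
  have h5 := hf.row_le p (P.2 - P.1)
  have h6 := p.2
  have h7 : f p (P.2 - P.1) = P.1 := h1
  exact h P (by omega) (by omega) h2 h3 h1

namespace BipartiteDatum

variable {S T : Type*} {n : ℕ} {D : BipartiteDatum S T n}
  {f : ∀ α, Fin (D.uT α) → ℤ → ℤ} {g : ∀ β, Fin (D.uS β) → ℤ → ℤ} {C : Finset (ℤ × ℤ × Fin n)}

theorem partT_mono {C C' : Finset (ℤ × ℤ × Fin n)} (h : C ⊆ C') (α : T) :
    D.partT C α ⊆ D.partT C' α := fun P hP => by
  obtain ⟨x, hx, hP⟩ := D.mem_partT.1 hP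
  exact D.mem_partT.2 ⟨x, h hx, hP⟩

theorem flipSet_mono {C C' : Finset (ℤ × ℤ × Fin n)} (h : C ⊆ C') : flipSet C ⊆ flipSet C' :=
  fun _ hx => mem_flipSet.2 (h (mem_flipSet.1 hx))

theorem flipSet_insert (x : ℤ × ℤ × Fin n) (C : Finset (ℤ × ℤ × Fin n)) :
    flipSet (insert x C) = insert (flip x) (flipSet C) := by
  ext y
  rw [mem_flipSet, mem_insert, mem_insert, mem_flipSet, ← flip_injective.eq_iff (a := flip y)]
  rfl

theorem maxChainSize_partT_le (h : ∀ x ∈ C, D.rT C x + D.sT C x < D.uT (D.tgt x.2.2)) (α : T) :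
    maxChainSize (D.partT C α) ≤ D.uT α := by
  rw [maxChainSize_le_iff]
  intro Y hY hYc
  rcases Y.eq_empty_or_nonempty with rfl | ⟨P, hP⟩
  · simp
  · obtain ⟨x, hx, rfl, rfl⟩ := D.mem_partT.1 (hY hP)
    exact (hYc.card_le hP fun Q hQ _ => hY hQ).trans (h x hx)

theorem rT_add_sT_lt (h : ∀ α, maxChainSize (D.partT C α) ≤ D.uT α) {x : ℤ × ℤ × Fin n}
    (hx : x ∈ C) : D.rT C x + D.sT C x < D.uT (D.tgt x.2.2) :=
  (chainNW_add_chainSE_add_one_le (D.mem_partT.2 ⟨x, hx, rfl, rfl⟩)).trans (h _)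

theorem maxChainSize_partT_insert_le (h : ∀ α, maxChainSize (D.partT C α) ≤ D.uT α)
    {x : ℤ × ℤ × Fin n} (hx : D.rT C x + D.sT C x < D.uT (D.tgt x.2.2)) (α : T) :
    maxChainSize (D.partT (insert x C) α) ≤ D.uT α := by
  by_cases hα : D.tgt x.2.2 = α
  · subst hα
    refine (maxChainSize_mono fun P hP => ?_).trans
      ((maxChainSize_insert_le _ (D.posT x)).trans (max_le (h _) hx))
    obtain ⟨y, hy, h1, rfl⟩ := D.mem_partT.1 hP
    rcases mem_insert.1 hy with rfl | hy
    · exact mem_insert_self _ _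
    · exact mem_insert_of_mem (D.mem_partT.2 ⟨y, hy, h1, rfl⟩)
  · refine (maxChainSize_mono fun P hP => ?_).trans (h α)
    obtain ⟨y, hy, h1, rfl⟩ := D.mem_partT.1 hP
    rcases mem_insert.1 hy with rfl | hy
    · exact absurd h1 hα
    · exact D.mem_partT.2 ⟨y, hy, h1, rfl⟩

theorem isUCompatible_of_forall_lt (hC : (C : Set (ℤ × ℤ × Fin n)) ⊆ D.L)
    (h : ∀ x ∈ C, D.rT C x + D.sT C x < D.uT (D.tgt x.2.2) ∧
      D.rS C x + D.sS C x < D.uS (D.src x.2.2)) : D.IsUCompatible C := by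
  refine (D.isUCompatible_iff C).2 ⟨hC, maxChainSize_partT_le fun x hx => (h x hx).1,
    maxChainSize_partT_le (D := D.op) fun x hx => ?_⟩
  have := (h (flip x) (mem_flipSet.1 hx)).2
  rwa [rS_eq, sS_eq] at this

/-- A chain through `x` has at most r + s + 1 points, so the inequalities say exactly when `x` can
be added; conversely r and s only grow when the set is enlarged. -/
theorem isMaximalUCompatible_iff (hC : (C : Set (ℤ × ℤ × Fin n)) ⊆ D.L) :
    D.IsMaximalUCompatible C ↔ ∀ x ∈ D.L, (x ∈ C ↔
      D.rT C x + D.sT C x < D.uT (D.tgt x.2.2) ∧ D.rS C x + D.sS C x < D.uS (D.src x.2.2)) := by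
  have key : ∀ {C' : Finset (ℤ × ℤ × Fin n)} {x}, D.IsUCompatible C' → x ∈ C' →
      D.rT C' x + D.sT C' x < D.uT (D.tgt x.2.2) ∧
        D.rS C' x + D.sS C' x < D.uS (D.src x.2.2) := by
    intro C' x h hx
    obtain ⟨-, h1, h2⟩ := (D.isUCompatible_iff C').1 h
    rw [rS_eq, sS_eq]
    exact ⟨rT_add_sT_lt h1 hx, rT_add_sT_lt h2 (flip_mem_flipSet.2 hx)⟩
  constructor
  · rintro ⟨hcomp, hmax⟩ x hx
    refine ⟨key hcomp, fun ⟨h1, h2⟩ => ?_⟩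
    by_contra hxC
    obtain ⟨-, h3, h4⟩ := (D.isUCompatible_iff C).1 hcomp
    refine hmax ⟨insert x C, (D.isUCompatible_iff _).2
      ⟨?_, maxChainSize_partT_insert_le h3 h1, ?_⟩, ssubset_insert hxC⟩
    · rw [coe_insert]
      exact Set.insert_subset hx hC
    · rw [rS_eq, sS_eq] at h2
      rw [flipSet_insert]
      exact maxChainSize_partT_insert_le (D := D.op) h4 h2
  · intro h
    refine ⟨isUCompatible_of_forall_lt hC fun x hx => (h x (hC hx)).1 hx, ?_⟩
    rintro ⟨C', hC', hlt⟩
    obtain ⟨x, hx, hxC⟩ := exists_of_ssubset hlt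
    obtain ⟨h1, h2⟩ := key hC' hx
    refine hxC ((h x (hC'.1 hx)).2 ⟨lt_of_le_of_lt (add_le_add ?_ ?_) h1, ?_⟩)
    · exact chainNW_mono (partT_mono hlt.1 _) _
    · exact chainSE_mono (partT_mono hlt.1 _) _
    · rw [rS_eq, sS_eq] at h2 ⊢
      exact lt_of_le_of_lt (add_le_add (chainNW_mono (partT_mono (flipSet_mono hlt.1) _) _)
        (chainSE_mono (partT_mono (flipSet_mono hlt.1) _) _)) h2

theorem finite_L : D.L.Finite := by
  refine (Set.finite_iUnion fun k : Fin n => (Set.finite_Icc (1 : ℤ) (D.mT (D.tgt k))).prod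
    ((Set.finite_Icc (1 : ℤ) (D.mS (D.src k))).prod (Set.finite_singleton k))).subset
    fun x hx => ?_
  have := D.mem_L_iff.1 hx
  rw [Set.mem_iUnion]
  exact ⟨x.2.2, ⟨this.1, this.2.1⟩, ⟨this.2.2.1, this.2.2.2⟩, rfl⟩

theorem IsUCompatible.exists_maximal (h : D.IsUCompatible C) :
    ∃ C', C ⊆ C' ∧ D.IsMaximalUCompatible C' := by
  have hfin : {C' | D.IsUCompatible C'}.Finite := by
    refine Set.Finite.subset (finite_toSet (D.finite_L.toFinset.powerset)) fun C' hC' => ?_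
    rw [mem_coe, mem_powerset]
    exact fun x hx => D.finite_L.mem_toFinset.2 (hC'.1 hx)
  obtain ⟨C', hle, hmax⟩ := hfin.exists_le_maximal h
  exact ⟨C', hle, hmax.prop, fun ⟨C'', h1, h2⟩ => hmax.not_gt h1 h2⟩

theorem isSaturated_of_forall_lt (hC : (C : Set (ℤ × ℤ × Fin n)) ⊆ D.L)
    (h : ∀ x ∈ D.L, (x ∈ C ↔
      D.rT C x + D.sT C x < D.uT (D.tgt x.2.2) ∧ D.rS C x + D.sS C x < D.uS (D.src x.2.2))) :
    D.IsSaturated C := by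
  obtain ⟨-, h1, h2⟩ := (D.isUCompatible_iff C).1
    (isUCompatible_of_forall_lt hC fun x hx => (h x (hC hx)).1 hx)
  refine ⟨hC, h1, h2, fun x hx h3 h4 => (h x hx).2 ?_⟩
  have h5 := rT_le_rbarT (D := D) C x
  have h6 := sT_le_sbarT (D := D) C x
  have h7 := rT_le_rbarT (D := D.op) (flipSet C) (flip x)
  have h8 := sT_le_sbarT (D := D.op) (flipSet C) (flip x)
  rw [rS_eq, sS_eq]
  omega

theorem isSaturated_of_bar (hC : (C : Set (ℤ × ℤ × Fin n)) ⊆ D.L)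
    (h : ∀ x ∈ D.L,
      (D.rbarT C x + D.sbarT C x = (D.uT (D.tgt x.2.2) : ℤ) - 1 ∨
        D.rbarT C x + D.sbarT C x = (D.uT (D.tgt x.2.2) : ℤ)) ∧
      (D.rbarS C x + D.sbarS C x = (D.uS (D.src x.2.2) : ℤ) - 1 ∨
        D.rbarS C x + D.sbarS C x = (D.uS (D.src x.2.2) : ℤ)) ∧
      (x ∈ C ↔
        D.rbarT C x + D.sbarT C x = (D.uT (D.tgt x.2.2) : ℤ) - 1 ∧
        D.rbarS C x + D.sbarS C x = (D.uS (D.src x.2.2) : ℤ) - 1)) :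
    D.IsSaturated C := by
  have hcomp : D.IsUCompatible C := isUCompatible_of_forall_lt hC fun x hx => by
    obtain ⟨h1, h2⟩ := (h x (hC hx)).2.2.1 hx
    have h5 := rT_le_rbarT (D := D) C x
    have h6 := sT_le_sbarT (D := D) C x
    have h7 := rT_le_rbarT (D := D.op) (flipSet C) (flip x)
    have h8 := sT_le_sbarT (D := D.op) (flipSet C) (flip x)
    rw [rbarS_eq, sbarS_eq] at h2
    rw [rS_eq, sS_eq]
    omega
  obtain ⟨-, h1, h2⟩ := (D.isUCompatible_iff C).1 hcomp
  refine ⟨hC, h1, h2, fun x hx h3 h4 => ?_⟩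
  obtain ⟨h5, h6, h7⟩ := h x hx
  rw [rbarS_eq, sbarS_eq] at h6 h7
  refine h7.2 ?_
  omega

theorem IsSaturated.isConcurrentVertexMap (h : D.IsSaturated C) (hD : D.Admissible) :
    D.IsConcurrentVertexMap C := by
  obtain ⟨f, hf⟩ := h.exists_isLevelMap hD
  obtain ⟨g, hg⟩ := h.op.exists_isLevelMap hD.op
  have hfP := hf.isPathMap h hD
  have hgP := hg.isPathMap h.op hD.op
  have hf' : D.op.op.IsLevelMap (flipSet (flipSet C)) f := by rwa [flipSet_flipSet]
  have hfg := hf.nwCornersMeet hg h hD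
  have hgf := hg.nwCornersMeet hf' h.op hD.op
  obtain ⟨R, hR⟩ := exists_roadMap hD hfP hgP
  exact ⟨R, hR.isStraight_iff.2 ⟨hfg.cornersMeet hgf hfP hgP, hgf.cornersMeet hfg hgP hfP⟩,
    hR.induces_iff.2 (hf.isInducedBy hg h hD)⟩

theorem RoadMap.IsStraight.exists_paths {R : D.RoadMap} (h : R.IsStraight) (hR : R.Induces C) :
    ∃ f g, R.IsGivenBy f g ∧ D.CornersMeet f g ∧ D.op.CornersMeet g f ∧ D.IsInducedBy f g C := by
  obtain ⟨f, g, hfg⟩ := R.exists_isGivenBy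
  obtain ⟨h1, h2⟩ := hfg.isStraight_iff.1 h
  exact ⟨f, g, hfg, h1, h2, hfg.induces_iff.1 hR⟩

/-- The points of the paths of `R` are those where the bounds `r̄`, `s̄` have the expected values. -/
def RoadMap.IsDeterminedBy (R : D.RoadMap)
    (C : Finset (ℤ × ℤ × Fin n)) : Prop :=
  ∀ x ∈ D.L,
    (∀ p : Fin (D.uT (D.tgt x.2.2)), D.posT x ∈ R.H (D.tgt x.2.2) p ↔
      D.rbarT C x = (p.val + 1 : ℤ) - 1 ∧
      D.sbarT C x = (D.uT (D.tgt x.2.2) : ℤ) - (p.val + 1 : ℤ)) ∧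
    (∀ q : Fin (D.uS (D.src x.2.2)), D.posS x ∈ R.V (D.src x.2.2) q ↔
      D.rbarS C x = (q.val + 1 : ℤ) - 1 ∧
      D.sbarS C x = (D.uS (D.src x.2.2) : ℤ) - (q.val + 1 : ℤ))

theorem RoadMap.IsStraight.isDeterminedBy {R : D.RoadMap} (h : R.IsStraight) (hR : R.Induces C) :
    R.IsDeterminedBy C := by
  obtain ⟨f, g, hfg, h1, h2, hI⟩ := h.exists_paths hR
  refine fun x hx => ⟨fun p => ?_, fun q => ?_⟩
  · rw [hfg.mem_H_iff hx, h1.onPath_iff hfg.isPathMap_H hI hx, add_sub_cancel_right,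
      sub_sub, add_comm (1 : ℤ)]
  · rw [hfg.mem_V_iff hx, rbarS_eq, sbarS_eq, add_sub_cancel_right, add_comm (q.val : ℤ),
      ← sub_sub]
    exact h2.onPath_iff hfg.isPathMap_V hI.op (D.flip_mem_L.2 hx) q

/-- Every vertex of a path is the position of a point of `L`, where membership depends on `C` alone;
the endpoints are fixed, so the lists agree. -/
theorem RoadMap.IsDeterminedBy.eq {R R' : D.RoadMap} (h : R.IsDeterminedBy C)
    (h' : R'.IsDeterminedBy C) : R = R' := by
  obtain ⟨f, g, hfg⟩ := R.exists_isGivenBy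
  obtain ⟨f', g', hfg'⟩ := R'.exists_isGivenBy
  have hH : R.H = R'.H := by
    funext α p
    rw [hfg.H_eq, hfg'.H_eq]
    refine (hfg.isPathMap_H α).systemList_congr fun P h1 h2 h3 h4 hP => ?_
    obtain ⟨x, hx, rfl, rfl⟩ := D.exists_mem_L h1 h2 h3 h4
    exact (hfg'.mem_H_iff hx p).1 (((h' x hx).1 p).2 (((h x hx).1 p).1
      ((hfg.mem_H_iff hx p).2 hP)))
  have hV : R.V = R'.V := by
    funext β q
    refine List.map_injective_iff.2 Prod.swap_injective (List.reverse_injective ?_)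
    rw [hfg.V_eq, hfg'.V_eq]
    refine (hfg.isPathMap_V β).systemList_congr fun P h1 h2 h3 h4 hP => ?_
    obtain ⟨y, hy, rfl, rfl⟩ := D.op.exists_mem_L h1 h2 h3 h4
    have hx : flip y ∈ D.L := D.flip_mem_L.1 (show flip (flip y) ∈ D.op.L from hy)
    exact (hfg'.mem_V_iff hx q).1 (((h' _ hx).2 q).2 (((h _ hx).2 q).1
      ((hfg.mem_V_iff hx q).2 hP)))
  cases R
  cases R'
  simp only at hH hV
  subst hH hV
  rfl

theorem IsConcurrentVertexMap.mem_iff (h : D.IsConcurrentVertexMap C) {x : ℤ × ℤ × Fin n}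
    (hx : x ∈ D.L) : x ∈ C ↔
      D.rT C x + D.sT C x < D.uT (D.tgt x.2.2) ∧ D.rS C x + D.sS C x < D.uS (D.src x.2.2) := by
  obtain ⟨R, hstr, hind⟩ := h
  obtain ⟨f, g, hfg, h1, h2, hI⟩ := hstr.exists_paths hind
  obtain ⟨-, h3, -⟩ := h1.meets_iff hfg.isPathMap_H hI hx
  obtain ⟨-, h4, -⟩ := h2.meets_iff hfg.isPathMap_V hI.op (D.flip_mem_L.2 hx)
  rw [hI x, and_iff_right hx, h3, h4, rS_eq, sS_eq]
  exact Iff.rfl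

theorem IsConcurrentVertexMap.bar (h : D.IsConcurrentVertexMap C) {x : ℤ × ℤ × Fin n}
    (hx : x ∈ D.L) :
    (D.rbarT C x + D.sbarT C x = (D.uT (D.tgt x.2.2) : ℤ) - 1 ∨
      D.rbarT C x + D.sbarT C x = (D.uT (D.tgt x.2.2) : ℤ)) ∧
    (D.rbarS C x + D.sbarS C x = (D.uS (D.src x.2.2) : ℤ) - 1 ∨
      D.rbarS C x + D.sbarS C x = (D.uS (D.src x.2.2) : ℤ)) ∧
    (x ∈ C ↔
      D.rbarT C x + D.sbarT C x = (D.uT (D.tgt x.2.2) : ℤ) - 1 ∧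
      D.rbarS C x + D.sbarS C x = (D.uS (D.src x.2.2) : ℤ) - 1) := by
  obtain ⟨R, hstr, hind⟩ := h
  obtain ⟨f, g, hfg, h1, h2, hI⟩ := hstr.exists_paths hind
  obtain ⟨h3, -, h4⟩ := h1.meets_iff hfg.isPathMap_H hI hx
  obtain ⟨h5, -, h6⟩ := h2.meets_iff hfg.isPathMap_V hI.op (D.flip_mem_L.2 hx)
  rw [hI x, and_iff_right hx, h3, h5, rbarS_eq, sbarS_eq]
  exact ⟨h4, h6, Iff.rfl⟩

theorem IsConcurrentVertexMap.card_eq [Fintype S] [Fintype T] (h : D.IsConcurrentVertexMap C)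
    (hD : D.Admissible) : (C.card : ℤ) = D.N := by
  obtain ⟨R, hstr, hind⟩ := h
  obtain ⟨f, g, hfg, h1, h2, hI⟩ := hstr.exists_paths hind
  exact card_eq_N hfg.isPathMap_H hfg.isPathMap_V
    (h1.nwCornersMeet hfg.isPathMap_H hfg.isPathMap_V fun β => (hD.2 β).1)
    (h2.nwCornersMeet hfg.isPathMap_V hfg.isPathMap_H fun α => (hD.1 α).1) hI

theorem IsConcurrentVertexMap.isMaximalUCompatible (h : D.IsConcurrentVertexMap C)
    (hC : (C : Set (ℤ × ℤ × Fin n)) ⊆ D.L) : D.IsMaximalUCompatible C :=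
  (isMaximalUCompatible_iff hC).2 fun _ hx => h.mem_iff hx

theorem IsMaximalUCompatible.isConcurrentVertexMap (h : D.IsMaximalUCompatible C)
    (hD : D.Admissible) : D.IsConcurrentVertexMap C :=
  (isSaturated_of_forall_lt h.1.1 ((isMaximalUCompatible_iff h.1.1).1 h)).isConcurrentVertexMap hD

/-- A maximal compatible set containing `C` is a concurrent vertex map, hence has `N` points, as
many as `C`. -/
theorem IsUCompatible.isMaximalUCompatible [Fintype S] [Fintype T] (h : D.IsUCompatible C)
    (hD : D.Admissible) (hcard : (C.card : ℤ) = D.N) : D.IsMaximalUCompatible C := by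
  obtain ⟨C', hle, hmax⟩ := h.exists_maximal
  have h1 := (hmax.isConcurrentVertexMap hD).card_eq hD
  rw [eq_of_subset_of_card_le hle (by omega)]
  exact hmax

end BipartiteDatum

end

theorem mainTheorem2 {S T : Type*} [Fintype S] [Fintype T] {n : ℕ}
    (D : BipartiteDatum S T n) (hD : D.Admissible)
    (C : Finset (ℤ × ℤ × Fin n)) (hC : (C : Set (ℤ × ℤ × Fin n)) ⊆ D.L) :
    List.TFAE [
      D.IsConcurrentVertexMap C,
      D.IsMaximalUCompatible C,
      D.IsUCompatible C ∧ (C.card : ℤ) = D.N,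
      ∀ x ∈ D.L, (x ∈ C ↔
        D.rT C x + D.sT C x < D.uT (D.tgt x.2.2) ∧ D.rS C x + D.sS C x < D.uS (D.src x.2.2)),
      ∀ x ∈ D.L,
        (D.rbarT C x + D.sbarT C x = (D.uT (D.tgt x.2.2) : ℤ) - 1 ∨
          D.rbarT C x + D.sbarT C x = (D.uT (D.tgt x.2.2) : ℤ)) ∧
        (D.rbarS C x + D.sbarS C x = (D.uS (D.src x.2.2) : ℤ) - 1 ∨
          D.rbarS C x + D.sbarS C x = (D.uS (D.src x.2.2) : ℤ)) ∧
        (x ∈ C ↔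
          D.rbarT C x + D.sbarT C x = (D.uT (D.tgt x.2.2) : ℤ) - 1 ∧
          D.rbarS C x + D.sbarS C x = (D.uS (D.src x.2.2) : ℤ) - 1)] ∧
    (D.IsConcurrentVertexMap C →
      (∃! R : D.RoadMap, R.IsStraight ∧ R.Induces C) ∧
      ∀ R : D.RoadMap, (R.IsStraight ∧ R.Induces C) ↔
        ∀ x ∈ D.L,
          (∀ p : Fin (D.uT (D.tgt x.2.2)), D.posT x ∈ R.H (D.tgt x.2.2) p ↔
            D.rbarT C x = (p.val + 1 : ℤ) - 1 ∧
            D.sbarT C x = (D.uT (D.tgt x.2.2) : ℤ) - (p.val + 1 : ℤ)) ∧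
          (∀ q : Fin (D.uS (D.src x.2.2)), D.posS x ∈ R.V (D.src x.2.2) q ↔
            D.rbarS C x = (q.val + 1 : ℤ) - 1 ∧
            D.sbarS C x = (D.uS (D.src x.2.2) : ℤ) - (q.val + 1 : ℤ))) := by
  constructor
  · tfae_have 1 → 2 := fun h => h.isMaximalUCompatible hC
    tfae_have 2 → 1 := fun h => h.isConcurrentVertexMap hD
    tfae_have 2 ↔ 4 := BipartiteDatum.isMaximalUCompatible_iff hC
    tfae_have 1 → 3 := fun h => ⟨(h.isMaximalUCompatible hC).1, h.card_eq hD⟩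
    tfae_have 3 → 2 := fun h => h.1.isMaximalUCompatible hD h.2
    tfae_have 1 → 5 := fun h _ hx => h.bar hx
    tfae_have 5 → 1 := fun h => (BipartiteDatum.isSaturated_of_bar hC h).isConcurrentVertexMap hD
    tfae_finish
  · rintro ⟨R, hR⟩
    have hdet := hR.1.isDeterminedBy hR.2
    refine ⟨⟨R, hR, fun R' hR' => (hR'.1.isDeterminedBy hR'.2).eq hdet⟩, fun R' => ⟨fun hR' =>
      hR'.1.isDeterminedBy hR'.2, fun hR' => ?_⟩⟩
    rwa [BipartiteDatum.RoadMap.IsDeterminedBy.eq hR' hdet]
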